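/- **Proposition (Concentration-Compactness Principle).** Let $s\in(0,1)$, $n\in\mathbb N$ with $n>2s$, $a:=1-2s$, $2^*_s:=\frac{2n}{n-2s}$ and $\mathbb R^{n+1}_+:=\{(x,y):x\in\mathbb R^n,\ y>0\}$. Let $\dot H^s_a(\mathbb R^{n+1})$ be the completion (as a space of functions) of $C_0^\infty(\mathbb R^{n+1})$ in the norm $\big(\int_{\mathbb R^{n+1}}|y|^a|\nabla U|^2\,dX\big)^{1/2}$, and let $\dot H^s_a(\mathbb R^{n+1}_+)$ be the Hilbert space of the restrictions to $\mathbb R^{n+1}_+$ of those $\tilde U\in \dot H^s_a(\mathbb R^{n+1})$ with $\tilde U(x,y)=\tilde U(x,-y)$ a.e., with norm $[U]_a:=\big(\int_{\mathbb R^{n+1}_+}y^a|\nabla U|^2\,dX\big)^{1/2}$. Let $U(\cdot,0)\in L^{2^*_s}(\mathbb R^n)$ denote the trace of $U$, that is, the image of $U$ under the continuous extension of $\varphi\mapsto\varphi(\cdot,0)$ from smooth functions, and let $S$ be the best constant in the trace inequality $$S\,\|U(\cdot,0)\|^2_{L^{2^*_s}(\mathbb R^n)}\le [U]_a^2,\qquad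 U\in\dot H^s_a(\mathbb R^{n+1}_+).$$ Let $\{U_k\}_{k\in\mathbb N}$ be a bounded sequence in $\dot H^s_a(\mathbb R^{n+1}_+)$ that is tight, i.e. for every $\eta>0$ there is $\rho>0$ with $\int_{\mathbb R^{n+1}_+\setminus B_\rho(0)}y^a|\nabla U_k|^2\,dX\le\eta$ for all $k$, and that converges weakly in $\dot H^s_a(\mathbb R^{n+1}_+)$ to some $U$. Let $\mu$ and $\nu$ be nonnegative Radon measures on $\overline{\mathbb R^{n+1}_+}=\mathbb R^n\times[0,\infty)$ and on $\mathbb R^n$ respectively, such that, as $k\to\infty$, $$y^a|\nabla U_k|^2\,dX\to\mu\qquad\text{and}\qquad |U_k(x,0)|^{2^*_s}\,dx\to\nu$$ in the sense of measures, i.e. the integrals of every continuous compactly supported function on $\overline{\mathbb R^{n+1}_+}$, respectively on $\mathbb R^n$, converge. Then there exist an at most countable set $J$ and families $\{x_j\}_{j\in J}$ of distinct points of $\mathbb R^n$ and $\{\nu_j\}_{j\in J}$, $\{\mu_j\}_{j\in J}$ of real numbers, $\nu_j,\mu_j\ge0$, such that (i) $\displaystyle \nu=|U(x,0)|^{2^*_s}\,dx+\sum_{j\in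 J}\nu_j\delta_{x_j}$, (ii) $\displaystyle \mu\ge y^a|\nabla U|^2\,dX+\sum_{j\in J}\mu_j\delta_{(x_j,0)}$, (iii) $\mu_j\ge S\,\nu_j^{2/2^*_s}$ for all $j\in J$. -/

import Mathlib

open MeasureTheory Filter Topology
open scoped ContDiff ENNReal

noncomputable section

namespace CCP

/-- Euclidean space `ℝⁿ`. -/
abbrev E (n : ℕ) : Type := EuclideanSpace ℝ (Fin n)

/-- Euclidean space `ℝⁿ⁺¹ = ℝⁿ × ℝ`; its points are `X = (x, y)` with `x = X.fst`, `y = X.snd`.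
The norm is the Euclidean one and `volume` is Lebesgue measure. -/
abbrev X (n : ℕ) : Type := WithLp 2 (E n × ℝ)

/-- The point `(x, y)` of `ℝⁿ⁺¹`. -/
def pt {n : ℕ} (x : E n) (y : ℝ) : X n := WithLp.toLp 2 (x, y)

/-- The open half-space `ℝⁿ⁺¹₊ = ℝⁿ × (0, ∞)`. -/
def half (n : ℕ) : Set (X n) := {P | 0 < P.snd}

/-- The closed half-space `ℝⁿ × [0, ∞)`. -/
def closedHalf (n : ℕ) : Set (X n) := {P | 0 ≤ P.snd}

/-- The weight `|y|^a` with `a = 1 - 2 s`. -/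
def weight {n : ℕ} (s : ℝ) (P : X n) : ℝ := |P.snd| ^ (1 - 2 * s)

/-- The fractional critical exponent `2^*_s = 2 n / (n - 2 s)`. -/
def critExp (n : ℕ) (s : ℝ) : ℝ := 2 * n / (n - 2 * s)

/-- The class `C_0^∞(ℝⁿ⁺¹)` of smooth compactly supported functions. -/
def IsTest {n : ℕ} (φ : X n → ℝ) : Prop := ContDiff ℝ ∞ φ ∧ HasCompactSupport φ

/-- `∫ |y|^a |∇φ|² dX` over the whole of `ℝⁿ⁺¹`, for a smooth function `φ`. -/
def energyWhole {n : ℕ} (s : ℝ) (φ : X n → ℝ) : ℝ≥0∞ :=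
  ∫⁻ P : X n, ENNReal.ofReal (weight s P * ‖gradient φ P‖ ^ 2)

/-- The sequence `φ` of functions in `C_0^∞(ℝⁿ⁺¹)` is Cauchy for the norm
`(∫ |y|^a |∇φ|² dX)^(1/2)`, and `W` is the function it represents, that is, its limit in `L¹_loc`.
(As `n > 2 s`, the weighted Sobolev inequality and `a ∈ (-1, 1)` show that each Cauchy sequence
has a limit in `L¹_loc`, and that two Cauchy sequences have the same limit iff they are
equivalent.) -/
structure IsApprox {n : ℕ} (s : ℝ) (φ : ℕ → X n → ℝ) (W : X n → ℝ) : Prop where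
  test : ∀ k, IsTest (φ k)
  cauchy : ∀ ε : ℝ, 0 < ε → ∃ N : ℕ, ∀ j ≥ N, ∀ k ≥ N,
    energyWhole s (fun P => φ j P - φ k P) ≤ ENNReal.ofReal ε
  locallyIntegrable : LocallyIntegrable W volume
  tendsto : ∀ K : Set (X n), IsCompact K →
    Tendsto (fun k => ∫⁻ P in K, ‖φ k P - W P‖ₑ) atTop (𝓝 0)

/-- `W ∈ Ḣ^s_a(ℝⁿ⁺¹)`: the completion of `C_0^∞(ℝⁿ⁺¹)` as a space of functions. -/
def MemWhole {n : ℕ} (s : ℝ) (W : X n → ℝ) : Prop := ∃ φ : ℕ → X n → ℝ, IsApprox s φ W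

/-- `W` belongs to `Ḣ^s_a(ℝⁿ⁺¹)`, is even in `y`, and restricts to `U` on `ℝⁿ⁺¹₊`. -/
structure IsEvenExt {n : ℕ} (s : ℝ) (W U : X n → ℝ) : Prop where
  mem : MemWhole s W
  even : ∀ᵐ P : X n, W P = W (pt P.fst (-P.snd))
  restrict : ∀ᵐ P ∂((volume : Measure (X n)).restrict (half n)), U P = W P

/-- `U ∈ Ḣ^s_a(ℝⁿ⁺¹₊)`. Only the values of `U` on the open half-space matter. -/
def MemHalf {n : ℕ} (s : ℝ) (U : X n → ℝ) : Prop := ∃ W : X n → ℝ, IsEvenExt s W U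

/-- `G` is the weak gradient of `U` in the open half-space `ℝⁿ⁺¹₊`. -/
structure IsWeakGrad {n : ℕ} (U : X n → ℝ) (G : X n → X n) : Prop where
  locInt : LocallyIntegrableOn U (half n) volume
  locInt_grad : LocallyIntegrableOn G (half n) volume
  integral_eq : ∀ ψ : X n → ℝ, IsTest ψ → tsupport ψ ⊆ half n → ∀ e : X n,
    ∫ P in half n, U P * fderiv ℝ ψ P e = - ∫ P in half n, inner ℝ (G P) e * ψ P

open Classical in
/-- The weak gradient `∇U` in the open half-space (unique up to null sets where it exists). -/
def grad {n : ℕ} (U : X n → ℝ) : X n → X n :=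
  if h : ∃ G, IsWeakGrad U G then h.choose else 0

/-- `u` is the trace `U(·, 0)`: the limit in `L^{2^*_s}(ℝⁿ)` of `φ_k(·, 0)`, for test functions
`φ_k` that converge to an even extension of `U` in `Ḣ^s_a(ℝⁿ⁺¹)`. -/
def IsTrace {n : ℕ} (s : ℝ) (U : X n → ℝ) (u : E n → ℝ) : Prop :=
  AEStronglyMeasurable u volume ∧
  ∃ (W : X n → ℝ) (φ : ℕ → X n → ℝ), IsEvenExt s W U ∧ IsApprox s φ W ∧
    Tendsto (fun k => eLpNorm (fun x => φ k (pt x 0) - u x) (ENNReal.ofReal (critExp n s)) volume)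
      atTop (𝓝 0)

open Classical in
/-- The trace `U(·, 0)` of `U ∈ Ḣ^s_a(ℝⁿ⁺¹₊)` (unique up to null sets). -/
def trace {n : ℕ} (s : ℝ) (U : X n → ℝ) : E n → ℝ :=
  if h : ∃ u, IsTrace s U u then h.choose else 0

/-- The inner product `∫ y^a ⟨∇U, ∇V⟩ dX` over `ℝⁿ⁺¹₊`. -/
def innerHalf {n : ℕ} (s : ℝ) (U V : X n → ℝ) : ℝ :=
  ∫ P in half n, weight s P * inner ℝ (grad U P) (grad V P)

/-- The norm `[U]_a = (∫ y^a |∇U|² dX)^(1/2)` of `Ḣ^s_a(ℝⁿ⁺¹₊)`. -/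
def normHalf {n : ℕ} (s : ℝ) (U : X n → ℝ) : ℝ :=
  Real.sqrt (∫ P in half n, weight s P * ‖grad U P‖ ^ 2)

/-- The norm `‖U(·, 0)‖` in `L^{2^*_s}(ℝⁿ)`. -/
def normTrace {n : ℕ} (s : ℝ) (U : X n → ℝ) : ℝ :=
  (eLpNorm (trace s U) (ENNReal.ofReal (critExp n s)) volume).toReal

/-- The best constant `S` in `S ‖U(·, 0)‖²_{L^{2^*_s}} ≤ [U]_a²`, `U ∈ Ḣ^s_a(ℝⁿ⁺¹₊)`. -/
def sobolevConst (n : ℕ) (s : ℝ) : ℝ :=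
  sInf {t : ℝ | ∃ U : X n → ℝ, MemHalf s U ∧ normTrace s U ≠ 0 ∧
    t = normHalf s U ^ 2 / normTrace s U ^ 2}

/-- A sequence is bounded in `Ḣ^s_a(ℝⁿ⁺¹₊)`. -/
def IsBoundedSeq {n : ℕ} (s : ℝ) (U : ℕ → X n → ℝ) : Prop :=
  ∃ C : ℝ, ∀ k, normHalf s (U k) ≤ C

/-- A sequence is tight: the energies outside half-balls `B_ρ^+` are uniformly small. -/
def IsTightSeq {n : ℕ} (s : ℝ) (U : ℕ → X n → ℝ) : Prop :=
  ∀ η : ℝ, 0 < η → ∃ ρ : ℝ, 0 < ρ ∧ ∀ k,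
    ∫ P in half n \ Metric.ball 0 ρ, weight s P * ‖grad (U k) P‖ ^ 2 ≤ η

/-- Weak convergence `U_k ⇀ V` in the Hilbert space `Ḣ^s_a(ℝⁿ⁺¹₊)`. -/
def WeaklyTendsto {n : ℕ} (s : ℝ) (U : ℕ → X n → ℝ) (V : X n → ℝ) : Prop :=
  ∀ Φ : X n → ℝ, MemHalf s Φ →
    Tendsto (fun k => innerHalf s (U k) Φ) atTop (𝓝 (innerHalf s V Φ))

/-- Convergence of measures tested against continuous functions with compact support. -/
def MeasTendsto {Y : Type*} [TopologicalSpace Y] [MeasurableSpace Y]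
    (m : ℕ → Measure Y) (m' : Measure Y) : Prop :=
  ∀ φ : Y → ℝ, Continuous φ → HasCompactSupport φ →
    Tendsto (fun k => ∫ x, φ x ∂(m k)) atTop (𝓝 (∫ x, φ x ∂m'))

/-- The measure `y^a |∇U|² dX` of `ℝⁿ⁺¹₊`, as a measure on `ℝⁿ⁺¹` carried by the half-space. -/
def energyMeas {n : ℕ} (s : ℝ) (U : X n → ℝ) : Measure (X n) :=
  ((volume : Measure (X n)).restrict (half n)).withDensity
    (fun P => ENNReal.ofReal (weight s P * ‖grad U P‖ ^ 2))

/-- The measure `|U(·, 0)|^{2^*_s} dx` on `ℝⁿ`. -/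
def traceMeas {n : ℕ} (s : ℝ) (U : X n → ℝ) : Measure (E n) :=
  (volume : Measure (E n)).withDensity
    (fun x => ENNReal.ofReal (|trace s U x| ^ critExp n s))

end CCP

end

open MeasureTheory Filter Topology
open scoped ContDiff ENNReal

noncomputable section

namespace CCP

variable {n : ℕ} {s : ℝ}

/-! Write p = 2n/(n - 2s) and τ = |V(x,0)|^p dx. The trace inequality is applied to η(U_k - V) for
an even test function η. Its energy is ∫ y^a η²|∇(U_k - V)|², up to the contribution of (U_k - V)∇η,
which disappears because U_k - V tends to 0 in weighted L² on bounded sets. By weak convergence the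
main term tends to ∫ η² dμ - ∫ y^a η²|∇V|², which is at most ∫ η² dμ. The triangle inequality in L^p
then compares ‖η(·,0)‖ in L^p(ν) and in L^p(τ), in both directions, with the error ‖η‖ in L²(μ)
(`eLpNorm_cutoff_le`). Since τ stays in the inequality, no lemma of Brezis-Lieb type is needed.

Shrinking the cutoffs turns this into a ν(B)^(1/p) ≤ a τ(B)^(1/p) + κ(B)^(1/2), and its mirror
image, for Borel sets B, where κ is the part of μ on the boundary hyperplane
(`rpow_measure_compact_le`, `rpow_measure_le`). Where κ has no atoms, B can be cut into pieces of
κ-mass at most ε. Adding p-th powers over the pieces, Minkowski's inequality leaves an error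
governed by ε^(p/2-1) κ(B), which vanishes as p > 2. Hence ν = τ off the countable set of atoms of κ
(`measure_univ_le_of_rpow_le`, `restrict_compl_eq_of_rpow_le`), and since τ has no atoms this is
(i). The inequality at a single point, with a = √S, is (iii). Statement (ii) is weak lower
semicontinuity (`energyMeas_le`), plus the fact that y^a|∇V|² dX does not charge the boundary.

Two analytic facts carry the argument: a trace inequality with some finite constant, and local
compactness. Both come from comparing φ(P) with the integral of φ over P + rζ, where ζ runs through
a bounded set of directions pointing into the half-space. The difference is small in L² of
horizontal slices when r is small; the integral itself is bounded pointwise by the energy, because n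
> 2s. Choosing r according to the energy gives a weak-type trace inequality, and Maz'ya's truncation
at dyadic levels makes it strong (`exists_trace_le`). For fixed r the integral is a continuous
linear functional of the gradient, so it tends to 0 under weak convergence; this gives compactness
(`tendsto_lintegral_box`). -/

/-- Cauchy-Schwarz, with `f` only dominated by the geometric mean of `v` and `h`: no measurability
of `f` is needed. -/
lemma lintegral_sq_le_mul {α : Type*} [MeasurableSpace α] {μ : Measure α} {f v h : α → ℝ≥0∞}
    (hv : AEMeasurable v μ) (hh : AEMeasurable h μ) (hf : ∀ᵐ x ∂μ, f x ^ 2 ≤ v x * h x) :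
    (∫⁻ x, f x ∂μ) ^ 2 ≤ (∫⁻ x, v x ∂μ) * ∫⁻ x, h x ∂μ := by
  have h1 : ∫⁻ x, f x ∂μ ≤ ∫⁻ x, v x ^ (1 / 2 : ℝ) * h x ^ (1 / 2 : ℝ) ∂μ := by
    refine lintegral_mono_ae (hf.mono fun x hx => ?_)
    rw [← ENNReal.mul_rpow_of_nonneg _ _ (by norm_num)]
    calc f x = (f x ^ 2) ^ (1 / 2 : ℝ) := by
          rw [← ENNReal.rpow_natCast, ← ENNReal.rpow_mul]; norm_num
      _ ≤ _ := by gcongr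
  have h2 := ENNReal.lintegral_mul_le_Lp_mul_Lq μ (Real.HolderConjugate.two_two)
    (hv.pow_const (1 / 2 : ℝ)) (hh.pow_const (1 / 2 : ℝ))
  have h3 : ∀ a : ℝ≥0∞, (a ^ (1 / 2 : ℝ)) ^ (2 : ℝ) = a := fun a => by
    rw [← ENNReal.rpow_mul]; norm_num
  have h4 : ∀ a : ℝ≥0∞, (a ^ (1 / 2 : ℝ)) ^ 2 = a := fun a => by
    rw [← ENNReal.rpow_natCast, ← ENNReal.rpow_mul]; norm_num
  simp only [Pi.mul_apply, h3] at h2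
  calc (∫⁻ x, f x ∂μ) ^ 2
      ≤ ((∫⁻ x, v x ∂μ) ^ (1 / 2 : ℝ) * (∫⁻ x, h x ∂μ) ^ (1 / 2 : ℝ)) ^ 2 := by
        gcongr; exact h1.trans h2
    _ = _ := by rw [mul_pow, h4, h4]

/-! ### Line integrals along rays. -/

section Ray

variable {F : Type*} [NormedAddCommGroup F] [NormedSpace ℝ F] {φ : F → ℝ}

lemma hasDerivAt_ray (hφ : ContDiff ℝ 1 φ) (P ζ : F) (t : ℝ) :
    HasDerivAt (fun t : ℝ => φ (P + t • ζ)) (fderiv ℝ φ (P + t • ζ) ζ) t := by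
  have h1 : HasFDerivAt φ (fderiv ℝ φ (P + t • ζ)) (P + t • ζ) :=
    (hφ.differentiable (by simp) (P + t • ζ)).hasFDerivAt
  have h2 : HasDerivAt (fun t : ℝ => P + t • ζ) ζ t := by
    have := ((hasDerivAt_id t).smul_const ζ).const_add P
    rwa [one_smul] at this
  exact HasFDerivAt.comp_hasDerivAt t h1 h2

lemma continuous_ray_deriv (hφ : ContDiff ℝ 1 φ) (P ζ : F) :
    Continuous fun t : ℝ => fderiv ℝ φ (P + t • ζ) ζ := by
  have := hφ.continuous_fderiv (by simp)
  fun_prop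

lemma integral_ray (hφ : ContDiff ℝ 1 φ) (P ζ : F) {r : ℝ} (hr : 0 ≤ r) :
    ∫ t in Set.Ioc 0 r, fderiv ℝ φ (P + t • ζ) ζ = φ (P + r • ζ) - φ P := by
  have h1 := intervalIntegral.integral_eq_sub_of_hasDerivAt (a := 0) (b := r)
    (fun t _ => hasDerivAt_ray hφ P ζ t) ((continuous_ray_deriv hφ P ζ).intervalIntegrable _ _)
  rwa [intervalIntegral.integral_of_le hr, zero_smul, add_zero] at h1

lemma integral_Ioi_ray (hφ : ContDiff ℝ 1 φ) (hc : HasCompactSupport φ) (P : F) {ζ : F}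
    (hζ : ζ ≠ 0) (r : ℝ) :
    ∫ t in Set.Ioi r, fderiv ℝ φ (P + t • ζ) ζ = - φ (P + r • ζ) := by
  have hemb : Topology.IsClosedEmbedding (fun t : ℝ => P + t • ζ) :=
    (Homeomorph.addLeft P).isClosedEmbedding.comp (isClosedEmbedding_smul_left hζ)
  have hc : HasCompactSupport (fun t : ℝ => φ (P + t • ζ)) := hc.comp_isClosedEmbedding hemb
  have hd : ContDiff ℝ 1 (fun t : ℝ => φ (P + t • ζ)) :=
    hφ.comp (contDiff_const.add (contDiff_id.smul contDiff_const))
  rw [← hc.integral_Ioi_deriv_eq hd r]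
  simp_rw [(hasDerivAt_ray hφ P ζ _).deriv]

end Ray

/-! ### Cone averages: near and far estimates. -/

/-- The energy `∫ y^a |∇φ|² dX` over the half-space, for a smooth function `φ`. -/
def halfEnergy (s : ℝ) (φ : X n → ℝ) : ℝ≥0∞ :=
  ∫⁻ P in half n, ENNReal.ofReal (weight s P) * ‖gradient φ P‖ₑ ^ 2

/-- The directions along which test functions are averaged. -/
def cone (n : ℕ) : Set (X n) := {ζ | ‖ζ.fst‖ < 1 ∧ 1 < ζ.snd ∧ ζ.snd < 2}

lemma continuous_fst : Continuous (fun P : X n => P.fst) := by fun_prop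
lemma continuous_snd : Continuous (fun P : X n => P.snd) := by fun_prop

lemma isOpen_half : IsOpen (half n) := isOpen_lt continuous_const continuous_snd

lemma isOpen_cone : IsOpen (cone n) :=
  (isOpen_lt continuous_fst.norm continuous_const).inter
    ((isOpen_lt continuous_const continuous_snd).inter (isOpen_lt continuous_snd continuous_const))

lemma measurableSet_half : MeasurableSet (half n) := isOpen_half.measurableSet
lemma measurableSet_cone : MeasurableSet (cone n) := isOpen_cone.measurableSet

lemma norm_le_of_mem_cone {ζ : X n} (h : ζ ∈ cone n) : ‖ζ‖ ≤ 3 := by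
  obtain ⟨h1, h2, h3⟩ := h
  have := WithLp.prod_norm_sq_eq_of_L2 ζ
  have h4 : ‖ζ.snd‖ ≤ 2 := by rw [Real.norm_eq_abs, abs_le]; constructor <;> linarith
  have := norm_nonneg ζ.fst
  have := norm_nonneg ζ.snd
  nlinarith [norm_nonneg ζ]

lemma volume_cone_lt_top : volume (cone n) < ⊤ :=
  (measure_mono fun ζ h => by simpa using norm_le_of_mem_cone h :
    volume (cone n) ≤ volume (Metric.closedBall (0 : X n) 3)).trans_lt measure_closedBall_lt_top

lemma volume_cone_pos : 0 < volume (cone n) := by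
  refine isOpen_cone.measure_pos volume ⟨pt 0 (3 / 2), ?_⟩
  simp [cone, pt]; norm_num

lemma measurable_weight : Measurable (weight s : X n → ℝ) := by
  unfold weight
  exact (continuous_snd.measurable.abs).pow_const _

lemma continuous_gradient {φ : X n → ℝ} (hφ : IsTest φ) : Continuous (gradient φ) := by
  have := hφ.1.continuous_fderiv (by simp)
  exact (InnerProductSpace.toDual ℝ (X n)).symm.continuous.comp this

lemma enorm_gradient (φ : X n → ℝ) (P : X n) : ‖gradient φ P‖ₑ = ‖fderiv ℝ φ P‖ₑ := by
  simp [gradient]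

lemma norm_gradient (φ : X n → ℝ) (P : X n) : ‖gradient φ P‖ = ‖fderiv ℝ φ P‖ := by
  simp [gradient]

lemma enorm_fderiv_apply_le {φ : X n → ℝ} {ζ : X n} (hζ : ζ ∈ cone n) (P : X n) :
    ‖fderiv ℝ φ P ζ‖ₑ ≤ 3 * ‖gradient φ P‖ₑ := by
  rw [enorm_gradient, mul_comm]
  refine ((fderiv ℝ φ P).le_opENorm ζ).trans ?_
  gcongr
  rw [← ofReal_norm, show (3 : ℝ≥0∞) = ENNReal.ofReal 3 by norm_num]
  exact ENNReal.ofReal_le_ofReal (norm_le_of_mem_cone hζ)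

lemma IsTest.contDiff_one {φ : X n → ℝ} (hφ : IsTest φ) : ContDiff ℝ 1 φ := hφ.1.of_le (by simp)

lemma enorm_near_le {φ : X n → ℝ} (hφ : IsTest φ) (P : X n) {ζ : X n} (hζ : ζ ∈ cone n)
    {r : ℝ} (hr : 0 ≤ r) :
    ‖φ P - φ (P + r • ζ)‖ₑ ≤ 3 * ∫⁻ t in Set.Ioc 0 r, ‖gradient φ (P + t • ζ)‖ₑ := by
  rw [← enorm_neg, neg_sub, ← integral_ray hφ.contDiff_one P ζ hr,
    ← lintegral_const_mul' _ _ (by simp)]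
  exact (enorm_integral_le_lintegral_enorm _).trans
    (lintegral_mono fun t => enorm_fderiv_apply_le hζ _)

/-- The ray eventually leaves the compact support, so the value at its starting point is minus the
integral of the derivative along all of it. -/
lemma enorm_far_le {φ : X n → ℝ} (hφ : IsTest φ) (P : X n) {ζ : X n} (hζ : ζ ∈ cone n)
    (r : ℝ) :
    ‖φ (P + r • ζ)‖ₑ ≤ 3 * ∫⁻ t in Set.Ioi r, ‖gradient φ (P + t • ζ)‖ₑ := by
  have hζ0 : ζ ≠ 0 := by
    rintro rfl
    have := hζ.2.1
    simp at this
    linarith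
  rw [← enorm_neg, ← integral_Ioi_ray hφ.contDiff_one hφ.2 P hζ0 r,
    ← lintegral_const_mul' _ _ (by simp)]
  exact (enorm_integral_le_lintegral_enorm _).trans
    (lintegral_mono fun t => enorm_fderiv_apply_le hζ _)

lemma lintegral_comp_add_smul {F : Type*} [NormedAddCommGroup F] [NormedSpace ℝ F]
    [FiniteDimensional ℝ F] [MeasurableSpace F] [BorelSpace F] (μ : Measure F)
    [μ.IsAddHaarMeasure] {f : F → ℝ≥0∞} (hf : Measurable f) (P : F) {r : ℝ} (hr : r ≠ 0) :
    ∫⁻ ζ, f (P + r • ζ) ∂μ =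
      ENNReal.ofReal |(r ^ Module.finrank ℝ F)⁻¹| * ∫⁻ Y, f Y ∂μ := by
  have h1 : ∫⁻ ζ, f (P + r • ζ) ∂μ = ∫⁻ η, f (P + η) ∂(μ.map (r • ·)) :=
    (lintegral_map (hf.comp (measurable_const_add P)) (measurable_const_smul r)).symm
  rw [h1, Measure.map_addHaar_smul μ hr, lintegral_smul_measure, lintegral_add_left_eq_self,
    smul_eq_mul]

lemma continuous_pt : Continuous (fun q : E n × ℝ => pt q.1 q.2) :=
  WithLp.prod_continuous_toLp 2 (E n) ℝ

lemma measurable_pt_uncurry : Measurable (fun q : E n × ℝ => pt q.1 q.2) :=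
  continuous_pt.measurable

lemma continuous_pt_add_smul (y : ℝ) :
    Continuous fun q : (E n × X n) × ℝ => pt q.1.1 y + q.2 • q.1.2 :=
  (continuous_pt.comp (f := fun q : (E n × X n) × ℝ => (q.1.1, y)) (by fun_prop)).add
    (by fun_prop)

lemma lintegral_eq_lintegral_pt {f : X n → ℝ≥0∞} (hf : Measurable f) :
    ∫⁻ P, f P = ∫⁻ y : ℝ, ∫⁻ x : E n, f (pt x y) := by
  rw [← (WithLp.volume_preserving_toLp (E n) ℝ).lintegral_comp hf, Measure.volume_eq_prod]
  exact lintegral_prod_symm' _ (hf.comp measurable_pt_uncurry)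

lemma lintegral_half {f : X n → ℝ≥0∞} (hf : Measurable f) :
    ∫⁻ P in half n, f P = ∫⁻ y in Set.Ioi (0 : ℝ), ∫⁻ x : E n, f (pt x y) := by
  rw [← lintegral_indicator measurableSet_half, ← lintegral_indicator measurableSet_Ioi,
    lintegral_eq_lintegral_pt (hf.indicator measurableSet_half)]
  refine lintegral_congr fun y => ?_
  by_cases hy : 0 < y
  · rw [Set.indicator_of_mem (Set.mem_Ioi.2 hy)]
    exact lintegral_congr fun x => Set.indicator_of_mem (show pt x y ∈ half n from hy) _
  · rw [Set.indicator_of_notMem (by simpa using hy)]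
    exact (lintegral_congr fun x =>
      Set.indicator_of_notMem (show pt x y ∉ half n from hy) _).trans (by simp)

lemma measurable_density {φ : X n → ℝ} (hφ : IsTest φ) :
    Measurable fun P : X n => ENNReal.ofReal (weight s P) * ‖gradient φ P‖ₑ ^ 2 :=
  measurable_weight.ennreal_ofReal.mul ((continuous_gradient hφ).enorm.measurable.pow_const 2)

lemma pt_add_smul (x : E n) (y t : ℝ) (ζ : X n) :
    pt x y + t • ζ = pt (x + t • ζ.fst) (y + ζ.snd • t) := by
  rw [smul_eq_mul, mul_comm]; rfl

/-- For a fixed direction, translation invariance in x removes the horizontal drift. The height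
moves at speed `ζ.snd` > 1, so passing from t to the height costs a factor at most 1. -/
lemma lintegral_slices_le {h : X n → ℝ≥0∞} (hh : Measurable h) {y : ℝ} (hy : 0 ≤ y) (r : ℝ)
    {ζ : X n} (hζ : ζ ∈ cone n) :
    ∫⁻ t in Set.Ioc 0 r, ∫⁻ x : E n, h (pt x y + t • ζ) ≤ ∫⁻ P in half n, h P := by
  have hm : Measurable fun y : ℝ => ∫⁻ x : E n, h (pt x y) :=
    (hh.comp measurable_pt_uncurry).lintegral_prod_left'
  have hw : (0 : ℝ) < ζ.snd := one_pos.trans hζ.2.1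
  have h1 : ∀ t : ℝ, ∫⁻ x : E n, h (pt x y + t • ζ) = ∫⁻ x : E n, h (pt x (y + ζ.snd • t)) := by
    intro t
    simp_rw [pt_add_smul]
    exact lintegral_add_right_eq_self (fun x : E n => h (pt x (y + ζ.snd • t))) _
  simp_rw [h1]
  rw [lintegral_half hh, ← lintegral_indicator measurableSet_Ioi]
  calc ∫⁻ t in Set.Ioc 0 r, ∫⁻ x : E n, h (pt x (y + ζ.snd • t))
      ≤ ∫⁻ t in Set.Ioc 0 r, (Set.Ioi (0 : ℝ)).indicator (fun y => ∫⁻ x : E n, h (pt x y))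
          (y + ζ.snd • t) := by
        refine setLIntegral_mono' measurableSet_Ioc fun t ht => ?_
        rw [Set.indicator_of_mem]
        exact add_pos_of_nonneg_of_pos hy (mul_pos hw ht.1)
    _ ≤ ∫⁻ t, (Set.Ioi (0 : ℝ)).indicator (fun y => ∫⁻ x : E n, h (pt x y))
          (y + ζ.snd • t) := setLIntegral_le_lintegral _ _
    _ ≤ _ := by
        rw [lintegral_comp_add_smul volume (hm.indicator measurableSet_Ioi) y hw.ne']
        refine (mul_le_mul_left (ENNReal.ofReal_le_one.2 ?_) _).trans_eq (one_mul _)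
        rw [Module.finrank_self, pow_one, abs_of_pos (inv_pos.2 hw)]
        exact inv_le_one_of_one_le₀ hζ.2.1.le

/-- `B` majorizes the reciprocal of the weight along the ray, uniformly over the admissible vertical
speeds `w`; Cauchy-Schwarz then separates `B` from the energy density. The 9 is the square of the
bound 3 for the length of a direction. -/
lemma near_sq_le {φ : X n → ℝ} (hφ : IsTest φ) {y r : ℝ} (hr : 0 ≤ r) {B : ℝ → ℝ≥0∞}
    (hBm : Measurable B) (hB : ∀ t ∈ Set.Ioc 0 r, ∀ w : ℝ, 1 < w → w < 2 →
      1 ≤ B t * ENNReal.ofReal (|y + w * t| ^ (1 - 2 * s))) (x : E n)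
    {ζ : X n} (hζ : ζ ∈ cone n) :
    ‖φ (pt x y) - φ (pt x y + r • ζ)‖ₑ ^ 2 ≤ 9 * (∫⁻ t in Set.Ioc 0 r, B t) *
      ∫⁻ t in Set.Ioc 0 r, ENNReal.ofReal (weight s (pt x y + t • ζ)) *
        ‖gradient φ (pt x y + t • ζ)‖ₑ ^ 2 := by
  have hc : Measurable fun t : ℝ => pt x y + t • ζ :=
    Continuous.measurable (continuous_const.add (continuous_id.smul continuous_const))
  calc _ ≤ (3 * ∫⁻ t in Set.Ioc 0 r, ‖gradient φ (pt x y + t • ζ)‖ₑ) ^ 2 := by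
        gcongr; exact enorm_near_le hφ _ hζ hr
    _ = 9 * (∫⁻ t in Set.Ioc 0 r, ‖gradient φ (pt x y + t • ζ)‖ₑ) ^ 2 := by
        rw [mul_pow]; norm_num
    _ ≤ _ := by
        rw [mul_assoc]
        gcongr
        refine lintegral_sq_le_mul hBm.aemeasurable
          ((measurable_density hφ).comp hc).aemeasurable ?_
        refine (ae_restrict_iff' measurableSet_Ioc).2 (ae_of_all _ fun t ht => ?_)
        rw [← mul_assoc]
        refine le_mul_of_one_le_left' ?_
        have := hB t ht ζ.snd hζ.2.1 hζ.2.2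
        rwa [pt_add_smul]

/-- After Cauchy-Schwarz over the cone, Tonelli makes the x-integral innermost. With direction and t
fixed, the slices met along the ray sweep the half-space at most once, so each direction contributes
at most the full energy. -/
lemma lintegral_near_sq_le {φ : X n → ℝ} (hφ : IsTest φ) {y r : ℝ} (hy : 0 ≤ y) (hr : 0 ≤ r)
    {B : ℝ → ℝ≥0∞} (hBm : Measurable B) (hB : ∀ t ∈ Set.Ioc 0 r, ∀ w : ℝ, 1 < w → w < 2 →
      1 ≤ B t * ENNReal.ofReal (|y + w * t| ^ (1 - 2 * s))) :
    ∫⁻ x, (∫⁻ ζ in cone n, ‖φ (pt x y) - φ (pt x y + r • ζ)‖ₑ) ^ 2 ≤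
      9 * volume (cone n) ^ 2 * (∫⁻ t in Set.Ioc 0 r, B t) * halfEnergy s φ := by
  set h : X n → ℝ≥0∞ := fun P => ENNReal.ofReal (weight s P) * ‖gradient φ P‖ₑ ^ 2 with hdef
  have hh : Measurable h := measurable_density hφ
  set b := ∫⁻ t in Set.Ioc 0 r, B t
  have hmeas : Measurable fun q : (E n × X n) × ℝ => h (pt q.1.1 y + q.2 • q.1.2) :=
    hh.comp (continuous_pt_add_smul y).measurable
  calc _ ≤ ∫⁻ x : E n, volume (cone n) * (9 * b * ∫⁻ ζ in cone n, ∫⁻ t in Set.Ioc 0 r,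
        h (pt x y + t • ζ)) := by
        refine lintegral_mono fun x => ?_
        have hm2 : Measurable fun ζ : X n => ∫⁻ t in Set.Ioc 0 r, h (pt x y + t • ζ) :=
          (hmeas.comp (f := fun q : X n × ℝ => ((x, q.1), q.2)) (by fun_prop)).lintegral_prod_right'
        rw [← lintegral_const_mul _ hm2]
        have := lintegral_sq_le_mul (μ := volume.restrict (cone n)) (v := fun _ => 1)
          (f := fun ζ => ‖φ (pt x y) - φ (pt x y + r • ζ)‖ₑ) aemeasurable_const
          (hm2.const_mul (9 * b)).aemeasurable
          ((ae_restrict_iff' measurableSet_cone).2 (ae_of_all _ fun ζ hζ => by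
            rw [one_mul]; exact near_sq_le hφ hr hBm hB x hζ))
        rwa [lintegral_one, Measure.restrict_apply_univ] at this
    _ = 9 * volume (cone n) * b * ∫⁻ x : E n, ∫⁻ ζ in cone n, ∫⁻ t in Set.Ioc 0 r,
        h (pt x y + t • ζ) := by
        simp_rw [← mul_assoc]
        rw [lintegral_const_mul _ hmeas.lintegral_prod_right'.lintegral_prod_right']
        ring
    _ ≤ 9 * volume (cone n) * b * ∫⁻ ζ in cone n, halfEnergy s φ := by
        gcongr 9 * volume (cone n) * b * ?_
        rw [lintegral_lintegral_swap]
        · refine setLIntegral_mono' measurableSet_cone fun ζ hζ => ?_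
          rw [lintegral_lintegral_swap]
          · exact lintegral_slices_le hh hy r hζ
          · exact (hmeas.comp (f := fun q : E n × ℝ => ((q.1, ζ), q.2))
              (by fun_prop)).aemeasurable
        · exact hmeas.lintegral_prod_right'.aemeasurable
    _ = _ := by
        rw [setLIntegral_const]; ring

lemma lintegral_Ioi_rpow {c r : ℝ} (hc : 0 < c) (hr : 0 < r) :
    ∫⁻ t in Set.Ioi r, ENNReal.ofReal (t ^ (-c - 1)) = ENNReal.ofReal (r ^ (-c) / c) := by
  rw [← ofReal_integral_eq_lintegral_ofReal (integrableOn_Ioi_rpow_of_lt (by linarith) hr),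
    integral_Ioi_rpow_of_lt (by linarith) hr]
  · congr 1; rw [sub_add_cancel, neg_div_neg_eq]
  · exact (ae_restrict_iff' measurableSet_Ioi).2
      (ae_of_all _ fun t ht => Real.rpow_nonneg (hr.trans ht).le _)

lemma lintegral_Ioc_rpow {c r : ℝ} (hc : -1 < c) (hr : 0 ≤ r) :
    ∫⁻ t in Set.Ioc 0 r, ENNReal.ofReal (t ^ c) = ENNReal.ofReal (r ^ (c + 1) / (c + 1)) := by
  rw [← ofReal_integral_eq_lintegral_ofReal, ← intervalIntegral.integral_of_le hr,
    integral_rpow (Or.inl hc), Real.zero_rpow (by linarith), sub_zero]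
  · exact (intervalIntegrable_iff_integrableOn_Ioc_of_le hr).1
      (intervalIntegral.intervalIntegrable_rpow' hc)
  · exact (ae_restrict_iff' measurableSet_Ioc).2
      (ae_of_all _ fun t ht => Real.rpow_nonneg ht.1.le _)

lemma inv_le_rpow {q a : ℝ} (hq : 1 ≤ q) (ha : -1 ≤ a) : q⁻¹ ≤ q ^ a := by
  rw [← Real.rpow_neg_one]
  exact Real.rpow_le_rpow_of_exponent_le hq ha

/-- Since t ≥ r, the quotient q of the height by t lies between 1 and y/r + 2. As the exponent is at
least -1, q to that exponent is at least 1/q, which treats both signs of the exponent at once. -/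
lemma one_le_far_weight {s : ℝ} (hs1 : s ≤ 1) {y r t w : ℝ} (hy : 0 ≤ y) (hr : 0 < r) (ht : r ≤ t)
    (hw1 : 1 ≤ w) (hw2 : w ≤ 2) :
    1 ≤ ENNReal.ofReal ((y / r + 2) * t ^ (-(1 - 2 * s))) *
      ENNReal.ofReal (|y + w * t| ^ (1 - 2 * s)) := by
  have ht0 : 0 < t := hr.trans_le ht
  have hq : (y + w * t) / t = y / t + w := by field_simp
  have h0 : 0 ≤ y / t := by positivity
  have h1 : 1 ≤ (y + w * t) / t := by rw [hq]; linarith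
  have h2 : (y + w * t) / t ≤ y / r + 2 := by
    rw [hq]
    have : y / t ≤ y / r := by gcongr
    linarith
  have hτ : 0 < y + w * t := by positivity
  rw [← ENNReal.ofReal_mul (by positivity), ← ENNReal.ofReal_one]
  refine ENNReal.ofReal_le_ofReal ?_
  rw [abs_of_pos hτ, mul_assoc, mul_comm (t ^ _), Real.rpow_neg ht0.le, ← div_eq_mul_inv,
    ← Real.div_rpow hτ.le ht0.le]
  have h3 := inv_le_rpow h1 (by linarith : (-1 : ℝ) ≤ 1 - 2 * s)
  calc (1 : ℝ) = ((y + w * t) / t) * ((y + w * t) / t)⁻¹ := by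
        rw [mul_inv_cancel₀]; positivity
    _ ≤ _ := by gcongr

lemma one_le_near_weight_zero {s : ℝ} (hs1 : s ≤ 1) {t w : ℝ} (ht : 0 < t)
    (hw1 : 1 ≤ w) (hw2 : w ≤ 2) :
    1 ≤ ENNReal.ofReal (2 * t ^ (-(1 - 2 * s))) *
      ENNReal.ofReal (|0 + w * t| ^ (1 - 2 * s)) := by
  simpa using one_le_far_weight hs1 le_rfl ht le_rfl hw1 hw2

/-- The height lies in [t, Y + 2]. For a nonnegative exponent the lower end gives the bound; for a
nonpositive one the upper end does, with loss Y + 2. The common majorant t^(-|1 - 2s|) is integrable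
at 0 when 0 < s < 1. -/
lemma one_le_near_weight {s : ℝ} (hs1 : s ≤ 1) {y Y t w : ℝ} (hy : 0 ≤ y) (hY : y ≤ Y)
    (ht0 : 0 < t) (ht1 : t ≤ 1) (hw1 : 1 ≤ w) (hw2 : w ≤ 2) :
    1 ≤ ENNReal.ofReal ((Y + 2) * t ^ (-|1 - 2 * s|)) *
      ENNReal.ofReal (|y + w * t| ^ (1 - 2 * s)) := by
  have hτ : t ≤ y + w * t := by nlinarith
  have hτ2 : y + w * t ≤ Y + 2 := by nlinarith
  have hτ0 : 0 < y + w * t := ht0.trans_le hτ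
  have hY2 : 1 ≤ Y + 2 := by linarith
  rw [← ENNReal.ofReal_mul (by positivity), ← ENNReal.ofReal_one]
  refine ENNReal.ofReal_le_ofReal ?_
  rw [abs_of_pos hτ0]
  rcases le_total 0 (1 - 2 * s) with ha | ha
  · rw [abs_of_nonneg ha, Real.rpow_neg ht0.le]
    have h1 : t ^ (1 - 2 * s) ≤ (y + w * t) ^ (1 - 2 * s) := by gcongr
    have h2 : 0 < t ^ (1 - 2 * s) := by positivity
    calc (1 : ℝ) = 1 * (t ^ (1 - 2 * s))⁻¹ * t ^ (1 - 2 * s) := by field_simp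
      _ ≤ _ := by gcongr
  · rw [abs_of_nonpos ha, neg_neg]
    have h1 : (Y + 2)⁻¹ ≤ (y + w * t) ^ (1 - 2 * s) :=
      (inv_le_rpow hY2 (by linarith)).trans (Real.rpow_le_rpow_of_nonpos hτ0 hτ2 ha)
    have h2 : 1 ≤ t ^ (1 - 2 * s) := Real.one_le_rpow_of_pos_of_le_one_of_nonpos ht0 ht1 ha
    calc (1 : ℝ) = (Y + 2) * 1 * (Y + 2)⁻¹ := by field_simp
      _ ≤ _ := by gcongr

/-- Averages over translated dilated cones are controlled by the energy. -/
lemma lintegral_far_le (hs1 : s ≤ 1) (hns : 2 * s < n) {φ : X n → ℝ} (hφ : IsTest φ) (x : E n)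
    {y r : ℝ} (hy : 0 ≤ y) (hr : 0 < r) :
    ∫⁻ ζ in cone n, ‖φ (pt x y + r • ζ)‖ₑ ≤
      3 * ENNReal.ofReal (y / r + 2) ^ (1 / 2 : ℝ) *
        ENNReal.ofReal (r ^ (-((n - 2 * s) / 2)) / ((n - 2 * s) / 2)) *
        (volume (cone n) * halfEnergy s φ) ^ (1 / 2 : ℝ) := by
  set h : X n → ℝ≥0∞ := fun P => ENNReal.ofReal (weight s P) * ‖gradient φ P‖ₑ ^ 2 with hdef
  have hh : Measurable h := measurable_density hφ
  have hd : 0 < (n - 2 * s) / 2 := by linarith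
  have hcone : ∀ t ∈ Set.Ioi r, ∫⁻ ζ in cone n, ‖gradient φ (pt x y + t • ζ)‖ₑ ≤
      ENNReal.ofReal (t ^ (-((n - 2 * s) / 2) - 1)) * (ENNReal.ofReal (y / r + 2) ^ (1 / 2 : ℝ) *
        (volume (cone n) * halfEnergy s φ) ^ (1 / 2 : ℝ)) := by
    intro t ht
    have ht0 : 0 < t := hr.trans ht
    -- Dilation by t has Jacobian t^(n+1). Together with the factor t^(-(1-2s)) from the weight, the
    -- square root yields the power -(n-2s)/2 - 1, which is integrable at infinity because n > 2s.
    have h1 : ∫⁻ ζ in cone n, h (pt x y + t • ζ) ≤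
        ENNReal.ofReal (t ^ (-((n : ℝ) + 1))) * halfEnergy s φ := by
      calc ∫⁻ ζ in cone n, h (pt x y + t • ζ)
          ≤ ∫⁻ ζ in cone n, (half n).indicator h (pt x y + t • ζ) := by
            refine setLIntegral_mono' measurableSet_cone fun ζ hζ => ?_
            rw [Set.indicator_of_mem]
            rw [pt_add_smul]
            exact add_pos_of_nonneg_of_pos hy (mul_pos (one_pos.trans hζ.2.1) ht0)
        _ ≤ ∫⁻ ζ, (half n).indicator h (pt x y + t • ζ) := setLIntegral_le_lintegral _ _
        _ = _ := by
            have hdim : Module.finrank ℝ (X n) = n + 1 := by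
              rw [(WithLp.linearEquiv 2 ℝ (E n × ℝ)).finrank_eq]; simp
            rw [lintegral_comp_add_smul volume (hh.indicator measurableSet_half) _ ht0.ne',
              lintegral_indicator measurableSet_half, hdim, abs_of_pos (by positivity),
              Real.rpow_neg ht0.le, ← Real.rpow_natCast]
            push_cast; rfl
    have h2 := lintegral_sq_le_mul (μ := volume.restrict (cone n))
      (f := fun ζ => ‖gradient φ (pt x y + t • ζ)‖ₑ)
      (v := fun _ => ENNReal.ofReal ((y / r + 2) * t ^ (-(1 - 2 * s))))
      (h := fun ζ => h (pt x y + t • ζ)) aemeasurable_const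
      (hh.comp ((measurable_const_smul t).const_add _)).aemeasurable
      ((ae_restrict_iff' measurableSet_cone).2 (ae_of_all _ fun ζ hζ => by
        rw [hdef, ← mul_assoc]
        refine le_mul_of_one_le_left' ?_
        have := one_le_far_weight hs1 hy hr (le_of_lt ht) hζ.2.1.le hζ.2.2.le
        rwa [pt_add_smul]))
    rw [setLIntegral_const] at h2
    calc ∫⁻ ζ in cone n, ‖gradient φ (pt x y + t • ζ)‖ₑ
        = ((∫⁻ ζ in cone n, ‖gradient φ (pt x y + t • ζ)‖ₑ) ^ 2) ^ (1 / 2 : ℝ) := by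
          rw [← ENNReal.rpow_natCast, ← ENNReal.rpow_mul]; norm_num
      _ ≤ (ENNReal.ofReal ((y / r + 2) * t ^ (-(1 - 2 * s))) * volume (cone n) *
            (ENNReal.ofReal (t ^ (-((n : ℝ) + 1))) * halfEnergy s φ)) ^ (1 / 2 : ℝ) := by
          gcongr
          exact h2.trans (by gcongr)
      _ = ((ENNReal.ofReal (t ^ (-((n - 2 * s) / 2) - 1))) ^ (2 : ℝ) *
            (ENNReal.ofReal (y / r + 2) * (volume (cone n) * halfEnergy s φ))) ^ (1 / 2 : ℝ) := by
          rw [ENNReal.ofReal_mul (by positivity), ENNReal.ofReal_rpow_of_pos (by positivity),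
            ← Real.rpow_mul ht0.le, show (-((n - 2 * s) / 2) - 1) * 2 =
              -(1 - 2 * s) + -((n : ℝ) + 1) by ring, Real.rpow_add ht0,
            ENNReal.ofReal_mul (by positivity)]
          congr 1; ring
      _ = _ := by
          rw [ENNReal.mul_rpow_of_nonneg _ _ (by norm_num), ← ENNReal.rpow_mul,
            ENNReal.mul_rpow_of_nonneg _ _ (by norm_num)]
          norm_num
  calc _ ≤ ∫⁻ ζ in cone n, 3 * ∫⁻ t in Set.Ioi r, ‖gradient φ (pt x y + t • ζ)‖ₑ :=
        setLIntegral_mono' measurableSet_cone fun ζ hζ => enorm_far_le hφ _ hζ r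
    _ = 3 * ∫⁻ t in Set.Ioi r, ∫⁻ ζ in cone n, ‖gradient φ (pt x y + t • ζ)‖ₑ := by
        rw [lintegral_const_mul' _ _ (by simp), lintegral_lintegral_swap]
        refine Measurable.aemeasurable ?_
        have h3 : Continuous fun q : X n × ℝ => pt x y + q.2 • q.1 := by fun_prop
        exact ((continuous_gradient hφ).comp h3).enorm.measurable
    _ ≤ 3 * ∫⁻ t in Set.Ioi r, ENNReal.ofReal (t ^ (-((n - 2 * s) / 2) - 1)) *
          (ENNReal.ofReal (y / r + 2) ^ (1 / 2 : ℝ) *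
            (volume (cone n) * halfEnergy s φ) ^ (1 / 2 : ℝ)) := by
        gcongr 3 * ?_
        exact setLIntegral_mono' measurableSet_Ioi hcone
    _ = _ := by
        rw [lintegral_mul_const _ (by fun_prop), lintegral_Ioi_rpow hd hr]
        ring

/-- The difference between a function and its averages, on the boundary. -/
lemma lintegral_near_zero_le (hs0 : 0 < s) (hs1 : s ≤ 1) {φ : X n → ℝ} (hφ : IsTest φ)
    {r : ℝ} (hr : 0 ≤ r) :
    ∫⁻ x, (∫⁻ ζ in cone n, ‖φ (pt x 0) - φ (pt x 0 + r • ζ)‖ₑ) ^ 2 ≤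
      9 * volume (cone n) ^ 2 * ENNReal.ofReal (r ^ (2 * s) / s) * halfEnergy s φ := by
  refine (lintegral_near_sq_le hφ le_rfl hr
    (B := fun t => ENNReal.ofReal (2 * t ^ (-(1 - 2 * s)))) (by fun_prop)
    fun t ht w hw1 hw2 => one_le_near_weight_zero hs1 ht.1 hw1.le hw2.le).trans_eq ?_
  congr 2
  simp_rw [ENNReal.ofReal_mul zero_le_two]
  rw [lintegral_const_mul _ (by fun_prop), lintegral_Ioc_rpow (by linarith) hr,
    ← ENNReal.ofReal_mul zero_le_two]
  congr 1
  rw [show -(1 - 2 * s) + 1 = 2 * s by ring]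
  field_simp

/-- The difference between a function and its averages, at bounded height. -/
lemma lintegral_near_le (hs0 : 0 < s) (hs1 : s < 1) {φ : X n → ℝ} (hφ : IsTest φ)
    {y Y r : ℝ} (hy : 0 ≤ y) (hY : y ≤ Y) (hr : 0 ≤ r) (hr1 : r ≤ 1) :
    ∫⁻ x, (∫⁻ ζ in cone n, ‖φ (pt x y) - φ (pt x y + r • ζ)‖ₑ) ^ 2 ≤
      9 * volume (cone n) ^ 2 *
        ENNReal.ofReal ((Y + 2) * (r ^ (1 - |1 - 2 * s|) / (1 - |1 - 2 * s|))) *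
        halfEnergy s φ := by
  have ha : |1 - 2 * s| < 1 := by rw [abs_lt]; constructor <;> linarith
  have hY2 : 0 ≤ Y + 2 := by linarith
  refine (lintegral_near_sq_le hφ hy hr
    (B := fun t => ENNReal.ofReal ((Y + 2) * t ^ (-|1 - 2 * s|))) (by fun_prop)
    fun t ht w hw1 hw2 => one_le_near_weight hs1.le hy hY ht.1 (ht.2.trans hr1)
      hw1.le hw2.le).trans_eq ?_
  congr 2
  simp_rw [ENNReal.ofReal_mul hY2]
  rw [lintegral_const_mul _ (by fun_prop), lintegral_Ioc_rpow (by linarith) hr,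
    neg_add_eq_sub]

/-! ### The weak-type trace inequality. -/

lemma sq_rpow_half (a : ℝ≥0∞) : (a ^ (1 / 2 : ℝ)) ^ 2 = a := by
  rw [← ENNReal.rpow_natCast, ← ENNReal.rpow_mul]; norm_num

lemma IsTest.continuous {φ : X n → ℝ} (hφ : IsTest φ) : Continuous φ := hφ.1.continuous

lemma continuous_pt_left (y : ℝ) : Continuous fun x : E n => pt x y :=
  continuous_pt.comp (f := fun x : E n => (x, y)) (by fun_prop)

/-- The hypothesis on `r` says that the far part accounts for at most half of `volume (cone n)`.
Where |φ| ≥ 1 the near part must supply the other half, and Chebyshev's inequality in L² concludes;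
36 is 9 times the square of 2. -/
lemma volume_superlevel_le (hs0 : 0 < s) (hs1 : s ≤ 1) (hns : 2 * s < n) {φ : X n → ℝ}
    (hφ : IsTest φ) {r : ℝ} (hr : 0 < r)
    (hfar : 2 * (3 * ENNReal.ofReal 2 ^ (1 / 2 : ℝ) *
        ENNReal.ofReal (r ^ (-((n - 2 * s) / 2)) / ((n - 2 * s) / 2)) *
        (volume (cone n) * halfEnergy s φ) ^ (1 / 2 : ℝ)) ≤ volume (cone n)) :
    volume {x : E n | 1 ≤ |φ (pt x 0)|} ≤
      36 * (ENNReal.ofReal (r ^ (2 * s) / s) * halfEnergy s φ) := by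
  set S := {x : E n | 1 ≤ |φ (pt x 0)|}
  have hS : MeasurableSet S :=
    (isClosed_le continuous_const (hφ.continuous.comp (continuous_pt_left 0)).abs).measurableSet
  set v := volume (cone n) with hv
  have hv0 : v ≠ 0 := volume_cone_pos.ne'
  have hvt : v ≠ ⊤ := volume_cone_lt_top.ne
  set N : E n → ℝ≥0∞ := fun x => ∫⁻ ζ in cone n, ‖φ (pt x 0) - φ (pt x 0 + r • ζ)‖ₑ
  have h1 : ∀ x ∈ S, v / 2 ≤ N x := by
    intro x hx
    have h2 : v ≤ N x + ∫⁻ ζ in cone n, ‖φ (pt x 0 + r • ζ)‖ₑ := by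
      rw [← lintegral_add_left (by
        have : Continuous fun ζ : X n => φ (pt x 0 + r • ζ) :=
          hφ.continuous.comp (by fun_prop)
        exact (continuous_const.sub this).enorm.measurable)]
      calc v = ∫⁻ ζ in cone n, 1 := by simp [v]
        _ ≤ _ := by
          refine lintegral_mono fun ζ => ?_
          have h3 : (1 : ℝ≥0∞) ≤ ‖φ (pt x 0)‖ₑ := by
            rw [← ofReal_norm, Real.norm_eq_abs, ← ENNReal.ofReal_one]
            exact ENNReal.ofReal_le_ofReal hx
          refine h3.trans ?_
          have := enorm_add_le (φ (pt x 0) - φ (pt x 0 + r • ζ)) (φ (pt x 0 + r • ζ))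
          rwa [sub_add_cancel] at this
    have h4 : ∫⁻ ζ in cone n, ‖φ (pt x 0 + r • ζ)‖ₑ ≤ v / 2 := by
      refine (lintegral_far_le hs1 hns hφ x le_rfl hr).trans ?_
      rw [zero_div, zero_add, ENNReal.le_div_iff_mul_le (by simp) (by simp), mul_comm]
      exact hfar
    by_contra hlt
    rw [not_le] at hlt
    have := h2.trans (add_le_add_right h4 _)
    have h5 : N x + v / 2 < v / 2 + v / 2 :=
      ENNReal.add_lt_add_right (ENNReal.div_ne_top hvt (by simp)) hlt
    rw [ENNReal.add_halves] at h5
    exact absurd (this.trans_lt h5) (lt_irrefl _)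
  have h6 : (v / 2) ^ 2 * volume S ≤
      9 * v ^ 2 * ENNReal.ofReal (r ^ (2 * s) / s) * halfEnergy s φ := by
    rw [← setLIntegral_const]
    refine (setLIntegral_mono' hS fun x hx => ?_).trans
      ((setLIntegral_le_lintegral S _).trans (lintegral_near_zero_le hs0 hs1 hφ hr.le))
    gcongr
    exact h1 x hx
  have h7 : (v / 2) ^ 2 ≠ 0 := by simp [hv0]
  have h8 : (v / 2) ^ 2 ≠ ⊤ := by
    exact ENNReal.pow_ne_top (ENNReal.div_ne_top hvt (by simp))
  rw [← ENNReal.mul_le_mul_iff_right h7 h8]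
  refine h6.trans_eq ?_
  rw [div_eq_mul_inv v, mul_pow]
  have : (2⁻¹ : ℝ≥0∞) ^ 2 * 36 = 9 := by
    rw [show (36 : ℝ≥0∞) = 2 ^ 2 * 9 by norm_num, ← mul_assoc, ← mul_pow,
      ENNReal.inv_mul_cancel (by simp) (by simp)]
    simp
  rw [← this]; ring

/-- Weak-type trace inequality. -/
lemma exists_volume_superlevel_le (hs0 : 0 < s) (hs1 : s ≤ 1) (hns : 2 * s < n) :
    ∃ C : ℝ≥0∞, C ≠ ⊤ ∧ ∀ φ : X n → ℝ, IsTest φ →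
      volume {x : E n | 1 ≤ |φ (pt x 0)|} ≤ C * halfEnergy s φ ^ (critExp n s / 2) := by
  set δ : ℝ := (n - 2 * s) / 2 with hδ
  have hd : 0 < δ := by rw [hδ]; linarith
  set v := volume (cone n) with hv
  have hvt : v ≠ ⊤ := volume_cone_lt_top.ne
  have hv0 : 0 < v.toReal := ENNReal.toReal_pos volume_cone_pos.ne' hvt
  -- `K` is chosen so that r^δ = K e^(1/2) makes the far condition of `volume_superlevel_le` an
  -- equality.
  set K : ℝ := 6 * 2 ^ (1 / 2 : ℝ) / δ * v.toReal ^ (1 / 2 : ℝ) / v.toReal with hK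
  have hK0 : 0 < K := by positivity
  have hp : critExp n s / 2 = 2 * s / δ / 2 + 1 := by
    have h0 : (n : ℝ) - 2 * s ≠ 0 := by linarith
    rw [critExp, hδ]; field_simp; ring
  -- The summand 1 makes it immediate that the constant is nonzero, so that its product with an
  -- infinite energy is infinite.
  refine ⟨ENNReal.ofReal (36 * K ^ (2 * s / δ) / s) + 1, by simp, fun φ hφ => ?_⟩
  rcases eq_or_ne (halfEnergy s φ) ⊤ with hE | hE
  · rw [hE, ENNReal.top_rpow_of_pos (by rw [hp]; positivity), ENNReal.mul_top (by simp)]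
    exact le_top
  rcases eq_or_ne (halfEnergy s φ) 0 with hE0 | hE0
  -- With zero energy the radius chosen below would degenerate to 0; here the far condition holds
  -- trivially and r = 1 serves.
  · refine (volume_superlevel_le hs0 hs1 hns hφ one_pos ?_).trans ?_
    · rw [hE0, mul_zero, ENNReal.zero_rpow_of_pos (by norm_num)]; simp
    · rw [hE0]; simp
  set e := (halfEnergy s φ).toReal with he
  have he0 : 0 < e := ENNReal.toReal_pos hE0 hE
  have heE : halfEnergy s φ = ENNReal.ofReal e := (ENNReal.ofReal_toReal hE).symm
  have hvV : v = ENNReal.ofReal v.toReal := (ENNReal.ofReal_toReal hvt).symm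
  set r : ℝ := (K * e ^ (1 / 2 : ℝ)) ^ (1 / δ) with hr
  have hb : 0 < K * e ^ (1 / 2 : ℝ) := by positivity
  have hr0 : 0 < r := by positivity
  have hrδ : r ^ (-δ) = (K * e ^ (1 / 2 : ℝ))⁻¹ := by
    rw [hr, ← Real.rpow_mul hb.le, ← Real.rpow_neg_one]; congr 1; field_simp
  refine (volume_superlevel_le hs0 hs1 hns hφ hr0 ?_).trans ?_
  · rw [← hδ, ← hv, hrδ, heE, hvV, ← ENNReal.ofReal_mul hv0.le,
      ENNReal.ofReal_rpow_of_pos (by positivity), ENNReal.ofReal_rpow_of_pos (by positivity),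
      show (3 : ℝ≥0∞) = ENNReal.ofReal 3 by simp, show (2 : ℝ≥0∞) = ENNReal.ofReal 2 by simp,
      ← ENNReal.ofReal_mul (by positivity), ← ENNReal.ofReal_mul (by positivity),
      ← ENNReal.ofReal_mul (by positivity), ← ENNReal.ofReal_mul (by positivity)]
    refine ENNReal.ofReal_le_ofReal (le_of_eq ?_)
    rw [Real.mul_rpow hv0.le he0.le, hK]
    field_simp
    norm_num
  · rw [heE, ← ENNReal.ofReal_mul (by positivity), ENNReal.ofReal_rpow_of_pos he0,
      show (36 : ℝ≥0∞) = ENNReal.ofReal 36 by simp, ← ENNReal.ofReal_mul (by positivity)]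
    refine le_trans (le_of_eq ?_) (mul_le_mul_left le_self_add _)
    rw [← ENNReal.ofReal_mul (by positivity)]
    congr 1
    rw [hr, ← Real.rpow_mul hb.le, Real.mul_rpow hK0.le (by positivity), ← Real.rpow_mul he0.le,
      hp, Real.rpow_add he0, Real.rpow_one, show 1 / δ * (2 * s) = 2 * s / δ by ring,
      show 1 / 2 * (2 * s / δ) = 2 * s / δ / 2 by ring]
    ring

/-! ### Dyadic truncation and the strong trace inequality. -/

/-- A smooth truncation, equal to `0` near zero and to `1` far from zero. -/
def trunc (t : ℝ) : ℝ := Real.smoothTransition (t ^ 2 - 1)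

lemma contDiff_trunc : ContDiff ℝ ∞ trunc :=
  Real.smoothTransition.contDiff.comp ((contDiff_id.pow 2).sub contDiff_const)

lemma trunc_of_abs_le {t : ℝ} (h : |t| ≤ 1) : trunc t = 0 :=
  Real.smoothTransition.zero_of_nonpos (by nlinarith [sq_abs t, abs_nonneg t])

lemma trunc_of_sq_ge {t : ℝ} (h : 2 ≤ t ^ 2) : trunc t = 1 :=
  Real.smoothTransition.one_of_one_le (by linarith)

/-- The transition from 0 to 1 happens within 1 ≤ |t| < 2, a single dyadic layer, so truncations at
different dyadic levels have gradients living on disjoint sets. -/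
lemma deriv_trunc_eq_zero {t : ℝ} (h : |t| < 1 ∨ 2 ≤ |t|) : deriv trunc t = 0 := by
  rcases h with h | h
  · have : trunc =ᶠ[𝓝 t] fun _ => 0 := by
      filter_upwards [(isOpen_lt continuous_abs continuous_const).mem_nhds h] with u hu
      exact trunc_of_abs_le (le_of_lt hu)
    rw [this.deriv_eq, deriv_const]
  · have : trunc =ᶠ[𝓝 t] fun _ => 1 := by
      have h2 : 2 < t ^ 2 := by nlinarith [sq_abs t]
      filter_upwards [(isOpen_lt continuous_const (continuous_pow 2)).mem_nhds h2] with u hu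
      exact trunc_of_sq_ge (le_of_lt hu)
    rw [this.deriv_eq, deriv_const]

lemma exists_deriv_trunc_le : ∃ L : ℝ, ∀ t, |deriv trunc t| ≤ L := by
  have h1 : Continuous (deriv trunc) := contDiff_trunc.continuous_deriv (by simp)
  have h2 : HasCompactSupport (deriv trunc) := by
    refine HasCompactSupport.intro (isCompact_closedBall (0 : ℝ) 2) fun t ht => ?_
    refine deriv_trunc_eq_zero (Or.inr ?_)
    simpa using (not_le.1 (by simpa using ht)).le
  obtain ⟨C, hC⟩ := h2.exists_bound_of_continuous h1
  exact ⟨C, hC⟩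

lemma isTest_trunc {φ : X n → ℝ} (hφ : IsTest φ) (c : ℝ) : IsTest fun P => trunc (c * φ P) := by
  refine ⟨contDiff_trunc.comp (contDiff_const.mul hφ.1), ?_⟩
  refine hφ.2.comp_left (g := fun t => trunc (c * t)) ?_
  exact trunc_of_abs_le (by simp)

lemma fderiv_comp_const_mul {F : Type*} [NormedAddCommGroup F] [NormedSpace ℝ F] {φ : F → ℝ}
    {θ : ℝ → ℝ} {P : F} (c : ℝ) (hφ : DifferentiableAt ℝ φ P)
    (hθ : DifferentiableAt ℝ θ (c * φ P)) :
    fderiv ℝ (fun P => θ (c * φ P)) P = deriv θ (c * φ P) • c • fderiv ℝ φ P :=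
  (HasDerivAt.comp_hasFDerivAt (h₂ := θ) (f := fun P => c * φ P) P hθ.hasDerivAt
    (hφ.hasFDerivAt.const_mul c)).fderiv

lemma IsTest.differentiable {φ : X n → ℝ} (hφ : IsTest φ) : Differentiable ℝ φ :=
  hφ.1.differentiable (by simp)

lemma enorm_gradient_trunc {φ : X n → ℝ} (hφ : IsTest φ) (c : ℝ) (P : X n) :
    ‖gradient (fun P => trunc (c * φ P)) P‖ₑ =
      ‖deriv trunc (c * φ P)‖ₑ * ‖c‖ₑ * ‖gradient φ P‖ₑ := by
  rw [enorm_gradient, fderiv_comp_const_mul c (hφ.differentiable P)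
    (contDiff_trunc.differentiable (by simp) _), enorm_smul, enorm_smul, enorm_gradient, mul_assoc]

lemma one_lt_critExp_half (hs0 : 0 < s) (hns : 2 * s < n) : 1 < critExp n s / 2 := by
  have h0 : 0 < (n : ℝ) - 2 * s := by linarith
  rw [critExp, div_div, one_lt_div (by positivity)]
  linarith

lemma two_lt_critExp (hs0 : 0 < s) (hns : 2 * s < n) : 2 < critExp n s := by
  have := one_lt_critExp_half hs0 hns; linarith

/-- The superposition inequality `∑ a_k^q ≤ (∑ a_k)^q` for `q ≥ 1`. -/
lemma tsum_rpow_le_rpow_tsum {ι : Type*} (a : ι → ℝ≥0∞) {q : ℝ} (hq : 1 ≤ q) :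
    ∑' k, a k ^ q ≤ (∑' k, a k) ^ q := by
  have h : ∀ b : ℝ≥0∞, b ^ q = b * b ^ (q - 1) := fun b => by
    conv_rhs => rw [← ENNReal.rpow_one b, ← ENNReal.rpow_mul, one_mul]
    rw [← ENNReal.rpow_add_of_nonneg _ _ zero_le_one (by linarith)]
    congr 1; ring
  rw [h (∑' k, a k), ← ENNReal.tsum_mul_right]
  refine ENNReal.tsum_le_tsum fun k => ?_
  rw [h]
  exact mul_le_mul_right (ENNReal.rpow_le_rpow (ENNReal.le_tsum k) (by linarith)) _

/-- Dyadic layers of the values of a function. -/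
def layer (φ : X n → ℝ) (k : ℤ) : Set (X n) := {P | |φ P| ∈ Set.Ico ((2 : ℝ) ^ k) (2 ^ (k + 1))}

lemma measurableSet_layer {φ : X n → ℝ} (hφ : IsTest φ) (k : ℤ) : MeasurableSet (layer φ k) :=
  hφ.continuous.abs.measurable measurableSet_Ico

lemma pairwise_disjoint_layer (φ : X n → ℝ) : Pairwise (Function.onFun Disjoint (layer φ)) := by
  have hm : Monotone fun k : ℤ => (2 : ℝ) ^ k := zpow_right_mono₀ (by norm_num)
  intro i j hij
  exact (hm.pairwise_disjoint_on_Ico_succ hij).preimage _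

lemma enorm_zpow_two (k : ℤ) : ‖(2 : ℝ) ^ k‖ₑ = (2 : ℝ≥0∞) ^ k := by
  rw [enorm_eq_nnnorm, nnnorm_zpow, ENNReal.coe_zpow (by simp)]
  simp

/-- The chain rule produces the factor 2^(-k), which cancels the power in front, and the derivative
of the truncation vanishes off the layer. -/
lemma halfEnergy_trunc_le {φ : X n → ℝ} (hφ : IsTest φ) {L : ℝ}
    (hL : ∀ t, |deriv trunc t| ≤ L) (k : ℤ) :
    ((2 : ℝ≥0∞) ^ k) ^ 2 * halfEnergy s (fun P => trunc ((2 : ℝ) ^ (-k) * φ P)) ≤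
      ENNReal.ofReal L ^ 2 * ∫⁻ P in layer φ k,
        ENNReal.ofReal (weight s P) * ‖gradient φ P‖ₑ ^ 2 ∂(volume.restrict (half n)) := by
  have h2 : (2 : ℝ≥0∞) ^ k * (2 : ℝ≥0∞) ^ (-k) = 1 := by
    rw [← ENNReal.zpow_add (by simp) (by simp), add_neg_cancel, zpow_zero]
  rw [halfEnergy, ← lintegral_const_mul _ (measurable_density (isTest_trunc hφ _)),
    ← lintegral_const_mul _ (measurable_density hφ),
    ← lintegral_indicator (measurableSet_layer hφ k)]
  refine lintegral_mono fun P => ?_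
  rw [enorm_gradient_trunc hφ, enorm_zpow_two]
  by_cases hP : P ∈ layer φ k
  · rw [Set.indicator_of_mem hP]
    have h1 : ‖deriv trunc ((2 : ℝ) ^ (-k) * φ P)‖ₑ ≤ ENNReal.ofReal L := by
      rw [← ofReal_norm]; exact ENNReal.ofReal_le_ofReal (hL _)
    calc _ = ((2 : ℝ≥0∞) ^ k * (2 : ℝ≥0∞) ^ (-k)) ^ 2 *
          (‖deriv trunc ((2 : ℝ) ^ (-k) * φ P)‖ₑ ^ 2 *
            (ENNReal.ofReal (weight s P) * ‖gradient φ P‖ₑ ^ 2)) := by ring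
      _ ≤ _ := by rw [h2, one_pow, one_mul]; gcongr
  · rw [Set.indicator_of_notMem hP, deriv_trunc_eq_zero]
    · simp
    · have hk : (0 : ℝ) < 2 ^ k := by positivity
      rw [abs_mul, abs_of_pos (by positivity : (0 : ℝ) < 2 ^ (-k)), zpow_neg,
        inv_mul_lt_iff₀ hk, mul_one, le_inv_mul_iff₀ hk, ← zpow_add_one₀ (by norm_num)]
      by_contra! hc
      exact hP hc

/-- The trace inequality for test functions. -/
theorem exists_trace_le (hs0 : 0 < s) (hs1 : s ≤ 1) (hns : 2 * s < n) :
    ∃ C : ℝ≥0∞, C ≠ ⊤ ∧ ∀ φ : X n → ℝ, IsTest φ →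
      ∫⁻ x : E n, ‖φ (pt x 0)‖ₑ ^ critExp n s ≤ C * halfEnergy s φ ^ (critExp n s / 2) := by
  obtain ⟨C, hC, hweak⟩ := exists_volume_superlevel_le (n := n) hs0 hs1 hns
  obtain ⟨L, hL⟩ := exists_deriv_trunc_le
  have hp2 := one_lt_critExp_half hs0 hns
  have hp : 0 ≤ critExp n s := by linarith
  refine ⟨(4 : ℝ≥0∞) ^ critExp n s * C * (ENNReal.ofReal L ^ 2) ^ (critExp n s / 2),
    by finiteness, fun φ hφ => ?_⟩
  set p := critExp n s with hpdef
  -- The threshold is 2^(k+1) and not 2^k, so that the truncation at level k already equals 1 on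
  -- this set.
  set S : ℤ → Set (E n) := fun k => {x | (2 : ℝ) ^ (k + 1) ≤ |φ (pt x 0)|} with hSdef
  have hS : ∀ k, MeasurableSet (S k) := fun k =>
    (isClosed_le continuous_const (hφ.continuous.comp (continuous_pt_left 0)).abs).measurableSet
  set T : ℤ → ℝ≥0∞ := fun k => ∫⁻ P in layer φ k,
    ENNReal.ofReal (weight s P) * ‖gradient φ P‖ₑ ^ 2 ∂(volume.restrict (half n)) with hT
  have hTsum : ∑' k, T k ≤ halfEnergy s φ := by
    rw [hT, ← lintegral_iUnion (measurableSet_layer hφ) (pairwise_disjoint_layer φ)]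
    exact setLIntegral_le_lintegral _ _
  have hvol : ∀ k : ℤ, ((2 : ℝ≥0∞) ^ k) ^ p * volume (S k) ≤
      C * (ENNReal.ofReal L ^ 2 * T k) ^ (p / 2) := by
    intro k
    have h1 : S k ⊆ {x | 1 ≤ |trunc ((2 : ℝ) ^ (-k) * φ (pt x 0))|} := by
      intro x hx
      have hk : (0 : ℝ) < 2 ^ k := by positivity
      have h2 : 2 ≤ |(2 : ℝ) ^ (-k) * φ (pt x 0)| := by
        rw [abs_mul, abs_of_pos (by positivity : (0 : ℝ) < 2 ^ (-k)), zpow_neg,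
          le_inv_mul_iff₀ hk, ← zpow_add_one₀ (by norm_num)]
        exact hx
      rw [Set.mem_ofPred_eq, trunc_of_sq_ge (by nlinarith [sq_abs ((2 : ℝ) ^ (-k) * φ (pt x 0))])]
      simp
    calc _ ≤ ((2 : ℝ≥0∞) ^ k) ^ p *
          (C * halfEnergy s (fun P => trunc ((2 : ℝ) ^ (-k) * φ P)) ^ (p / 2)) := by
          gcongr
          exact (measure_mono h1).trans (hweak _ (isTest_trunc hφ _))
      _ = C * (((2 : ℝ≥0∞) ^ k) ^ 2 *
            halfEnergy s (fun P => trunc ((2 : ℝ) ^ (-k) * φ P))) ^ (p / 2) := by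
          rw [ENNReal.mul_rpow_of_nonneg _ _ (by linarith), ← ENNReal.rpow_natCast (_ ^ k),
            ← ENNReal.rpow_mul, show ((2 : ℕ) : ℝ) * (p / 2) = p by push_cast; ring]
          ring
      _ ≤ _ := by
          exact mul_le_mul_right (ENNReal.rpow_le_rpow (halfEnergy_trunc_le hφ hL k)
            (by linarith)) _
  have hpt : ∀ x : E n, ‖φ (pt x 0)‖ₑ ^ p ≤
      ∑' k : ℤ, (S k).indicator (fun _ => (4 : ℝ≥0∞) ^ p * ((2 : ℝ≥0∞) ^ k) ^ p) x := by
    intro x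
    rcases eq_or_ne (φ (pt x 0)) 0 with h0 | h0
    · rw [h0, enorm_zero, ENNReal.zero_rpow_of_pos (by linarith)]; exact zero_le
    -- If |φ| lies in the layer of m, the term of index m - 1 alone is enough: |φ| < 2^(m+1) = 4 ·
    -- 2^(m-1), whence the factor 4.
    · obtain ⟨m, hm1, hm2⟩ := exists_mem_Ico_zpow (abs_pos.2 h0) (one_lt_two)
      refine le_trans ?_ (ENNReal.le_tsum (m - 1))
      rw [Set.indicator_of_mem (by rw [hSdef]; simpa using hm1),
        ← ENNReal.mul_rpow_of_nonneg _ _ hp]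
      gcongr
      have h3 : (4 : ℝ≥0∞) * 2 ^ (m - 1) = ‖(2 : ℝ) ^ (m + 1)‖ₑ := by
        rw [enorm_zpow_two, show m + 1 = 2 + (m - 1) by ring,
          ENNReal.zpow_add (by simp) (by simp)]
        norm_num
      rw [h3, Real.enorm_eq_ofReal_abs, Real.enorm_of_nonneg (by positivity)]
      exact ENNReal.ofReal_le_ofReal hm2.le
  calc ∫⁻ x : E n, ‖φ (pt x 0)‖ₑ ^ p
      ≤ ∫⁻ x : E n, ∑' k : ℤ,
          (S k).indicator (fun _ => (4 : ℝ≥0∞) ^ p * ((2 : ℝ≥0∞) ^ k) ^ p) x := lintegral_mono hpt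
    _ = ∑' k : ℤ, 4 ^ p * (((2 : ℝ≥0∞) ^ k) ^ p * volume (S k)) := by
        rw [lintegral_tsum fun k => (measurable_const.indicator (hS k)).aemeasurable]
        congr 1 with k
        rw [lintegral_indicator_const (hS k), mul_assoc]
    _ ≤ ∑' k : ℤ, 4 ^ p * (C * (ENNReal.ofReal L ^ 2 * T k) ^ (p / 2)) :=
        ENNReal.tsum_le_tsum fun k => by gcongr 4 ^ p * ?_; exact hvol k
    -- Here p/2 ≥ 1 matters: the powers of the layer energies add up to at most the power of their
    -- sum.
    _ ≤ 4 ^ p * (C * (ENNReal.ofReal L ^ 2 * ∑' k, T k) ^ (p / 2)) := by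
        rw [ENNReal.tsum_mul_left, ENNReal.tsum_mul_left, ← ENNReal.tsum_mul_left (a := _ ^ 2)]
        gcongr 4 ^ p * (C * ?_)
        exact tsum_rpow_le_rpow_tsum _ hp2.le
    _ ≤ _ := by
        rw [ENNReal.mul_rpow_of_nonneg _ _ (by linarith), ← mul_assoc, ← mul_assoc]
        gcongr

/-! ### Weighted L² bounds on bounded boxes. -/

/-- The measure `y^a dX` on the half-space. -/
def halfMeas (n : ℕ) (s : ℝ) : Measure (X n) :=
  ((volume : Measure (X n)).restrict (half n)).withDensity fun P => ENNReal.ofReal (weight s P)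

lemma lintegral_halfMeas (f : X n → ℝ≥0∞) :
    ∫⁻ P, f P ∂halfMeas n s = ∫⁻ P in half n, ENNReal.ofReal (weight s P) * f P :=
  lintegral_withDensity_eq_lintegral_mul_non_measurable _ measurable_weight.ennreal_ofReal
    (ae_of_all _ fun _ => ENNReal.ofReal_lt_top) f

lemma halfEnergy_eq (φ : X n → ℝ) : halfEnergy s φ = ∫⁻ P, ‖gradient φ P‖ₑ ^ 2 ∂halfMeas n s :=
  (lintegral_halfMeas _).symm

/-- A bounded box, symmetric in `y`. -/
def box (n : ℕ) (R : ℝ) : Set (X n) := {P | ‖P.fst‖ ≤ R ∧ |P.snd| ≤ R}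

lemma measurableSet_box (R : ℝ) : MeasurableSet (box n R) :=
  ((isClosed_le continuous_fst.norm continuous_const).inter
    (isClosed_le continuous_snd.abs continuous_const)).measurableSet

lemma lintegral_box {G : X n → ℝ≥0∞} (hG : Measurable G) (R : ℝ) :
    ∫⁻ P in box n R, G P ∂halfMeas n s = ∫⁻ y in Set.Ioc 0 R,
      ENNReal.ofReal (y ^ (1 - 2 * s)) * ∫⁻ x in Metric.closedBall (0 : E n) R, G (pt x y) := by
  rw [← lintegral_indicator (measurableSet_box R), lintegral_halfMeas,
    lintegral_half (f := fun P => _ * (box n R).indicator G P)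
    (measurable_weight.ennreal_ofReal.mul (hG.indicator (measurableSet_box R))),
    ← lintegral_indicator measurableSet_Ioi, ← lintegral_indicator measurableSet_Ioc]
  refine lintegral_congr fun y => ?_
  by_cases hy : 0 < y
  · rw [Set.indicator_of_mem (Set.mem_Ioi.2 hy)]
    have hw : ∀ x : E n, weight s (pt x y) = y ^ (1 - 2 * s) := fun x => by
      change |y| ^ _ = _; rw [abs_of_pos hy]
    simp_rw [hw]
    rw [lintegral_const_mul' _ _ ENNReal.ofReal_ne_top]
    by_cases hyR : y ≤ R
    · rw [Set.indicator_of_mem (Set.mem_Ioc.2 ⟨hy, hyR⟩),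
        ← lintegral_indicator Metric.isClosed_closedBall.measurableSet]
      congr 2 with x
      refine Set.indicator_eq_indicator ?_ rfl
      simp [box, pt, abs_of_pos hy, hyR]
    · rw [Set.indicator_of_notMem (by simp [hyR])]
      have : ∀ x : E n, (box n R).indicator G (pt x y) = 0 := fun x =>
        Set.indicator_of_notMem (by simp [box, pt, abs_of_pos hy, hyR]) _
      simp [this]
  · rw [Set.indicator_of_notMem (by simpa using hy),
      Set.indicator_of_notMem (by simp [hy])]

lemma halfMeas_box_lt_top (hs1 : s < 1) {R : ℝ} (hR : 0 ≤ R) : halfMeas n s (box n R) < ⊤ := by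
  rw [← setLIntegral_one, lintegral_box measurable_const, lintegral_mul_const _ (by fun_prop),
    lintegral_Ioc_rpow (by linarith) hR]
  refine ENNReal.mul_lt_top ENNReal.ofReal_lt_top ?_
  simpa using measure_closedBall_lt_top

/-- The integral of a function over a translated dilated cone. -/
def coneAvg (r : ℝ) (φ : X n → ℝ) (P : X n) : ℝ := ∫ ζ in cone n, φ (P + r • ζ)

lemma integrableOn_cone_comp {φ : X n → ℝ} (hφ : IsTest φ) (r : ℝ) (P : X n) :
    IntegrableOn (fun ζ => φ (P + r • ζ)) (cone n) := by
  obtain ⟨C, hC⟩ := hφ.2.exists_bound_of_continuous hφ.continuous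
  have hc : Continuous fun ζ : X n => φ (P + r • ζ) := hφ.continuous.comp (by fun_prop)
  exact IntegrableOn.of_bound volume_cone_lt_top hc.aestronglyMeasurable.restrict C
    (ae_of_all _ fun ζ => hC _)

lemma measurable_coneAvg {φ : X n → ℝ} (hφ : IsTest φ) (r : ℝ) : Measurable (coneAvg r φ) := by
  have hc : Continuous fun q : X n × X n => φ (q.1 + r • q.2) := hφ.continuous.comp (by fun_prop)
  exact (hc.stronglyMeasurable.integral_prod_right' (ν := volume.restrict (cone n))).measurable

/-- `coneAvg` is not normalized, which is why the volume of the cone multiplies the value of φ. -/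
lemma volume_cone_mul_enorm_le {φ : X n → ℝ} (hφ : IsTest φ) (r : ℝ) (P : X n) :
    volume (cone n) * ‖φ P‖ₑ ≤
      (∫⁻ ζ in cone n, ‖φ P - φ (P + r • ζ)‖ₑ) + ‖coneAvg r φ P‖ₑ := by
  have hi := integrableOn_cone_comp hφ r P
  have hc : IntegrableOn (fun _ : X n => φ P) (cone n) :=
    integrableOn_const volume_cone_lt_top.ne
  have h1 : (volume (cone n)).toReal * φ P =
      (∫ ζ in cone n, (φ P - φ (P + r • ζ))) + coneAvg r φ P := by
    rw [coneAvg, integral_sub hc hi, sub_add_cancel, setIntegral_const, smul_eq_mul]; rfl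
  calc volume (cone n) * ‖φ P‖ₑ = ‖(volume (cone n)).toReal * φ P‖ₑ := by
        rw [enorm_mul, Real.enorm_of_nonneg ENNReal.toReal_nonneg,
          ENNReal.ofReal_toReal volume_cone_lt_top.ne]
    _ ≤ _ := by
        rw [h1]
        refine (enorm_add_le _ _).trans ?_
        gcongr
        exact enorm_integral_le_lintegral_enorm _

lemma add_sq_le_two_mul (a b : ℝ≥0∞) : (a + b) ^ 2 ≤ 2 * (a ^ 2 + b ^ 2) := by
  have := ENNReal.rpow_add_le_mul_rpow_add_rpow a b (p := 2) one_le_two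
  norm_num at this
  exact this

/-- A weighted local `L²` bound with small constant, up to averages. -/
lemma lintegral_box_le (hs0 : 0 < s) (hs1 : s < 1) {φ : X n → ℝ} (hφ : IsTest φ) {R r : ℝ}
    (hR : 0 ≤ R) (hr : 0 ≤ r) (hr1 : r ≤ 1) :
    volume (cone n) ^ 2 * ∫⁻ P in box n R, ‖φ P‖ₑ ^ 2 ∂halfMeas n s ≤
      2 * (ENNReal.ofReal (R ^ (1 - 2 * s + 1) / (1 - 2 * s + 1)) * (9 * volume (cone n) ^ 2 *
        ENNReal.ofReal ((R + 2) * (r ^ (1 - |1 - 2 * s|) / (1 - |1 - 2 * s|))) *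
        halfEnergy s φ)) + 2 * ∫⁻ P in box n R, ‖coneAvg r φ P‖ₑ ^ 2 ∂halfMeas n s := by
  have hm1 : Measurable fun P : X n => ∫⁻ ζ in cone n, ‖φ P - φ (P + r • ζ)‖ₑ := by
    have hc : Continuous fun q : X n × X n => φ (q.1 + r • q.2) :=
      hφ.continuous.comp (by fun_prop)
    exact ((hφ.continuous.comp _root_.continuous_fst).sub hc).enorm.measurable.lintegral_prod_right'
  have hm2 := (measurable_coneAvg hφ r).enorm.pow_const 2
  calc volume (cone n) ^ 2 * ∫⁻ P in box n R, ‖φ P‖ₑ ^ 2 ∂halfMeas n s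
      = ∫⁻ P in box n R, (volume (cone n) * ‖φ P‖ₑ) ^ 2 ∂halfMeas n s := by
        rw [← lintegral_const_mul _ (by
          exact hφ.continuous.enorm.measurable.pow_const 2)]
        simp_rw [mul_pow]
    _ ≤ ∫⁻ P in box n R, (2 * (∫⁻ ζ in cone n, ‖φ P - φ (P + r • ζ)‖ₑ) ^ 2 +
          2 * ‖coneAvg r φ P‖ₑ ^ 2) ∂halfMeas n s := by
        refine lintegral_mono fun P => ?_
        rw [← mul_add]
        refine le_trans ?_ (add_sq_le_two_mul _ _)
        gcongr
        exact volume_cone_mul_enorm_le hφ r P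
    _ = 2 * (∫⁻ P in box n R, (∫⁻ ζ in cone n, ‖φ P - φ (P + r • ζ)‖ₑ) ^ 2 ∂halfMeas n s) +
          2 * ∫⁻ P in box n R, ‖coneAvg r φ P‖ₑ ^ 2 ∂halfMeas n s := by
        rw [lintegral_add_left ((hm1.pow_const 2).const_mul 2),
          lintegral_const_mul _ (hm1.pow_const 2), lintegral_const_mul _ hm2]
    _ ≤ _ := by
        gcongr 2 * ?_ + _
        rw [lintegral_box (hm1.pow_const 2)]
        rw [← lintegral_Ioc_rpow (by linarith) hR, ← lintegral_mul_const _ (by fun_prop)]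
        refine setLIntegral_mono' measurableSet_Ioc fun y hy => ?_
        gcongr
        exact (setLIntegral_le_lintegral _ _).trans
          (lintegral_near_le hs0 hs1 hφ hy.1.le hy.2 hr hr1)

/-- For fixed r the far estimate is pointwise and uniform up to height `R`. It serves twice: as
continuity of the average in the gradient, and as the dominating constant in the compactness
argument. -/
lemma enorm_coneAvg_sq_le (hs1 : s ≤ 1) (hns : 2 * s < n) {r R : ℝ} (hr : 0 < r) :
    ∃ C : ℝ≥0∞, C ≠ ⊤ ∧ ∀ φ : X n → ℝ, IsTest φ → ∀ P : X n, 0 ≤ P.snd → P.snd ≤ R →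
      ‖coneAvg r φ P‖ₑ ^ 2 ≤ C * halfEnergy s φ := by
  refine ⟨(3 * ENNReal.ofReal (R / r + 2) ^ (1 / 2 : ℝ) *
        ENNReal.ofReal (r ^ (-((n - 2 * s) / 2)) / ((n - 2 * s) / 2))) ^ 2 * volume (cone n), ?_,
    fun φ hφ P hP hPR => ?_⟩
  · have := volume_cone_lt_top (n := n)
    finiteness
  · have h1 := (enorm_integral_le_lintegral_enorm _).trans
      (lintegral_far_le hs1 hns hφ P.fst hP hr)
    calc ‖coneAvg r φ P‖ₑ ^ 2 ≤ _ := pow_le_pow_left₀ zero_le h1 2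
      _ ≤ _ := by
        rw [mul_pow, sq_rpow_half, ← mul_assoc]
        gcongr

/-- The weighted local `L²` bound. -/
lemma exists_lintegral_box_le (hs0 : 0 < s) (hs1 : s < 1) (hns : 2 * s < n) {R : ℝ} (hR : 0 ≤ R) :
    ∃ C : ℝ≥0∞, C ≠ ⊤ ∧ ∀ φ : X n → ℝ, IsTest φ →
      ∫⁻ P in box n R, ‖φ P‖ₑ ^ 2 ∂halfMeas n s ≤ C * halfEnergy s φ := by
  obtain ⟨C, hC, h⟩ := enorm_coneAvg_sq_le (R := R) hs1.le hns one_pos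
  have hv0 : volume (cone n) ^ 2 ≠ 0 := by simpa using volume_cone_pos.ne'
  have hvt : volume (cone n) ^ 2 ≠ ⊤ := ENNReal.pow_ne_top volume_cone_lt_top.ne
  refine ⟨(volume (cone n) ^ 2)⁻¹ *
    (2 * (ENNReal.ofReal (R ^ (1 - 2 * s + 1) / (1 - 2 * s + 1)) * (9 * volume (cone n) ^ 2 *
        ENNReal.ofReal ((R + 2) * (1 ^ (1 - |1 - 2 * s|) / (1 - |1 - 2 * s|))))) +
      2 * (C * halfMeas n s (box n R))), ?_, fun φ hφ => ?_⟩
  · have := (halfMeas_box_lt_top (n := n) hs1 hR).ne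
    have := ENNReal.inv_ne_top.2 hv0
    finiteness
  · rw [mul_assoc, ← one_mul (∫⁻ P in box n R, _ ∂_), ← ENNReal.inv_mul_cancel hv0 hvt, mul_assoc]
    refine mul_le_mul_right ?_ _
    refine (lintegral_box_le hs0 hs1 hφ hR zero_le_one le_rfl).trans ?_
    have h1 : ∫⁻ P in box n R, ‖coneAvg 1 φ P‖ₑ ^ 2 ∂halfMeas n s ≤
        C * halfEnergy s φ * halfMeas n s (box n R) := by
      rw [← setLIntegral_const]
      refine lintegral_mono_ae ?_
      have h0 : ∀ᵐ P ∂halfMeas n s, P ∈ half n :=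
        (withDensity_absolutelyContinuous _ _).ae_le (ae_restrict_mem measurableSet_half)
      filter_upwards [ae_restrict_of_ae h0, ae_restrict_mem (measurableSet_box R)] with P hP hPR
      exact h φ hφ P (le_of_lt hP) ((le_abs_self _).trans hPR.2)
    calc _ ≤ _ := add_le_add_right (mul_le_mul_right h1 2) _
      _ = _ := by ring

/-! ### Averages as functionals of the gradient, and local compactness. -/

/-- The bound forces `l` to vanish on the kernel of `D`, so it descends to a bounded functional on
the range. Hahn-Banach extends it and Riesz represents it; the range need not be closed. -/
lemma exists_inner_of_bound {V H : Type*} [AddCommGroup V] [Module ℝ V] [NormedAddCommGroup H]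
    [InnerProductSpace ℝ H] [CompleteSpace H] (D : V →ₗ[ℝ] H) (l : V →ₗ[ℝ] ℝ) (C : ℝ)
    (h : ∀ v, |l v| ≤ C * ‖D v‖) : ∃ K : H, ∀ v, l v = inner ℝ K (D v) := by
  have hker : LinearMap.ker D ≤ LinearMap.ker l := by
    intro v hv
    have h1 := h v
    rw [LinearMap.mem_ker.1 hv, norm_zero, mul_zero] at h1
    exact abs_nonpos_iff.1 h1
  let g : LinearMap.range D →ₗ[ℝ] ℝ :=
    ((LinearMap.ker D).liftQ l hker) ∘ₗ D.quotKerEquivRange.symm.toLinearMap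
  have hg : ∀ v, g ⟨D v, LinearMap.mem_range_self D v⟩ = l v := fun v => by
    simp only [g, LinearMap.comp_apply, LinearEquiv.coe_coe]
    rw [LinearMap.quotKerEquivRange_symm_apply_image]
    simp
  let G : StrongDual ℝ (LinearMap.range D) := g.mkContinuous C (by
    rintro ⟨_, v, rfl⟩
    rw [hg]
    exact h v)
  obtain ⟨F, hF, -⟩ := exists_extension_norm_eq _ G
  refine ⟨(InnerProductSpace.toDual ℝ H).symm F, fun v => ?_⟩
  rw [InnerProductSpace.toDual_symm_apply, ← hg]
  exact (hF ⟨D v, LinearMap.mem_range_self D v⟩).symm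

lemma eLpNorm_two_sq {α F : Type*} [MeasurableSpace α] [NormedAddCommGroup F] (f : α → F)
    (μ : Measure α) : eLpNorm f 2 μ ^ 2 = ∫⁻ x, ‖f x‖ₑ ^ 2 ∂μ := by
  rw [eLpNorm_eq_lintegral_rpow_enorm_toReal (by simp) (by simp), ← ENNReal.rpow_natCast,
    ← ENNReal.rpow_mul]
  simp

lemma isFiniteMeasureOnCompacts_halfMeas (hs1 : s < 1) :
    IsFiniteMeasureOnCompacts (halfMeas n s) := by
  refine ⟨fun K hK => ?_⟩
  obtain ⟨R, hR⟩ := hK.isBounded.exists_norm_le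
  refine (measure_mono fun P hP => ?_).trans_lt (halfMeas_box_lt_top hs1 (le_max_right R 0))
  have h1 := (hR P hP).trans (le_max_left R 0)
  have h2 := WithLp.prod_norm_sq_eq_of_L2 P
  constructor
  · refine le_trans ?_ h1
    nlinarith [norm_nonneg P, norm_nonneg P.fst, sq_nonneg ‖P.snd‖]
  · refine le_trans ?_ h1
    rw [← Real.norm_eq_abs]
    nlinarith [norm_nonneg P, norm_nonneg P.snd, sq_nonneg ‖P.fst‖]

lemma hasCompactSupport_gradient {φ : X n → ℝ} (hφ : IsTest φ) :
    HasCompactSupport (gradient φ) :=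
  (hφ.2.fderiv ℝ).comp_left (g := (InnerProductSpace.toDual ℝ (X n)).symm) (map_zero _)

lemma memLp_gradient (hs1 : s < 1) {φ : X n → ℝ} (hφ : IsTest φ) :
    MemLp (gradient φ) 2 (halfMeas n s) :=
  haveI := isFiniteMeasureOnCompacts_halfMeas (n := n) hs1
  (continuous_gradient hφ).memLp_of_hasCompactSupport (hasCompactSupport_gradient hφ)

lemma halfEnergy_eq_eLpNorm (φ : X n → ℝ) :
    halfEnergy s φ = eLpNorm (gradient φ) 2 (halfMeas n s) ^ 2 := by
  rw [eLpNorm_two_sq, halfEnergy_eq]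

lemma IsTest.add {φ ψ : X n → ℝ} (hφ : IsTest φ) (hψ : IsTest ψ) :
    IsTest (fun P => φ P + ψ P) := ⟨hφ.1.add hψ.1, hφ.2.add hψ.2⟩

lemma IsTest.const_mul {φ : X n → ℝ} (c : ℝ) (hφ : IsTest φ) :
    IsTest (fun P => c * φ P) := ⟨contDiff_const.mul hφ.1, hφ.2.mul_left⟩

lemma IsTest.sub {φ ψ : X n → ℝ} (hφ : IsTest φ) (hψ : IsTest ψ) :
    IsTest (fun P => φ P - ψ P) := ⟨hφ.1.sub hψ.1, hφ.2.sub hψ.2⟩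

lemma IsTest.mul {φ ψ : X n → ℝ} (hφ : IsTest φ) (hψ : IsTest ψ) :
    IsTest (fun P => φ P * ψ P) := ⟨hφ.1.mul hψ.1, hφ.2.mul_right⟩

lemma gradient_add {φ ψ : X n → ℝ} (hφ : IsTest φ) (hψ : IsTest ψ) (P : X n) :
    gradient (fun P => φ P + ψ P) P = gradient φ P + gradient ψ P := by
  simp only [gradient]
  rw [fderiv_fun_add (hφ.differentiable P) (hψ.differentiable P), map_add]

lemma gradient_sub {φ ψ : X n → ℝ} (hφ : IsTest φ) (hψ : IsTest ψ) (P : X n) :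
    gradient (fun P => φ P - ψ P) P = gradient φ P - gradient ψ P := by
  simp only [gradient]
  rw [fderiv_fun_sub (hφ.differentiable P) (hψ.differentiable P), map_sub]

lemma gradient_const_mul (c : ℝ) {φ : X n → ℝ} (hφ : IsTest φ) (P : X n) :
    gradient (fun P => c * φ P) P = c • gradient φ P := by
  simp only [gradient]
  rw [fderiv_const_mul (hφ.differentiable P), map_smulₛₗ]
  simp

lemma gradient_mul {φ ψ : X n → ℝ} (hφ : IsTest φ) (hψ : IsTest ψ) (P : X n) :
    gradient (fun P => φ P * ψ P) P = φ P • gradient ψ P + ψ P • gradient φ P := by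
  simp only [gradient]
  rw [fderiv_fun_mul (hφ.differentiable P) (hψ.differentiable P), map_add, map_smulₛₗ, map_smulₛₗ]
  simp

/-- The space of test functions. -/
def testSpace (n : ℕ) : Submodule ℝ (X n → ℝ) where
  carrier := {φ | IsTest φ}
  add_mem' := fun hφ hψ => hφ.add hψ
  zero_mem' := ⟨contDiff_const, HasCompactSupport.zero⟩
  smul_mem' := fun c _ hφ => hφ.const_mul c

/-- The gradient of test functions, as a map to the weighted `L²` space. -/
def gradLp (n : ℕ) (hs1 : s < 1) : testSpace n →ₗ[ℝ] Lp (X n) 2 (halfMeas n s) where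
  toFun φ := (memLp_gradient hs1 φ.2).toLp _
  map_add' φ ψ := by
    rw [← MemLp.toLp_add]
    exact MemLp.toLp_congr _ _ (ae_of_all _ fun P => gradient_add φ.2 ψ.2 P)
  map_smul' c φ := by
    rw [RingHom.id_apply, ← MemLp.toLp_const_smul]
    exact MemLp.toLp_congr _ _ (ae_of_all _ fun P => gradient_const_mul c φ.2 P)

/-- Averages over cones are bounded linear functionals of the gradient. -/
lemma exists_coneAvg_eq_inner (hs1 : s < 1) (hns : 2 * s < n) {r : ℝ} (hr : 0 < r) {P : X n}
    (hP : 0 ≤ P.snd) : ∃ K : Lp (X n) 2 (halfMeas n s), ∀ φ : X n → ℝ, ∀ hφ : IsTest φ,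
      coneAvg r φ P = inner ℝ K ((memLp_gradient hs1 hφ).toLp _) := by
  obtain ⟨C, hC, h⟩ := enorm_coneAvg_sq_le (n := n) (R := P.snd) hs1.le hns hr
  let l : testSpace n →ₗ[ℝ] ℝ :=
    { toFun := fun φ => coneAvg r φ.1 P
      map_add' := fun φ ψ => integral_add (integrableOn_cone_comp φ.2 r P)
        (integrableOn_cone_comp ψ.2 r P)
      map_smul' := fun c φ => integral_const_mul c fun ζ => φ.1 (P + r • ζ) }
  obtain ⟨K, hK⟩ := exists_inner_of_bound (gradLp n hs1) l (Real.sqrt C.toReal) (by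
    intro φ
    have h1 := h φ φ.2 P hP le_rfl
    have h2 : ‖gradLp n hs1 φ‖ = (eLpNorm (gradient φ.1) 2 (halfMeas n s)).toReal :=
      Lp.norm_toLp _ (memLp_gradient hs1 φ.2)
    rw [halfEnergy_eq_eLpNorm] at h1
    have h3 := ENNReal.toReal_mono (ENNReal.mul_ne_top hC
      (ENNReal.pow_ne_top (memLp_gradient hs1 φ.2).2.ne)) h1
    rw [ENNReal.toReal_mul, ENNReal.toReal_pow, ENNReal.toReal_pow, toReal_enorm, ← h2] at h3
    have h4 : |coneAvg r φ.1 P| = ‖coneAvg r φ.1 P‖ := rfl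
    change |coneAvg r φ.1 P| ≤ _
    rw [h4]
    calc ‖coneAvg r φ.1 P‖ = Real.sqrt (‖coneAvg r φ.1 P‖ ^ 2) :=
          (Real.sqrt_sq (norm_nonneg _)).symm
      _ ≤ Real.sqrt (C.toReal * ‖gradLp n hs1 φ‖ ^ 2) := Real.sqrt_le_sqrt h3
      _ = _ := by
        rw [Real.sqrt_mul ENNReal.toReal_nonneg, Real.sqrt_sq (norm_nonneg _)])
  exact ⟨K, fun φ hφ => hK ⟨φ, hφ⟩⟩

lemma ae_halfMeas_mem_half : ∀ᵐ P ∂halfMeas n s, P ∈ half n :=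
  (withDensity_absolutelyContinuous _ _).ae_le (ae_restrict_mem measurableSet_half)

/-- Local compactness: weak convergence of gradients implies local strong convergence. -/
theorem tendsto_lintegral_box (hs0 : 0 < s) (hs1 : s < 1) (hns : 2 * s < n) {ψ : ℕ → X n → ℝ}
    (hψ : ∀ k, IsTest (ψ k)) {M : ℝ≥0∞} (hM : M ≠ ⊤) (hb : ∀ k, halfEnergy s (ψ k) ≤ M)
    (hw : ∀ K : Lp (X n) 2 (halfMeas n s), Tendsto
      (fun k => inner ℝ K ((memLp_gradient hs1 (hψ k)).toLp _)) atTop (𝓝 0)) {R : ℝ} (hR : 0 ≤ R) :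
    Tendsto (fun k => ∫⁻ P in box n R, ‖ψ k P‖ₑ ^ 2 ∂halfMeas n s) atTop (𝓝 0) := by
  set v2 := volume (cone n) ^ 2 with hv2
  have hv0 : v2 ≠ 0 := by simpa [v2] using volume_cone_pos.ne'
  have hvt : v2 ≠ ⊤ := ENNReal.pow_ne_top volume_cone_lt_top.ne
  suffices h : Tendsto (fun k => v2 * ∫⁻ P in box n R, ‖ψ k P‖ₑ ^ 2 ∂halfMeas n s) atTop
      (𝓝 0) by
    have h1 := ENNReal.Tendsto.const_mul (a := v2⁻¹) h (Or.inr (ENNReal.inv_ne_top.2 hv0))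
    simp_rw [← mul_assoc, ENNReal.inv_mul_cancel hv0 hvt, one_mul, mul_zero] at h1
    exact h1
  have ha : 0 < 1 - |1 - 2 * s| := by
    have : |1 - 2 * s| < 1 := by rw [abs_lt]; constructor <;> linarith
    linarith
  -- `q r` bounds the near contribution for all k at once and tends to 0 with r. In the end r is
  -- fixed first, and only then is k taken large for the averages at scale r.
  set q : ℝ → ℝ≥0∞ := fun r => 2 * (ENNReal.ofReal (R ^ (1 - 2 * s + 1) / (1 - 2 * s + 1)) *
    (9 * v2 * ENNReal.ofReal ((R + 2) * (r ^ (1 - |1 - 2 * s|) / (1 - |1 - 2 * s|))) * M)) with hq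
  have hq0 : Tendsto q (𝓝[>] 0) (𝓝 0) := by
    have h1 : Tendsto (fun r : ℝ => (R + 2) * (r ^ (1 - |1 - 2 * s|) / (1 - |1 - 2 * s|)))
        (𝓝[>] 0) (𝓝 0) := by
      have h2 : Continuous fun r : ℝ =>
          (R + 2) * (r ^ (1 - |1 - 2 * s|) / (1 - |1 - 2 * s|)) :=
        continuous_const.mul ((Real.continuous_rpow_const ha.le).div_const _)
      have h3 := h2.tendsto 0
      rw [Real.zero_rpow ha.ne', zero_div, mul_zero] at h3
      exact h3.mono_left nhdsWithin_le_nhds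
    have h4 := ENNReal.tendsto_ofReal h1
    rw [ENNReal.ofReal_zero] at h4
    have h5 := ENNReal.Tendsto.const_mul (a := 9 * v2) h4 (Or.inr (by finiteness))
    have h6 := ENNReal.Tendsto.mul_const (b := M) h5 (Or.inr hM)
    have h7 := ENNReal.Tendsto.const_mul
      (a := ENNReal.ofReal (R ^ (1 - 2 * s + 1) / (1 - 2 * s + 1))) h6
      (Or.inr ENNReal.ofReal_ne_top)
    have h8 := ENNReal.Tendsto.const_mul (a := 2) h7 (Or.inr (by simp))
    simpa only [mul_zero, zero_mul] using h8
  -- At each point of the half-space the average is a continuous functional of the gradient, so weak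
  -- convergence gives pointwise convergence; dominated convergence on the box does the rest.
  have havg : ∀ r, 0 < r → Tendsto
      (fun k => 2 * ∫⁻ P in box n R, ‖coneAvg r (ψ k) P‖ₑ ^ 2 ∂halfMeas n s) atTop (𝓝 0) := by
    intro r hr
    obtain ⟨C, hC, h⟩ := enorm_coneAvg_sq_le (n := n) (R := R) hs1.le hns hr
    have hh := ae_restrict_of_ae (s := box n R) (ae_halfMeas_mem_half (n := n) (s := s))
    have hdom := tendsto_lintegral_of_dominated_convergence (μ := (halfMeas n s).restrict (box n R))
      (F := fun k P => ‖coneAvg r (ψ k) P‖ₑ ^ 2) (f := fun _ => 0) (fun _ => C * M)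
      (fun k => (measurable_coneAvg (hψ k) r).enorm.pow_const 2)
      (fun k => by
        filter_upwards [hh, ae_restrict_mem (measurableSet_box R)] with P hP hPR
        exact (h _ (hψ k) P (le_of_lt hP) ((le_abs_self _).trans hPR.2)).trans
          (mul_le_mul_right (hb k) _))
      (by
        rw [setLIntegral_const]
        have := (halfMeas_box_lt_top (n := n) hs1 hR).ne
        finiteness)
      (by
        filter_upwards [hh] with P hP
        obtain ⟨K, hK⟩ := exists_coneAvg_eq_inner (n := n) hs1 hns hr (le_of_lt hP)
        have h1 : Tendsto (fun k => coneAvg r (ψ k) P) atTop (𝓝 0) := by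
          simp_rw [fun k => hK (ψ k) (hψ k)]
          exact hw K
        have h2 := ENNReal.Tendsto.pow (n := 2) h1.enorm
        simpa using h2)
    rw [lintegral_zero] at hdom
    simpa using ENNReal.Tendsto.const_mul (a := 2) hdom (Or.inr (by simp))
  rw [ENNReal.tendsto_nhds_zero]
  intro ε hε
  have hε2 : 0 < ε / 2 := ENNReal.half_pos hε.ne'
  have h1 : ∀ᶠ r in 𝓝[>] (0 : ℝ), r ∈ Set.Ioc (0 : ℝ) 1 := Ioc_mem_nhdsGT one_pos
  obtain ⟨r, hqr, hr0, hr1⟩ :=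
    ((ENNReal.tendsto_nhds_zero.1 hq0 (ε / 2) hε2).and h1).exists
  filter_upwards [ENNReal.tendsto_nhds_zero.1 (havg r hr0) (ε / 2) hε2] with k hk
  refine (lintegral_box_le hs0 hs1 (hψ k) hR hr0.le hr1).trans ?_
  rw [← ENNReal.add_halves ε]
  refine add_le_add (le_trans ?_ hqr) hk
  exact mul_le_mul_right (mul_le_mul_right (mul_le_mul_right (hb k) _) _) _

/-! ### Weak gradients as limits of gradients of test functions. -/

lemma exists_tendsto_eLpNorm_of_cauchy {α F : Type*} [MeasurableSpace α] {μ : Measure α}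
    [NormedAddCommGroup F] [CompleteSpace F] {p : ℝ≥0∞} (hp : 1 ≤ p) {f : ℕ → α → F}
    (hf : ∀ j, MemLp (f j) p μ)
    (h : ∀ ε > 0, ∃ N, ∀ j ≥ N, ∀ k ≥ N, eLpNorm (f j - f k) p μ < ε) :
    ∃ g, MemLp g p μ ∧ Tendsto (fun j => eLpNorm (f j - g) p μ) atTop (𝓝 0) := by
  have := Fact.mk hp
  have hc : CauchySeq fun j => (hf j).toLp (f j) := by
    rw [EMetric.cauchySeq_iff]
    intro ε hε
    obtain ⟨N, hN⟩ := h ε hε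
    exact ⟨N, fun j hj k hk => by rw [Lp.edist_toLp_toLp]; exact hN j hj k hk⟩
  obtain ⟨g, hg⟩ := cauchySeq_tendsto_of_complete hc
  refine ⟨g, Lp.memLp g, ?_⟩
  rw [tendsto_iff_edist_tendsto_0] at hg
  refine hg.congr fun j => ?_
  rw [Lp.edist_def]
  exact eLpNorm_congr_ae ((hf j).coeFn_toLp.sub (EventuallyEq.refl _ _))

lemma tendsto_eLpNorm_sub_unique {α F : Type*} [MeasurableSpace α] {μ : Measure α}
    [NormedAddCommGroup F] {p : ℝ≥0∞} (hp : 1 ≤ p) {f f' : ℕ → α → F} {g : α → F}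
    (hf : ∀ j, AEStronglyMeasurable (f j) μ) (hf' : ∀ j, AEStronglyMeasurable (f' j) μ)
    (hg : AEStronglyMeasurable g μ)
    (h : Tendsto (fun j => eLpNorm (f j - g) p μ) atTop (𝓝 0))
    (h' : Tendsto (fun j => eLpNorm (f' j - f j) p μ) atTop (𝓝 0)) :
    Tendsto (fun j => eLpNorm (f' j - g) p μ) atTop (𝓝 0) := by
  refine tendsto_of_tendsto_of_tendsto_of_le_of_le tendsto_const_nhds
    (by simpa using h'.add h) (fun _ => zero_le) fun j => ?_
  have := eLpNorm_add_le ((hf' j).sub (hf j)) ((hf j).sub hg) hp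
  simpa using this

lemma integrable_mul_of_tsupport_subset {F : Type*} [NormedAddCommGroup F] [NormedSpace ℝ F]
    {f : X n → F} {c : X n → ℝ} (hc : Continuous c) (hcs : HasCompactSupport c)
    (hf : IntegrableOn f (tsupport c)) : Integrable fun P => c P • f P := by
  obtain ⟨C, hC⟩ := hcs.exists_bound_of_continuous hc
  rw [← integrableOn_iff_integrable_of_support_subset (s := tsupport c)]
  · exact Integrable.smul_of_top_right hf
      (memLp_top_of_bound hc.aestronglyMeasurable C (ae_of_all _ hC))
  · intro P hP
    by_contra h
    exact hP (by simp [image_eq_zero_of_notMem_tsupport h])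

/-- Convergence in `L¹` on the support of a continuous weight implies convergence of integrals. -/
lemma tendsto_integral_mul {f : ℕ → X n → ℝ} {g c : X n → ℝ} (hc : Continuous c)
    (hcs : HasCompactSupport c) (hf : ∀ j, IntegrableOn (f j) (tsupport c))
    (hg : IntegrableOn g (tsupport c))
    (h : Tendsto (fun j => ∫⁻ P in tsupport c, ‖f j P - g P‖ₑ) atTop (𝓝 0)) :
    Tendsto (fun j => ∫ P, c P * f j P) atTop (𝓝 (∫ P, c P * g P)) := by
  obtain ⟨C, hC⟩ := hcs.exists_bound_of_continuous hc
  refine tendsto_integral_of_L1 _ (integrable_mul_of_tsupport_subset hc hcs hg).aestronglyMeasurable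
    (Eventually.of_forall fun j => integrable_mul_of_tsupport_subset hc hcs (hf j)) ?_
  have h1 := ENNReal.Tendsto.const_mul (a := ENNReal.ofReal C) h (Or.inr ENNReal.ofReal_ne_top)
  rw [mul_zero] at h1
  refine tendsto_of_tendsto_of_tendsto_of_le_of_le tendsto_const_nhds h1 (fun _ => zero_le)
    fun j => ?_
  change _ ≤ ENNReal.ofReal C * _
  rw [← lintegral_const_mul' _ _ ENNReal.ofReal_ne_top,
    ← lintegral_indicator (isClosed_tsupport c).measurableSet]
  refine lintegral_mono fun P => ?_
  by_cases hP : P ∈ tsupport c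
  · rw [Set.indicator_of_mem hP, smul_eq_mul, ← mul_sub, enorm_mul]
    gcongr
    rw [← ofReal_norm]
    exact ENNReal.ofReal_le_ofReal (hC P)
  · simp [image_eq_zero_of_notMem_tsupport hP]

lemma setIntegral_half_eq {F : Type*} [NormedAddCommGroup F] [NormedSpace ℝ F] {f : X n → F}
    (h : ∀ P, P ∉ half n → f P = 0) : ∫ P in half n, f P = ∫ P, f P :=
  setIntegral_eq_integral_of_forall_compl_eq_zero h

/-- The difference integrates to zero against every test function supported in the open half-space,
so it vanishes almost everywhere there. This makes the choice hidden in `grad` harmless. -/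
lemma IsWeakGrad.ae_eq {U : X n → ℝ} {G G' : X n → X n} (h : IsWeakGrad U G)
    (h' : IsWeakGrad U G') : ∀ᵐ P ∂(volume : Measure (X n)), P ∈ half n → G P = G' P := by
  have key := isOpen_half.ae_eq_zero_of_integral_contDiff_smul_eq_zero (μ := volume)
    (h.locInt_grad.sub h'.locInt_grad) (fun ψ hψ1 hψ2 hψ3 => ?_)
  · filter_upwards [key] with P hP hP'
    exact sub_eq_zero.1 (hP hP')
  · have hi : Integrable fun P => ψ P • G P := integrable_mul_of_tsupport_subset hψ1.continuous hψ2
      (h.locInt_grad.integrableOn_compact_subset hψ3 hψ2)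
    have hi' : Integrable fun P => ψ P • G' P := integrable_mul_of_tsupport_subset hψ1.continuous
      hψ2 (h'.locInt_grad.integrableOn_compact_subset hψ3 hψ2)
    have hz : ∀ P, P ∉ half n → ψ P = 0 := fun P hP =>
      image_eq_zero_of_notMem_tsupport fun h => hP (hψ3 h)
    refine ext_inner_right ℝ fun e => ?_
    have h1 := (h.integral_eq ψ ⟨hψ1, hψ2⟩ hψ3 e).symm.trans (h'.integral_eq ψ ⟨hψ1, hψ2⟩ hψ3 e)
    rw [neg_inj, setIntegral_half_eq (fun P hP => by simp [hz P hP]),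
      setIntegral_half_eq (fun P hP => by simp [hz P hP])] at h1
    have h2 : ∀ (H : X n → X n), Integrable (fun P => ψ P • H P) →
        inner ℝ (∫ P, ψ P • H P) e = ∫ P, inner ℝ (H P) e * ψ P := fun H hH => by
      rw [real_inner_comm, ← integral_inner hH]
      refine integral_congr_ae (ae_of_all _ fun P => ?_)
      simp only
      rw [inner_smul_right, real_inner_comm, mul_comm]
    have h3 : (fun P => ψ P • (G - G') P) = fun P => ψ P • G P - ψ P • G' P := by
      ext1 P; simp [smul_sub]
    rw [h3, integral_sub hi hi', inner_sub_left, h2 G hi, h2 G' hi', h1, sub_self, inner_zero_left]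

lemma grad_ae_eq {U : X n → ℝ} {G : X n → X n} (h : IsWeakGrad U G) :
    ∀ᵐ P ∂(volume : Measure (X n)), P ∈ half n → grad U P = G P := by
  have hex : ∃ G, IsWeakGrad U G := ⟨G, h⟩
  have : IsWeakGrad U (grad U) := by
    rw [grad, dif_pos hex]; exact hex.choose_spec
  exact this.ae_eq h

lemma weight_pos {P : X n} (hP : P ∈ half n) : 0 < weight s P :=
  Real.rpow_pos_of_pos (abs_pos.2 (ne_of_gt hP)) _

lemma restrict_half_absolutelyContinuous :
    (volume : Measure (X n)).restrict (half n) ≪ halfMeas n s := by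
  refine withDensity_absolutelyContinuous' measurable_weight.ennreal_ofReal.aemeasurable ?_
  filter_upwards [ae_restrict_mem measurableSet_half] with P hP
  simpa using weight_pos hP

lemma halfMeas_absolutelyContinuous :
    halfMeas n s ≪ (volume : Measure (X n)).restrict (half n) :=
  withDensity_absolutelyContinuous _ _

/-- On a compact subset of the open half-space the weight is continuous and positive, so its
reciprocal is bounded. -/
lemma exists_restrict_le {K : Set (X n)} (hK : IsCompact K) (hKh : K ⊆ half n) :
    ∃ C : ℝ≥0∞, C ≠ ⊤ ∧ (volume : Measure (X n)).restrict K ≤ C • halfMeas n s := by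
  have hc : ContinuousOn (fun P : X n => (weight s P)⁻¹) K := by
    refine ContinuousOn.inv₀ ?_ fun P hP => (weight_pos (hKh hP)).ne'
    refine ContinuousOn.rpow_const continuous_snd.abs.continuousOn fun P hP => Or.inl ?_
    exact abs_ne_zero.2 (ne_of_gt (hKh hP))
  obtain ⟨C, hC⟩ := hK.exists_bound_of_continuousOn hc
  refine ⟨ENNReal.ofReal C, ENNReal.ofReal_ne_top, Measure.le_iff.2 fun A hA => ?_⟩
  rw [Measure.smul_apply, smul_eq_mul, halfMeas, withDensity_apply _ hA, Measure.restrict_apply hA,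
    ← setLIntegral_one, Measure.restrict_restrict hA,
    ← lintegral_const_mul _ measurable_weight.ennreal_ofReal]
  refine (setLIntegral_mono' (hA.inter hK.measurableSet) fun P hP => ?_).trans
    (lintegral_mono_set (Set.inter_subset_inter_right A hKh))
  have h1 := weight_pos (s := s) (hKh hP.2)
  have h2 := hC P hP.2
  rw [Real.norm_of_nonneg (inv_nonneg.2 h1.le)] at h2
  rw [← ENNReal.ofReal_mul ((inv_nonneg.2 h1.le).trans h2), ← ENNReal.ofReal_one]
  refine ENNReal.ofReal_le_ofReal ?_
  calc (1 : ℝ) = (weight s P)⁻¹ * weight s P := (inv_mul_cancel₀ h1.ne').symm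
    _ ≤ _ := by gcongr

/-- `L²` convergence with weight implies `L¹` convergence on compact subsets. -/
lemma tendsto_lintegral_compact {F : Type*} [NormedAddCommGroup F] {K : Set (X n)}
    (hK : IsCompact K) (hKh : K ⊆ half n) {f : ℕ → X n → F}
    (hf : ∀ j, AEStronglyMeasurable (f j) (halfMeas n s))
    (h : Tendsto (fun j => eLpNorm (f j) 2 (halfMeas n s)) atTop (𝓝 0)) :
    Tendsto (fun j => ∫⁻ P in K, ‖f j P‖ₑ) atTop (𝓝 0) := by
  obtain ⟨C, hC, hle⟩ := exists_restrict_le (s := s) hK hKh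
  have hfin : volume K ≠ ⊤ := hK.measure_lt_top.ne
  have h1 := ENNReal.Tendsto.mul_const (b := volume K ^ (1 / 2 : ℝ))
    (ENNReal.Tendsto.const_mul (a := C ^ (1 / (2 : ℝ≥0∞)).toReal) h (Or.inr (by finiteness)))
    (Or.inr (by finiteness))
  rw [mul_zero, zero_mul] at h1
  refine tendsto_of_tendsto_of_tendsto_of_le_of_le tendsto_const_nhds h1 (fun _ => zero_le)
    fun j => ?_
  have hm : AEStronglyMeasurable (f j) (volume.restrict K) :=
    (hf j).mono_ac ((Measure.restrict_mono_set _ hKh).absolutelyContinuous.trans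
      restrict_half_absolutelyContinuous)
  have h2 := eLpNorm_le_eLpNorm_mul_rpow_measure_univ (one_le_two : (1 : ℝ≥0∞) ≤ 2) hm
  rw [eLpNorm_one_eq_lintegral_enorm, Measure.restrict_apply_univ] at h2
  refine h2.trans ?_
  have h3 := eLpNorm_le_of_measure_le_smul (f := f j) (p := 2) hle
  norm_num at h2 h3 ⊢
  gcongr

lemma integral_mul_fderiv_test {φ ψ : X n → ℝ} (hφ : IsTest φ) (hψ : IsTest ψ) (e : X n) :
    ∫ P, φ P * fderiv ℝ ψ P e = - ∫ P, inner ℝ (gradient φ P) e * ψ P := by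
  have hcf : Continuous fun P => fderiv ℝ φ P e :=
    (hφ.1.continuous_fderiv (by simp)).clm_apply continuous_const
  have hcg : Continuous fun P => fderiv ℝ ψ P e :=
    (hψ.1.continuous_fderiv (by simp)).clm_apply continuous_const
  have h := integral_mul_fderiv_eq_neg_fderiv_mul_of_integrable (μ := (volume : Measure (X n)))
    (f := φ) (g := ψ) (v := e)
    ((hcf.mul hψ.continuous).integrable_of_hasCompactSupport hψ.2.mul_left)
    ((hφ.continuous.mul hcg).integrable_of_hasCompactSupport hφ.2.mul_right)
    ((hφ.continuous.mul hψ.continuous).integrable_of_hasCompactSupport hφ.2.mul_right)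
    (fun P _ => hφ.differentiable P) (fun P _ => hψ.differentiable P)
  rw [h]
  simp [gradient, InnerProductSpace.toDual_symm_apply]

/-- Limits of gradients of test functions are weak gradients. -/
lemma isWeakGrad_of_tendsto {φ : ℕ → X n → ℝ} (hφ : ∀ j, IsTest (φ j)) {U : X n → ℝ}
    {G : X n → X n} (hU : LocallyIntegrableOn U (half n))
    (hUt : ∀ K, IsCompact K → K ⊆ half n →
      Tendsto (fun j => ∫⁻ P in K, ‖φ j P - U P‖ₑ) atTop (𝓝 0))
    (hG : MemLp G 2 (halfMeas n s))
    (hGt : Tendsto (fun j => eLpNorm (gradient (φ j) - G) 2 (halfMeas n s)) atTop (𝓝 0)) :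
    IsWeakGrad U G := by
  have hGK : ∀ K, K ⊆ half n → IsCompact K → IntegrableOn G K := by
    intro K hKh hK
    obtain ⟨C, hC, hle⟩ := exists_restrict_le (s := s) hK hKh
    have : IsFiniteMeasure ((volume : Measure (X n)).restrict K) := ⟨by
      rw [Measure.restrict_apply_univ]; exact hK.measure_lt_top⟩
    exact (hG.of_measure_le_smul hC hle).integrable one_le_two
  refine ⟨hU, (locallyIntegrableOn_iff isOpen_half.isLocallyClosed).2 hGK, ?_⟩
  intro ψ hψ hsub e
  have hK : IsCompact (tsupport ψ) := hψ.2
  have hcg : Continuous fun P => fderiv ℝ ψ P e :=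
    (hψ.1.continuous_fderiv (by simp)).clm_apply continuous_const
  have hcgs : HasCompactSupport fun P => fderiv ℝ ψ P e :=
    (hψ.2.fderiv ℝ).comp_left (g := fun l : X n →L[ℝ] ℝ => l e) rfl
  have hcsub : tsupport (fun P => fderiv ℝ ψ P e) ⊆ tsupport ψ :=
    (tsupport_fderiv_apply_subset ℝ e)
  have hz : ∀ P, P ∉ half n → ψ P = 0 := fun P hP =>
    image_eq_zero_of_notMem_tsupport fun h => hP (hsub h)
  have hz' : ∀ P, P ∉ half n → fderiv ℝ ψ P e = 0 := fun P hP =>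
    image_eq_zero_of_notMem_tsupport (f := fun P => fderiv ℝ ψ P e) fun h => hP (hsub (hcsub h))
  have hKc : IsCompact (tsupport fun P => fderiv ℝ ψ P e) := hcgs
  have h1 := tendsto_integral_mul hcg hcgs
    (fun j => (hφ j).continuous.continuousOn.integrableOn_compact hKc)
    (hU.integrableOn_compact_subset (hcsub.trans hsub) hKc) (hUt _ hKc (hcsub.trans hsub))
  have h2 := tendsto_integral_mul (f := fun j P => inner ℝ (gradient (φ j) P) e)
    (g := fun P => inner ℝ (G P) e) hψ.continuous hψ.2
    (fun j => ((continuous_gradient (hφ j)).inner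
      continuous_const).continuousOn.integrableOn_compact
      hK)
    ((hGK _ hsub hK).inner_const e) (by
      have h3 := ENNReal.Tendsto.mul_const (b := ‖e‖ₑ) (tendsto_lintegral_compact hK hsub
        (fun j => (continuous_gradient (hφ j)).aestronglyMeasurable.sub hG.1) hGt)
        (Or.inr (by simp))
      rw [zero_mul] at h3
      refine tendsto_of_tendsto_of_tendsto_of_le_of_le tendsto_const_nhds h3 (fun _ => zero_le)
        fun j => ?_
      change _ ≤ (∫⁻ P in tsupport ψ, ‖(gradient (φ j) - G) P‖ₑ) * ‖e‖ₑ
      rw [← lintegral_mul_const' _ _ (by simp)]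
      refine lintegral_mono fun P => ?_
      rw [← inner_sub_left]
      rw [← ofReal_norm, ← ofReal_norm, ← ofReal_norm, ← ENNReal.ofReal_mul (norm_nonneg _)]
      exact ENNReal.ofReal_le_ofReal (norm_inner_le_norm _ _))
  rw [setIntegral_half_eq (fun P hP => by simp [hz' P hP]),
    setIntegral_half_eq (fun P hP => by simp [hz P hP])]
  have h4 : ∀ j, ∫ P, fderiv ℝ ψ P e * φ j P = - ∫ P, ψ P * inner ℝ (gradient (φ j) P) e := by
    intro j
    have := integral_mul_fderiv_test (hφ j) hψ e
    simp_rw [mul_comm (φ j _), mul_comm _ (ψ _)] at this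
    exact this
  simp_rw [h4] at h1
  have h5 := tendsto_nhds_unique h1 h2.neg
  simp_rw [mul_comm (U _), mul_comm _ (ψ _)]
  exact h5

/-- The test functions `φ` converge to an even extension of `U`. -/
def ApproxHalf (s : ℝ) (φ : ℕ → X n → ℝ) (U : X n → ℝ) : Prop :=
  ∃ W, IsEvenExt s W U ∧ IsApprox s φ W

lemma MemHalf.exists_approxHalf {U : X n → ℝ} (h : MemHalf s U) : ∃ φ, ApproxHalf s φ U := by
  obtain ⟨W, hW⟩ := h
  obtain ⟨φ, hφ⟩ := hW.mem
  exact ⟨φ, W, hW, hφ⟩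

lemma ApproxHalf.memHalf {φ : ℕ → X n → ℝ} {U : X n → ℝ} (h : ApproxHalf s φ U) : MemHalf s U :=
  ⟨h.choose, h.choose_spec.1⟩

lemma ApproxHalf.test {φ : ℕ → X n → ℝ} {U : X n → ℝ} (h : ApproxHalf s φ U) (j : ℕ) :
    IsTest (φ j) := h.choose_spec.2.test j

lemma weight_nonneg (s : ℝ) (P : X n) : 0 ≤ weight s P := Real.rpow_nonneg (abs_nonneg _) _

lemma energyWhole_eq (φ : X n → ℝ) :
    energyWhole s φ = ∫⁻ P : X n, ENNReal.ofReal (weight s P) * ‖gradient φ P‖ₑ ^ 2 := by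
  refine lintegral_congr fun P => ?_
  rw [ENNReal.ofReal_mul (weight_nonneg s P), ENNReal.ofReal_pow (norm_nonneg _),
    ofReal_norm]

lemma halfEnergy_le_energyWhole (φ : X n → ℝ) : halfEnergy s φ ≤ energyWhole s φ := by
  rw [energyWhole_eq]
  exact setLIntegral_le_lintegral _ _

lemma gradient_sub' {φ ψ : X n → ℝ} (hφ : IsTest φ) (hψ : IsTest ψ) :
    gradient (fun P => φ P - ψ P) = gradient φ - gradient ψ := by
  ext1 P; exact gradient_sub hφ hψ P

lemma IsApprox.cauchy_eLpNorm {φ : ℕ → X n → ℝ} {W : X n → ℝ} (h : IsApprox s φ W)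
    {ε : ℝ≥0∞} (hε : 0 < ε) : ∃ N, ∀ j ≥ N, ∀ k ≥ N,
      eLpNorm (gradient (φ j) - gradient (φ k)) 2 (halfMeas n s) < ε := by
  obtain ⟨δ, hδ0, hδ⟩ := ENNReal.lt_iff_exists_nnreal_btwn.1 hε
  have hδ0' : (0 : ℝ) < δ := by exact_mod_cast hδ0
  obtain ⟨N, hN⟩ := h.cauchy (δ ^ 2) (by positivity)
  refine ⟨N, fun j hj k hk => lt_of_le_of_lt ?_ hδ⟩
  have h1 := (halfEnergy_le_energyWhole _).trans (hN j hj k hk)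
  rw [halfEnergy_eq_eLpNorm, gradient_sub' (h.test j) (h.test k), ENNReal.ofReal_pow hδ0'.le,
    ENNReal.ofReal_coe_nnreal] at h1
  exact (ENNReal.pow_le_pow_left_iff two_ne_zero).1 h1

/-- The gradients of approximating test functions converge. -/
theorem ApproxHalf.grad {φ : ℕ → X n → ℝ} {U : X n → ℝ} (hs1 : s < 1) (h : ApproxHalf s φ U) :
    MemLp (grad U) 2 (halfMeas n s) ∧
      Tendsto (fun j => eLpNorm (gradient (φ j) - CCP.grad U) 2 (halfMeas n s)) atTop (𝓝 0) := by
  obtain ⟨W, hW, hφ⟩ := h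
  obtain ⟨G, hG, hGt⟩ := exists_tendsto_eLpNorm_of_cauchy one_le_two
    (fun j => memLp_gradient hs1 (hφ.test j)) (fun ε hε => hφ.cauchy_eLpNorm hε)
  -- The L² limit of the gradients is identified with the weak gradient through the L¹ convergence
  -- of the functions on compact sets.
  have hw : IsWeakGrad U G := by
    refine isWeakGrad_of_tendsto hφ.test ?_ ?_ hG hGt
    · exact LocallyIntegrableOn.congr (EventuallyEq.symm hW.restrict)
        (hφ.locallyIntegrable.locallyIntegrableOn _)
    · intro K hK hKh
      refine (hφ.tendsto K hK).congr fun j => ?_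
      refine lintegral_congr_ae ?_
      filter_upwards [ae_restrict_of_ae_restrict_of_subset hKh hW.restrict] with P hP
      rw [hP]
  have hae : CCP.grad U =ᵐ[halfMeas n s] G := by
    refine halfMeas_absolutelyContinuous.ae_le ?_
    exact (ae_restrict_iff' measurableSet_half).2 (grad_ae_eq hw)
  exact ⟨hG.ae_eq hae.symm, hGt.congr fun j =>
    eLpNorm_congr_ae ((EventuallyEq.refl _ _).sub hae.symm)⟩

/-! ### Reflection and multiplication by cutoffs. -/

/-- The reflection `(x, y) ↦ (x, -y)`. -/
def reflect (n : ℕ) : X n ≃ₗᵢ[ℝ] X n where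
  toLinearEquiv := LinearEquiv.ofInvolutive
    { toFun := fun P : X n => pt P.fst (-P.snd)
      map_add' := fun P Q => by
        simp only [pt, WithLp.add_fst, WithLp.add_snd, neg_add]; rfl
      map_smul' := fun c P => by
        simp only [pt, WithLp.smul_fst, WithLp.smul_snd, RingHom.id_apply, ← smul_neg]; rfl }
    (fun P => by simp [pt]; rfl)
  norm_map' := fun P => by
    refine (sq_eq_sq₀ (norm_nonneg _) (norm_nonneg _)).1 ?_
    rw [WithLp.prod_norm_sq_eq_of_L2, WithLp.prod_norm_sq_eq_of_L2]
    simp [pt, LinearEquiv.ofInvolutive]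

lemma reflect_apply (P : X n) : reflect n P = pt P.fst (-P.snd) := rfl

lemma isTest_reflect {φ : X n → ℝ} (hφ : IsTest φ) : IsTest fun P => φ (reflect n P) :=
  ⟨hφ.1.comp (reflect n).contDiff, hφ.2.comp_homeomorph (reflect n).toHomeomorph⟩

lemma opNorm_fderiv_comp {F : Type*} [NormedAddCommGroup F] [NormedSpace ℝ F] {φ : F → ℝ}
    (L : F ≃ₗᵢ[ℝ] F) (P : F) : ‖fderiv ℝ (fun P => φ (L P)) P‖ = ‖fderiv ℝ φ (L P)‖ := by
  have h : fderiv ℝ (φ ∘ L.toContinuousLinearEquiv) P =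
    (fderiv ℝ φ (L P)).comp L.toContinuousLinearEquiv.toContinuousLinearMap :=
    L.toContinuousLinearEquiv.comp_right_fderiv
  have h' : fderiv ℝ (fun P => φ (L P)) P = fderiv ℝ (φ ∘ L.toContinuousLinearEquiv) P := rfl
  rw [h', h]
  exact ContinuousLinearMap.opNorm_comp_linearIsometryEquiv _ L

lemma enorm_gradient_reflect (φ : X n → ℝ) (P : X n) :
    ‖gradient (fun P => φ (reflect n P)) P‖ₑ = ‖gradient φ (reflect n P)‖ₑ := by
  rw [← ofReal_norm, ← ofReal_norm, norm_gradient, norm_gradient, opNorm_fderiv_comp]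

lemma weight_reflect (P : X n) : weight s (reflect n P) = weight s P := by
  rw [weight, weight, reflect_apply]
  change |-P.snd| ^ _ = _
  rw [abs_neg]

lemma lintegral_eq_half_add {f : X n → ℝ≥0∞} (hf : Measurable f) :
    ∫⁻ P, f P = (∫⁻ P in half n, f P) + ∫⁻ P in half n, f (reflect n P) := by
  have hfr : Measurable fun P => f (reflect n P) := hf.comp (reflect n).continuous.measurable
  rw [lintegral_half hf, lintegral_half hfr, lintegral_eq_lintegral_pt hf,
    ← lintegral_add_compl _ (measurableSet_Ioi (a := (0 : ℝ))), Set.compl_Ioi]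
  congr 1
  have h1 := (Measure.measurePreserving_neg (volume : Measure ℝ)).setLIntegral_comp_preimage_emb
    (MeasurableEquiv.neg ℝ).measurableEmbedding
    (fun y => ∫⁻ x : E n, f (pt x y)) (Set.Iic 0)
  rw [← h1]
  have h2 : (Neg.neg : ℝ → ℝ) ⁻¹' Set.Iic 0 = Set.Ici 0 := by ext; simp
  rw [h2, setLIntegral_congr Ioi_ae_eq_Ici.symm]
  rfl

/-- Approximating test functions need not be even. This splitting transfers half-space estimates to
the whole space, by applying them to φ and to its reflection. -/
lemma energyWhole_eq_add {φ : X n → ℝ} (hφ : IsTest φ) :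
    energyWhole s φ = halfEnergy s φ + halfEnergy s (fun P => φ (reflect n P)) := by
  rw [energyWhole_eq, lintegral_eq_half_add (measurable_density hφ)]
  simp_rw [halfEnergy, enorm_gradient_reflect, weight_reflect]

lemma exists_lintegral_box_whole_le (hs0 : 0 < s) (hs1 : s < 1) (hns : 2 * s < n) {R : ℝ}
    (hR : 0 ≤ R) : ∃ C : ℝ≥0∞, C ≠ ⊤ ∧ ∀ φ : X n → ℝ, IsTest φ →
      ∫⁻ P in box n R, ENNReal.ofReal (weight s P) * ‖φ P‖ₑ ^ 2 ≤ C * energyWhole s φ := by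
  obtain ⟨C, hC, h⟩ := exists_lintegral_box_le (n := n) hs0 hs1 hns hR
  refine ⟨C, hC, fun φ hφ => ?_⟩
  have hm : Measurable fun P : X n => ENNReal.ofReal (weight s P) * ‖φ P‖ₑ ^ 2 :=
    measurable_weight.ennreal_ofReal.mul (hφ.continuous.enorm.measurable.pow_const 2)
  have key : ∀ f : X n → ℝ≥0∞, ∫⁻ P in box n R, f P ∂halfMeas n s =
      ∫⁻ P in half n, (box n R).indicator (fun P => ENNReal.ofReal (weight s P) * f P) P := by
    intro f
    rw [← lintegral_indicator (measurableSet_box R), lintegral_halfMeas]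
    refine lintegral_congr fun P => ?_
    by_cases hP : P ∈ box n R <;> simp [hP]
  rw [← lintegral_indicator (measurableSet_box R),
    lintegral_eq_half_add (hm.indicator (measurableSet_box R)), energyWhole_eq_add hφ, mul_add]
  refine add_le_add ((key _).symm.trans_le (h φ hφ)) (le_trans (le_of_eq ?_)
    (h _ (isTest_reflect hφ)))
  rw [key]
  refine lintegral_congr fun P => ?_
  have hb : reflect n P ∈ box n R ↔ P ∈ box n R := by
    rw [reflect_apply]
    change ‖P.fst‖ ≤ R ∧ |-P.snd| ≤ R ↔ _
    rw [abs_neg]; rfl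
  by_cases hP : P ∈ box n R
  · rw [Set.indicator_of_mem hP, Set.indicator_of_mem (hb.2 hP), weight_reflect]
  · rw [Set.indicator_of_notMem hP, Set.indicator_of_notMem (mt hb.1 hP)]

lemma exists_tsupport_subset_box {η : X n → ℝ} (hη : IsTest η) :
    ∃ R, 0 ≤ R ∧ tsupport η ⊆ box n R := by
  have hK : IsCompact (tsupport η) := hη.2
  obtain ⟨R, hR⟩ := hK.isBounded.exists_norm_le
  refine ⟨max R 0, le_max_right R 0, fun P hP => ?_⟩
  have h1 := (hR P hP).trans (le_max_left R 0)
  have h2 := WithLp.prod_norm_sq_eq_of_L2 P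
  constructor
  · refine le_trans ?_ h1
    nlinarith [norm_nonneg P, norm_nonneg P.fst, sq_nonneg ‖P.snd‖]
  · refine le_trans ?_ h1
    rw [← Real.norm_eq_abs]
    nlinarith [norm_nonneg P, norm_nonneg P.snd, sq_nonneg ‖P.fst‖]

lemma IsTest.exists_enorm_le {η : X n → ℝ} (hη : IsTest η) :
    ∃ A : ℝ≥0∞, A ≠ ⊤ ∧ (∀ P, ‖η P‖ₑ ≤ A) ∧ ∀ P, ‖gradient η P‖ₑ ≤ A := by
  obtain ⟨C, hC⟩ := hη.2.exists_bound_of_continuous hη.continuous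
  obtain ⟨D, hD⟩ := (hasCompactSupport_gradient hη).exists_bound_of_continuous
    (continuous_gradient hη)
  refine ⟨max (ENNReal.ofReal C) (ENNReal.ofReal D), by simp, fun P => ?_, fun P => ?_⟩
  · rw [← ofReal_norm]
    exact (ENNReal.ofReal_le_ofReal (hC P)).trans (le_max_left _ _)
  · rw [← ofReal_norm]
    exact (ENNReal.ofReal_le_ofReal (hD P)).trans (le_max_right _ _)

lemma gradient_eq_zero_of_notMem {η : X n → ℝ} {P : X n} (hP : P ∉ tsupport η) :
    gradient η P = 0 := by
  have : fderiv ℝ η P = 0 :=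
    image_eq_zero_of_notMem_tsupport fun h => hP (tsupport_fderiv_subset ℝ h)
  simp [gradient, this]

/-- Multiplication by a test function is bounded for the energy. -/
lemma exists_energyWhole_mul_le (hs0 : 0 < s) (hs1 : s < 1) (hns : 2 * s < n) {η : X n → ℝ}
    (hη : IsTest η) : ∃ C : ℝ≥0∞, C ≠ ⊤ ∧ ∀ φ : X n → ℝ, IsTest φ →
      energyWhole s (fun P => η P * φ P) ≤ C * energyWhole s φ := by
  obtain ⟨R, hR, hsub⟩ := exists_tsupport_subset_box hη
  obtain ⟨A, hA, hA1, hA2⟩ := hη.exists_enorm_le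
  obtain ⟨C, hC, h⟩ := exists_lintegral_box_whole_le (n := n) hs0 hs1 hns hR
  refine ⟨2 * A ^ 2 * (1 + C), by finiteness, fun φ hφ => ?_⟩
  have hm : Measurable fun P : X n => ENNReal.ofReal (weight s P) * ‖φ P‖ₑ ^ 2 :=
    measurable_weight.ennreal_ofReal.mul (hφ.continuous.enorm.measurable.pow_const 2)
  have hpt : ∀ P : X n, ENNReal.ofReal (weight s P) * ‖gradient (fun P => η P * φ P) P‖ₑ ^ 2 ≤
      2 * A ^ 2 * (ENNReal.ofReal (weight s P) * ‖gradient φ P‖ₑ ^ 2) + 2 * A ^ 2 *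
        (box n R).indicator (fun P => ENNReal.ofReal (weight s P) * ‖φ P‖ₑ ^ 2) P := by
    intro P
    rw [gradient_mul hη hφ]
    have h1 : ‖η P • gradient φ P + φ P • gradient η P‖ₑ ^ 2 ≤
        2 * ((A * ‖gradient φ P‖ₑ) ^ 2 + (‖φ P‖ₑ * ‖gradient η P‖ₑ) ^ 2) := by
      refine (pow_le_pow_left₀ zero_le (enorm_add_le _ _) 2).trans
        ((add_sq_le_two_mul _ _).trans ?_)
      rw [enorm_smul, enorm_smul]
      gcongr
      exact hA1 P
    by_cases hP : P ∈ tsupport η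
    · rw [Set.indicator_of_mem (hsub hP)]
      calc _ ≤ ENNReal.ofReal (weight s P) *
            (2 * ((A * ‖gradient φ P‖ₑ) ^ 2 + (‖φ P‖ₑ * A) ^ 2)) := by
            refine mul_le_mul_right (h1.trans ?_) _
            gcongr
            exact hA2 P
        _ = _ := by ring
    · rw [gradient_eq_zero_of_notMem hP, enorm_zero, mul_zero] at h1
      rw [gradient_eq_zero_of_notMem hP]
      calc _ ≤ ENNReal.ofReal (weight s P) * (2 * ((A * ‖gradient φ P‖ₑ) ^ 2 + 0 ^ 2)) :=
            mul_le_mul_right h1 _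
        _ = 2 * A ^ 2 * (ENNReal.ofReal (weight s P) * ‖gradient φ P‖ₑ ^ 2) := by ring
        _ ≤ _ := le_self_add
  calc energyWhole s (fun P => η P * φ P)
      ≤ ∫⁻ P : X n, (2 * A ^ 2 * (ENNReal.ofReal (weight s P) * ‖gradient φ P‖ₑ ^ 2) + 2 * A ^ 2 *
        (box n R).indicator (fun P => ENNReal.ofReal (weight s P) * ‖φ P‖ₑ ^ 2) P) := by
        rw [energyWhole_eq]; exact lintegral_mono hpt
    _ = 2 * A ^ 2 * energyWhole s φ + 2 * A ^ 2 *
        ∫⁻ P in box n R, ENNReal.ofReal (weight s P) * ‖φ P‖ₑ ^ 2 := by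
        rw [lintegral_add_left ((measurable_density hφ).const_mul _),
          lintegral_const_mul _ (measurable_density hφ),
          lintegral_const_mul _ (hm.indicator (measurableSet_box R)),
          lintegral_indicator (measurableSet_box R), energyWhole_eq]
    _ ≤ 2 * A ^ 2 * energyWhole s φ + 2 * A ^ 2 * (C * energyWhole s φ) := by
        gcongr; exact h φ hφ
    _ = _ := by ring

lemma exists_pos_mul_ofReal_le {C : ℝ≥0∞} (hC : C ≠ ⊤) {ε : ℝ} (hε : 0 < ε) :
    ∃ δ : ℝ, 0 < δ ∧ C * ENNReal.ofReal δ ≤ ENNReal.ofReal ε := by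
  have h0 : 0 ≤ C.toReal := ENNReal.toReal_nonneg
  refine ⟨ε / (C.toReal + 1), by positivity, ?_⟩
  rw [← ENNReal.ofReal_toReal hC, ← ENNReal.ofReal_mul h0, ENNReal.toReal_ofReal h0]
  refine ENNReal.ofReal_le_ofReal ?_
  rw [mul_div_assoc', div_le_iff₀ (by positivity)]
  nlinarith

/-- The Cauchy property survives because multiplication by η is bounded for the energy, the term
containing ∇η being absorbed by the local weighted L² bound. -/
lemma IsApprox.mul (hs0 : 0 < s) (hs1 : s < 1) (hns : 2 * s < n) {η : X n → ℝ} (hη : IsTest η)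
    {φ : ℕ → X n → ℝ} {W : X n → ℝ} (h : IsApprox s φ W) :
    IsApprox s (fun j P => η P * φ j P) (fun P => η P * W P) := by
  obtain ⟨C, hC, hmul⟩ := exists_energyWhole_mul_le hs0 hs1 hns hη
  obtain ⟨B, hB⟩ := hη.2.exists_bound_of_continuous hη.continuous
  refine ⟨fun j => hη.mul (h.test j), fun ε hε => ?_, ?_, fun K hK => ?_⟩
  · obtain ⟨δ, hδ, hδε⟩ := exists_pos_mul_ofReal_le hC hε
    obtain ⟨N, hN⟩ := h.cauchy δ hδ
    refine ⟨N, fun j hj k hk => ?_⟩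
    simp_rw [← mul_sub]
    exact (hmul _ ((h.test j).sub (h.test k))).trans
      ((mul_le_mul_right (hN j hj k hk) _).trans hδε)
  · refine (h.locallyIntegrable.smul B).mono
      (hη.continuous.aestronglyMeasurable.mul h.locallyIntegrable.aestronglyMeasurable)
      (ae_of_all _ fun P => ?_)
    rw [Pi.smul_apply, smul_eq_mul, norm_mul, norm_mul]
    gcongr
    exact (hB P).trans (le_abs_self B)
  · have h1 := ENNReal.Tendsto.const_mul (a := ENNReal.ofReal B) (h.tendsto K hK)
      (Or.inr ENNReal.ofReal_ne_top)
    rw [mul_zero] at h1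
    refine tendsto_of_tendsto_of_tendsto_of_le_of_le tendsto_const_nhds h1 (fun _ => zero_le)
      fun j => ?_
    change _ ≤ ENNReal.ofReal B * _
    rw [← lintegral_const_mul' _ _ ENNReal.ofReal_ne_top]
    refine lintegral_mono fun P => ?_
    rw [← mul_sub, enorm_mul]
    gcongr
    rw [← ofReal_norm]
    exact ENNReal.ofReal_le_ofReal (hB P)

lemma energyWhole_sub_le {φ ψ : X n → ℝ} (hφ : IsTest φ) (hψ : IsTest ψ) :
    energyWhole s (fun P => φ P - ψ P) ≤ 2 * (energyWhole s φ + energyWhole s ψ) := by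
  simp_rw [energyWhole_eq]
  rw [← lintegral_add_left (measurable_density hφ), ← lintegral_const_mul' _ _ (by simp)]
  refine lintegral_mono fun P => ?_
  rw [gradient_sub hφ hψ]
  have h1 := (pow_le_pow_left₀ zero_le (enorm_sub_le (a := gradient φ P) (b := gradient ψ P))
    2).trans (add_sq_le_two_mul _ _)
  calc _ ≤ _ := mul_le_mul_right h1 _
    _ = _ := by ring

lemma IsApprox.sub {φ ψ : ℕ → X n → ℝ} {W Z : X n → ℝ} (h : IsApprox s φ W)
    (h' : IsApprox s ψ Z) : IsApprox s (fun j P => φ j P - ψ j P) (fun P => W P - Z P) := by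
  refine ⟨fun j => (h.test j).sub (h'.test j), fun ε hε => ?_,
    h.locallyIntegrable.sub h'.locallyIntegrable, fun K hK => ?_⟩
  · obtain ⟨N, hN⟩ := h.cauchy (ε / 4) (by linarith)
    obtain ⟨N', hN'⟩ := h'.cauchy (ε / 4) (by linarith)
    refine ⟨max N N', fun j hj k hk => ?_⟩
    have h1 := hN j (le_of_max_le_left hj) k (le_of_max_le_left hk)
    have h2 := hN' j (le_of_max_le_right hj) k (le_of_max_le_right hk)
    simp_rw [sub_sub_sub_comm]
    refine (energyWhole_sub_le ((h.test j).sub (h.test k)) ((h'.test j).sub (h'.test k))).trans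
      ((mul_le_mul_right (add_le_add h1 h2) _).trans_eq ?_)
    rw [← ENNReal.ofReal_add (by linarith) (by linarith),
      show (2 : ℝ≥0∞) = ENNReal.ofReal 2 by simp,
      ← ENNReal.ofReal_mul (by norm_num)]
    congr 1; ring
  · have h1 := (h.tendsto K hK).add (h'.tendsto K hK)
    rw [add_zero] at h1
    refine tendsto_of_tendsto_of_tendsto_of_le_of_le tendsto_const_nhds h1 (fun _ => zero_le)
      fun j => ?_
    simp only
    rw [← lintegral_add_left' (f := fun P => ‖φ j P - W P‖ₑ)
      ((h.test j).continuous.aestronglyMeasurable.sub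
      h.locallyIntegrable.aestronglyMeasurable).enorm.restrict]
    refine lintegral_mono fun P => ?_
    simp only
    rw [sub_sub_sub_comm]
    exact enorm_sub_le

lemma ApproxHalf.sub {φ ψ : ℕ → X n → ℝ} {U V : X n → ℝ} (h : ApproxHalf s φ U)
    (h' : ApproxHalf s ψ V) :
    ApproxHalf s (fun j P => φ j P - ψ j P) (fun P => U P - V P) := by
  obtain ⟨W, hW, hφ⟩ := h
  obtain ⟨Z, hZ, hψ⟩ := h'
  refine ⟨_, ⟨⟨_, hφ.sub hψ⟩, ?_, ?_⟩, hφ.sub hψ⟩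
  · filter_upwards [hW.even, hZ.even] with P h1 h2
    rw [h1, h2]
  · filter_upwards [hW.restrict, hZ.restrict] with P h1 h2
    rw [h1, h2]

/-- The evenness of η is what keeps η times an even extension an even extension. -/
lemma ApproxHalf.mul (hs0 : 0 < s) (hs1 : s < 1) (hns : 2 * s < n) {η : X n → ℝ} (hη : IsTest η)
    (heven : ∀ P, η (reflect n P) = η P) {φ : ℕ → X n → ℝ} {U : X n → ℝ}
    (h : ApproxHalf s φ U) : ApproxHalf s (fun j P => η P * φ j P) (fun P => η P * U P) := by
  obtain ⟨W, hW, hφ⟩ := h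
  have h1 := hφ.mul hs0 hs1 hns hη
  refine ⟨_, ⟨⟨_, h1⟩, ?_, ?_⟩, h1⟩
  · filter_upwards [hW.even] with P h2
    rw [← reflect_apply, heven P, h2, reflect_apply]
  · filter_upwards [hW.restrict] with P h2
    rw [h2]

/-! ### Traces of functions in the energy space. -/

lemma ae_eq_of_tendsto_eLpNorm {α F : Type*} [MeasurableSpace α] {μ : Measure α}
    [NormedAddCommGroup F] {p : ℝ≥0∞} (hp : 1 ≤ p) {f : ℕ → α → F} {g g' : α → F}
    (hf : ∀ j, AEStronglyMeasurable (f j) μ) (hg : AEStronglyMeasurable g μ)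
    (hg' : AEStronglyMeasurable g' μ)
    (h : Tendsto (fun j => eLpNorm (f j - g) p μ) atTop (𝓝 0))
    (h' : Tendsto (fun j => eLpNorm (f j - g') p μ) atTop (𝓝 0)) : g =ᵐ[μ] g' := by
  have h1 : Tendsto (fun _ : ℕ => eLpNorm (g - g') p μ) atTop (𝓝 0) := by
    refine tendsto_eLpNorm_sub_unique hp hf (fun _ => hg) hg' h' ?_
    simp_rw [eLpNorm_sub_comm g]
    exact h
  have h2 := tendsto_nhds_unique tendsto_const_nhds h1
  rw [eLpNorm_eq_zero_iff (hg.sub hg') (one_pos.trans_le hp).ne'] at h2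
  filter_upwards [h2] with x hx
  exact sub_eq_zero.1 hx

lemma eLpNorm_mul_le {α F : Type*} [MeasurableSpace α] {μ : Measure α} [NormedAddCommGroup F]
    [NormedSpace ℝ F] {p : ℝ≥0∞} {c : α → ℝ} {A : ℝ≥0∞} (hA : A ≠ ⊤) (hc : ∀ x, ‖c x‖ₑ ≤ A)
    (f : α → F) : eLpNorm (fun x => c x • f x) p μ ≤ A * eLpNorm f p μ := by
  have hA' : A = (A.toNNReal : ℝ≥0∞) := (ENNReal.coe_toNNReal hA).symm
  rw [hA']
  refine (eLpNorm_le_nnreal_smul_eLpNorm_of_ae_le_mul (c := A.toNNReal) (g := f)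
    (ae_of_all _ fun x => ?_) p).trans_eq rfl
  rw [nnnorm_smul]
  gcongr
  have := hc x
  rw [hA', enorm_eq_nnnorm] at this
  exact_mod_cast this

lemma eLpNorm_critExp (hs0 : 0 < s) (hns : 2 * s < n) {Y : Type*} [MeasurableSpace Y]
    (m : Measure Y) (f : Y → ℝ) :
    eLpNorm f (ENNReal.ofReal (critExp n s)) m =
      (∫⁻ x, ‖f x‖ₑ ^ critExp n s ∂m) ^ (1 / critExp n s) := by
  have hp : 0 < critExp n s := by linarith [two_lt_critExp hs0 hns]
  rw [eLpNorm_eq_lintegral_rpow_enorm_toReal (by simpa using hp) (by simp),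
    ENNReal.toReal_ofReal hp.le]

lemma exists_eLpNorm_trace_le (hs0 : 0 < s) (hs1 : s ≤ 1) (hns : 2 * s < n) :
    ∃ C : ℝ≥0∞, C ≠ ⊤ ∧ ∀ φ : X n → ℝ, IsTest φ →
      eLpNorm (fun x : E n => φ (pt x 0)) (ENNReal.ofReal (critExp n s)) volume ≤
        C * eLpNorm (gradient φ) 2 (halfMeas n s) := by
  obtain ⟨C, hC, h⟩ := exists_trace_le (n := n) hs0 hs1 hns
  have hp : 0 < critExp n s := by linarith [two_lt_critExp hs0 hns]
  refine ⟨C ^ (1 / critExp n s), by finiteness, fun φ hφ => ?_⟩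
  rw [eLpNorm_critExp hs0 hns]
  calc _ ≤ (C * halfEnergy s φ ^ (critExp n s / 2)) ^ (1 / critExp n s) := by
        gcongr; exact h φ hφ
    _ = _ := by
        rw [ENNReal.mul_rpow_of_nonneg _ _ (by positivity), halfEnergy_eq_eLpNorm,
          ← ENNReal.rpow_natCast, ← ENNReal.rpow_mul, ← ENNReal.rpow_mul]
        congr 1
        rw [show ((2 : ℕ) : ℝ) * (critExp n s / 2 * (1 / critExp n s)) = 1 by
          push_cast; field_simp, ENNReal.rpow_one]

lemma one_le_critExp (hs0 : 0 < s) (hns : 2 * s < n) : 1 ≤ ENNReal.ofReal (critExp n s) := by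
  rw [← ENNReal.ofReal_one]
  exact ENNReal.ofReal_le_ofReal (by linarith [two_lt_critExp hs0 hns])

lemma isClosedEmbedding_pt : Topology.IsClosedEmbedding fun x : E n => pt x 0 := by
  refine Isometry.isClosedEmbedding fun x y => ?_
  rw [edist_dist, edist_dist, dist_eq_norm, dist_eq_norm]
  congr 1
  refine (sq_eq_sq₀ (norm_nonneg _) (norm_nonneg _)).1 ?_
  rw [WithLp.prod_norm_sq_eq_of_L2]
  simp [pt]

lemma IsTest.continuous_trace {φ : X n → ℝ} (hφ : IsTest φ) :
    Continuous fun x : E n => φ (pt x 0) := hφ.continuous.comp (continuous_pt_left 0)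

lemma IsTest.hasCompactSupport_trace {φ : X n → ℝ} (hφ : IsTest φ) :
    HasCompactSupport fun x : E n => φ (pt x 0) := hφ.2.comp_isClosedEmbedding isClosedEmbedding_pt

/-- The trace inequality for differences of approximants makes their boundary values a Cauchy
sequence in L^p. -/
lemma ApproxHalf.exists_isTrace (hs0 : 0 < s) (hs1 : s < 1) (hns : 2 * s < n)
    {φ : ℕ → X n → ℝ} {U : X n → ℝ} (h : ApproxHalf s φ U) :
    ∃ u, IsTrace s U u ∧ MemLp u (ENNReal.ofReal (critExp n s)) volume := by
  obtain ⟨C, hC, htr⟩ := exists_eLpNorm_trace_le (n := n) hs0 hs1.le hns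
  obtain ⟨W, hW, hφ⟩ := h
  obtain ⟨u, hu, hut⟩ := exists_tendsto_eLpNorm_of_cauchy (μ := (volume : Measure (E n)))
    (one_le_critExp hs0 hns) (f := fun j x => φ j (pt x 0))
    (fun j => (hφ.test j).continuous_trace.memLp_of_hasCompactSupport
      (hφ.test j).hasCompactSupport_trace) (fun ε hε => by
      have hε' : 0 < ε / (C + 1) := ENNReal.div_pos hε.ne' (by finiteness)
      obtain ⟨N, hN⟩ := hφ.cauchy_eLpNorm hε'
      refine ⟨N, fun j hj k hk => ?_⟩
      have h1 := htr _ ((hφ.test j).sub (hφ.test k))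
      rw [gradient_sub' (hφ.test j) (hφ.test k)] at h1
      refine h1.trans_lt ?_
      have h2 := hN j hj k hk
      rw [ENNReal.lt_div_iff_mul_lt (by simp) (by left; finiteness), mul_comm] at h2
      exact (mul_le_mul_left le_self_add _).trans_lt h2)
  exact ⟨u, ⟨hu.1, W, φ, hW, hφ, hut⟩, hu⟩

/-- The traces of approximating test functions converge. -/
theorem ApproxHalf.trace (hs0 : 0 < s) (hs1 : s < 1) (hns : 2 * s < n)
    {φ : ℕ → X n → ℝ} {U : X n → ℝ} (h : ApproxHalf s φ U) :
    MemLp (trace s U) (ENNReal.ofReal (critExp n s)) volume ∧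
      Tendsto (fun j => eLpNorm ((fun x => φ j (pt x 0)) - CCP.trace s U)
        (ENNReal.ofReal (critExp n s)) volume) atTop (𝓝 0) := by
  obtain ⟨C, hC, htr⟩ := exists_eLpNorm_trace_le (n := n) hs0 hs1.le hns
  have hp := one_le_critExp (n := n) hs0 hns
  obtain ⟨u, hu, huL⟩ := h.exists_isTrace hs0 hs1 hns
  have hex : ∃ u, IsTrace s U u := ⟨u, hu⟩
  have htrace : IsTrace s U (CCP.trace s U) := by
    rw [CCP.trace, dif_pos hex]; exact hex.choose_spec
  -- A trace comes with its own extension and its own sequence. Both gradient sequences converge to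
  -- `grad U` in the half-space, so the trace inequality forces the two sequences of boundary values
  -- together.
  have key : ∀ w, IsTrace s U w →
      Tendsto (fun j => eLpNorm ((fun x => φ j (pt x 0)) - w)
        (ENNReal.ofReal (critExp n s)) volume) atTop (𝓝 0) := by
    rintro w ⟨hw, W, ψ, hW, hψ, hlim⟩
    have hψU : ApproxHalf s ψ U := ⟨W, hW, hψ⟩
    refine tendsto_eLpNorm_sub_unique hp (f := fun j x => ψ j (pt x 0))
      (fun j => (hψ.test j).continuous_trace.aestronglyMeasurable)
      (fun j => (h.test j).continuous_trace.aestronglyMeasurable) hw hlim ?_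
    have h1 := (h.grad hs1).2
    have h2 := (hψU.grad hs1).2
    have h3 := ENNReal.Tendsto.const_mul (a := C) (h1.add h2) (Or.inr hC)
    rw [add_zero, mul_zero] at h3
    refine tendsto_of_tendsto_of_tendsto_of_le_of_le tendsto_const_nhds h3 (fun _ => zero_le)
      fun j => ?_
    have h4 := htr _ ((h.test j).sub (hψ.test j))
    rw [gradient_sub' (h.test j) (hψ.test j)] at h4
    refine h4.trans (mul_le_mul_right ?_ _)
    have h5 := eLpNorm_sub_le (p := 2)
      ((continuous_gradient (h.test j)).aestronglyMeasurable.sub (h.grad hs1).1.1)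
      ((continuous_gradient (hψ.test j)).aestronglyMeasurable.sub (h.grad hs1).1.1) one_le_two
    rwa [sub_sub_sub_cancel_right] at h5
  have hae : CCP.trace s U =ᵐ[volume] u := ae_eq_of_tendsto_eLpNorm hp
    (fun j => (h.test j).continuous_trace.aestronglyMeasurable) htrace.1 hu.1
    (key _ htrace) (key _ hu)
  exact ⟨huL.ae_eq hae.symm, key _ htrace⟩

/-- `grad` and `trace` are defined by choice, so algebraic identities hold only almost everywhere;
they are obtained by uniqueness of limits of approximating test functions. -/
lemma grad_sub_ae (hs1 : s < 1) {U V : X n → ℝ} (hU : MemHalf s U) (hV : MemHalf s V) :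
    grad (fun P => U P - V P) =ᵐ[halfMeas n s] grad U - grad V := by
  obtain ⟨φ, hφ⟩ := hU.exists_approxHalf
  obtain ⟨ψ, hψ⟩ := hV.exists_approxHalf
  have h := hφ.sub hψ
  have h1 := (hφ.grad hs1).2.add (hψ.grad hs1).2
  rw [add_zero] at h1
  refine ae_eq_of_tendsto_eLpNorm one_le_two
    (fun j => (continuous_gradient (h.test j)).aestronglyMeasurable) (h.grad hs1).1.1
    ((hφ.grad hs1).1.1.sub (hψ.grad hs1).1.1) (h.grad hs1).2 ?_
  refine tendsto_of_tendsto_of_tendsto_of_le_of_le tendsto_const_nhds h1 (fun _ => zero_le)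
    fun j => ?_
  simp only
  rw [gradient_sub' (hφ.test j) (hψ.test j), sub_sub_sub_comm]
  exact eLpNorm_sub_le ((continuous_gradient (hφ.test j)).aestronglyMeasurable.sub
    (hφ.grad hs1).1.1) ((continuous_gradient (hψ.test j)).aestronglyMeasurable.sub
    (hψ.grad hs1).1.1) one_le_two

lemma trace_sub_ae (hs0 : 0 < s) (hs1 : s < 1) (hns : 2 * s < n) {U V : X n → ℝ}
    (hU : MemHalf s U) (hV : MemHalf s V) :
    trace s (fun P => U P - V P) =ᵐ[volume] trace s U - trace s V := by
  obtain ⟨φ, hφ⟩ := hU.exists_approxHalf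
  obtain ⟨ψ, hψ⟩ := hV.exists_approxHalf
  have h := hφ.sub hψ
  have h1 := (hφ.trace hs0 hs1 hns).2.add (hψ.trace hs0 hs1 hns).2
  rw [add_zero] at h1
  refine ae_eq_of_tendsto_eLpNorm (one_le_critExp hs0 hns)
    (fun j => (h.test j).continuous_trace.aestronglyMeasurable) (h.trace hs0 hs1 hns).1.1
    ((hφ.trace hs0 hs1 hns).1.1.sub (hψ.trace hs0 hs1 hns).1.1) (h.trace hs0 hs1 hns).2 ?_
  refine tendsto_of_tendsto_of_tendsto_of_le_of_le tendsto_const_nhds h1 (fun _ => zero_le)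
    fun j => ?_
  have h2 : (fun x : E n => φ j (pt x 0) - ψ j (pt x 0)) - (CCP.trace s U - CCP.trace s V) =
      ((fun x => φ j (pt x 0)) - CCP.trace s U) - ((fun x => ψ j (pt x 0)) - CCP.trace s V) := by
    ext x; simp only [Pi.sub_apply]; ring
  simp only
  rw [h2]
  exact eLpNorm_sub_le ((hφ.test j).continuous_trace.aestronglyMeasurable.sub
    (hφ.trace hs0 hs1 hns).1.1) ((hψ.test j).continuous_trace.aestronglyMeasurable.sub
    (hψ.trace hs0 hs1 hns).1.1) (one_le_critExp hs0 hns)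

lemma trace_mul_ae (hs0 : 0 < s) (hs1 : s < 1) (hns : 2 * s < n) {η : X n → ℝ} (hη : IsTest η)
    (heven : ∀ P, η (reflect n P) = η P) {U : X n → ℝ} (hU : MemHalf s U) :
    trace s (fun P => η P * U P) =ᵐ[volume] fun x => η (pt x 0) * trace s U x := by
  obtain ⟨φ, hφ⟩ := hU.exists_approxHalf
  have h := hφ.mul hs0 hs1 hns hη heven
  obtain ⟨A, hA, hA1, -⟩ := hη.exists_enorm_le
  have h1 := ENNReal.Tendsto.const_mul (a := A) (hφ.trace hs0 hs1 hns).2 (Or.inr hA)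
  rw [mul_zero] at h1
  refine ae_eq_of_tendsto_eLpNorm (one_le_critExp hs0 hns)
    (fun j => (h.test j).continuous_trace.aestronglyMeasurable) (h.trace hs0 hs1 hns).1.1
    (hη.continuous_trace.aestronglyMeasurable.mul (hφ.trace hs0 hs1 hns).1.1)
    (h.trace hs0 hs1 hns).2 ?_
  refine tendsto_of_tendsto_of_tendsto_of_le_of_le tendsto_const_nhds h1 (fun _ => zero_le)
    fun j => ?_
  refine le_trans (le_of_eq ?_) (eLpNorm_mul_le hA (fun x : E n => hA1 (pt x 0)) _)
  congr 1
  ext x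
  simp only [Pi.sub_apply, smul_eq_mul, mul_sub]

/-! ### Weak convergence of gradients in weighted L². -/

lemma innerHalf_eq (U V : X n → ℝ) :
    innerHalf s U V = ∫ P, inner ℝ (grad U P) (grad V P) ∂halfMeas n s := by
  rw [halfMeas, integral_withDensity_eq_integral_toReal_smul measurable_weight.ennreal_ofReal
    (ae_of_all _ fun _ => ENNReal.ofReal_lt_top)]
  refine integral_congr_ae (ae_of_all _ fun P => ?_)
  simp only [ENNReal.toReal_ofReal (weight_nonneg s P), smul_eq_mul]

lemma normHalf_eq {U : X n → ℝ} (hU : AEStronglyMeasurable (grad U) (halfMeas n s)) :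
    normHalf s U = (eLpNorm (grad U) 2 (halfMeas n s)).toReal := by
  have h1 : ∫ P in half n, weight s P * ‖grad U P‖ ^ 2 = ∫ P, ‖grad U P‖ ^ 2 ∂halfMeas n s := by
    rw [halfMeas, integral_withDensity_eq_integral_toReal_smul measurable_weight.ennreal_ofReal
      (ae_of_all _ fun _ => ENNReal.ofReal_lt_top)]
    refine integral_congr_ae (ae_of_all _ fun P => ?_)
    simp only [ENNReal.toReal_ofReal (weight_nonneg s P), smul_eq_mul]
  rw [normHalf, h1, integral_eq_lintegral_of_nonneg_ae (f := fun P => ‖grad U P‖ ^ 2)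
    (ae_of_all _ fun _ => by positivity) (hU.norm.pow 2)]
  have h2 : ∀ P, ENNReal.ofReal (‖grad U P‖ ^ 2) = ‖grad U P‖ₑ ^ 2 := fun P => by
    rw [ENNReal.ofReal_pow (norm_nonneg _), ofReal_norm]
  simp_rw [h2]
  rw [← eLpNorm_two_sq, ENNReal.toReal_pow, Real.sqrt_sq ENNReal.toReal_nonneg]

/-- Weak convergence against a spanning set of a bounded sequence. -/
lemma tendsto_inner_of_forall_mem {H : Type*} [NormedAddCommGroup H] [InnerProductSpace ℝ H]
    [CompleteSpace H] {S : Set H} {g : ℕ → H} {g0 : H} (hg : ∀ k, g k ∈ S) (hg0 : g0 ∈ S) {C : ℝ}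
    (hC : ∀ k, ‖g k‖ ≤ C)
    (h : ∀ y ∈ S, Tendsto (fun k => inner ℝ (g k) y) atTop (𝓝 (inner ℝ g0 y))) (y : H) :
    Tendsto (fun k => inner ℝ (g k - g0) y) atTop (𝓝 0) := by
  let T : Submodule ℝ H :=
    { carrier := {y | Tendsto (fun k => inner ℝ (g k - g0) y) atTop (𝓝 0)}
      add_mem' := fun {a b} ha hb => by
        have := Tendsto.add ha hb
        simp only [← inner_add_right, add_zero] at this
        exact this
      zero_mem' := by simp
      smul_mem' := fun c a ha => by
        have := Tendsto.const_mul c ha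
        simp only [← real_inner_smul_right, mul_zero] at this
        exact this }
  have hbd : ∀ k, ‖g k - g0‖ ≤ C + ‖g0‖ := fun k =>
    (norm_sub_le _ _).trans (add_le_add_left (hC k) _)
  have hC0 : 0 ≤ C + ‖g0‖ := (norm_nonneg _).trans (hbd 0)
  have hT : IsClosed (T : Set H) := by
    refine isClosed_of_closure_subset fun a ha => ?_
    change Tendsto (fun k => inner ℝ (g k - g0) a) atTop (𝓝 0)
    rw [Metric.tendsto_atTop]
    intro ε hε
    obtain ⟨b, hb, hab⟩ := Metric.mem_closure_iff.1 ha (ε / 2 / (C + ‖g0‖ + 1)) (by positivity)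
    obtain ⟨N, hN⟩ := Metric.tendsto_atTop.1 (show Tendsto (fun k => inner ℝ (g k - g0) b)
      atTop (𝓝 0) from hb) (ε / 2) (by positivity)
    refine ⟨N, fun k hk => ?_⟩
    have h1 := hN k hk
    rw [dist_zero_right] at h1 ⊢
    have h2 : inner ℝ (g k - g0) a = inner ℝ (g k - g0) (a - b) + inner ℝ (g k - g0) b := by
      rw [← inner_add_right, sub_add_cancel]
    rw [dist_eq_norm, lt_div_iff₀ (by positivity)] at hab
    have h3 : ‖inner ℝ (g k - g0) (a - b)‖ ≤ ‖a - b‖ * (C + ‖g0‖ + 1) := by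
      refine (norm_inner_le_norm _ _).trans ?_
      rw [mul_comm]
      gcongr
      linarith [hbd k]
    rw [h2]
    linarith [norm_add_le (inner ℝ (g k - g0) (a - b)) (inner ℝ (g k - g0) b)]
  have hST : S ⊆ T := fun y hy => by
    have := (h y hy).sub_const (inner ℝ g0 y)
    simp only [← inner_sub_left, sub_self] at this
    exact this
  -- All g_k - g0 lie in M, so the component of y orthogonal to M pairs to zero with them, and only
  -- the component in M, where convergence is known, matters.
  let M := (Submodule.span ℝ S).topologicalClosure
  have hMT : M ≤ T := Submodule.topologicalClosure_minimal _ (Submodule.span_le.2 hST) hT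
  have hSM : S ⊆ M := Submodule.subset_span.trans (Submodule.le_topologicalClosure _)
  have : CompleteSpace M := (Submodule.isClosed_topologicalClosure _).completeSpace_coe
  obtain ⟨a, ha, b, hb, rfl⟩ := M.exists_add_mem_mem_orthogonal y
  have h1 : ∀ k, inner ℝ (g k - g0) (a + b) = inner ℝ (g k - g0) a := fun k => by
    rw [inner_add_right, (Submodule.mem_orthogonal M b).1 hb _
      (M.sub_mem (hSM (hg k)) (hSM hg0)), add_zero]
  simp_rw [h1]
  exact hMT ha

lemma MemHalf.memLp (hs1 : s < 1) {U : X n → ℝ} (hU : MemHalf s U) :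
    MemLp (grad U) 2 (halfMeas n s) :=
  (hU.exists_approxHalf.choose_spec.grad hs1).1

lemma inner_toLp {f g : X n → X n} (hf : MemLp f 2 (halfMeas n s))
    (hg : MemLp g 2 (halfMeas n s)) :
    inner ℝ (hf.toLp f) (hg.toLp g) = ∫ P, inner ℝ (f P) (g P) ∂halfMeas n s := by
  rw [L2.inner_def]
  refine integral_congr_ae ?_
  filter_upwards [hf.coeFn_toLp, hg.coeFn_toLp] with P h1 h2
  rw [h1, h2]

/-- Weak convergence in the energy space is weak convergence of gradients in `L²`. -/
lemma tendsto_inner_grad (hs1 : s < 1) {U : ℕ → X n → ℝ} {V : X n → ℝ}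
    (hU : ∀ k, MemHalf s (U k)) (hV : MemHalf s V) (hbdd : IsBoundedSeq s U)
    (hweak : WeaklyTendsto s U V) (K : Lp (X n) 2 (halfMeas n s)) :
    Tendsto (fun k => inner ℝ (((hU k).memLp hs1).toLp _ - (hV.memLp hs1).toLp _) K)
      atTop (𝓝 0) := by
  obtain ⟨C, hC⟩ := hbdd
  refine tendsto_inner_of_forall_mem
    (S := {y | ∃ Φ : X n → ℝ, ∃ h : MemHalf s Φ, y = (h.memLp hs1).toLp _})
    (fun k => ⟨_, hU k, rfl⟩) ⟨_, hV, rfl⟩ (C := C) (fun k => ?_) ?_ K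
  · rw [Lp.norm_toLp, ← normHalf_eq ((hU k).memLp hs1).1]
    exact hC k
  · rintro _ ⟨Φ, hΦ, rfl⟩
    simp_rw [inner_toLp, ← innerHalf_eq]
    exact hweak Φ hΦ

/-! ### Limits of localized energies. -/

lemma lintegral_enorm_rpow_eq {Y : Type*} [TopologicalSpace Y] [MeasurableSpace Y]
    [OpensMeasurableSpace Y] {m : Measure Y} [IsFiniteMeasureOnCompacts m] {c : Y → ℝ}
    (hc : Continuous c) (hcs : HasCompactSupport c) {r : ℝ} (hr : 0 < r) :
    ∫⁻ x, ‖c x‖ₑ ^ r ∂m = ENNReal.ofReal (∫ x, |c x| ^ r ∂m) := by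
  have h1 : Continuous fun x => |c x| ^ r := hc.abs.rpow_const fun _ => Or.inr hr.le
  have h2 : HasCompactSupport fun x => |c x| ^ r :=
    hcs.comp_left (g := fun t => |t| ^ r) (by simp [hr.ne'])
  rw [ofReal_integral_eq_lintegral_ofReal (h1.integrable_of_hasCompactSupport h2)
    (ae_of_all _ fun _ => by positivity)]
  refine lintegral_congr fun x => ?_
  rw [← ENNReal.ofReal_rpow_of_nonneg (abs_nonneg _) hr.le, ← Real.norm_eq_abs, ofReal_norm]

lemma MeasTendsto.lintegral_rpow {Y : Type*} [TopologicalSpace Y] [MeasurableSpace Y]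
    [OpensMeasurableSpace Y] {m : ℕ → Measure Y} {m' : Measure Y}
    [∀ k, IsFiniteMeasureOnCompacts (m k)] [IsFiniteMeasureOnCompacts m'] (h : MeasTendsto m m')
    {c : Y → ℝ} (hc : Continuous c) (hcs : HasCompactSupport c) {r : ℝ} (hr : 0 < r) :
    Tendsto (fun k => ∫⁻ x, ‖c x‖ₑ ^ r ∂m k) atTop (𝓝 (∫⁻ x, ‖c x‖ₑ ^ r ∂m')) := by
  simp_rw [lintegral_enorm_rpow_eq hc hcs hr]
  exact ENNReal.tendsto_ofReal (h _ (hc.abs.rpow_const fun _ => Or.inr hr.le)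
    (hcs.comp_left (g := fun t => |t| ^ r) (by simp [hr.ne'])))

lemma lintegral_energyMeas (hs1 : s < 1) {U : X n → ℝ} (hU : MemHalf s U) (f : X n → ℝ≥0∞) :
    ∫⁻ P, f P ∂energyMeas s U = ∫⁻ P, ‖grad U P‖ₑ ^ 2 * f P ∂halfMeas n s := by
  have hm : AEStronglyMeasurable (grad U) (volume.restrict (half n)) :=
    (hU.memLp hs1).1.mono_ac restrict_half_absolutelyContinuous
  have h1 : AEMeasurable (fun P => ENNReal.ofReal (weight s P * ‖grad U P‖ ^ 2))
      (volume.restrict (half n)) :=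
    ((measurable_weight.aemeasurable).mul (hm.norm.aemeasurable.pow_const 2)).ennreal_ofReal
  rw [energyMeas, lintegral_withDensity_eq_lintegral_mul_non_measurable₀ _ h1
    (ae_of_all _ fun _ => ENNReal.ofReal_lt_top), lintegral_halfMeas]
  refine lintegral_congr fun P => ?_
  rw [Pi.mul_apply, ENNReal.ofReal_mul (weight_nonneg s P), ENNReal.ofReal_pow (norm_nonneg _),
    ofReal_norm, mul_assoc]

lemma isFiniteMeasure_energyMeas (hs1 : s < 1) {U : X n → ℝ} (hU : MemHalf s U) :
    IsFiniteMeasure (energyMeas s U) := by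
  refine ⟨?_⟩
  rw [← lintegral_one, lintegral_energyMeas hs1 hU]
  simp_rw [mul_one]
  rw [← eLpNorm_two_sq]
  exact ENNReal.pow_lt_top (hU.memLp hs1).2

lemma lintegral_traceMeas {U : X n → ℝ} (hU : AEStronglyMeasurable (trace s U) volume)
    (f : E n → ℝ≥0∞) :
    ∫⁻ x, f x ∂traceMeas s U =
      ∫⁻ x, ENNReal.ofReal (|trace s U x| ^ critExp n s) * f x := by
  have h1 : AEMeasurable (fun x => ENNReal.ofReal (|trace s U x| ^ critExp n s))
      (volume : Measure (E n)) := (hU.norm.aemeasurable.pow_const _).ennreal_ofReal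
  rw [traceMeas, lintegral_withDensity_eq_lintegral_mul_non_measurable₀ _ h1
    (ae_of_all _ fun _ => ENNReal.ofReal_lt_top)]
  rfl

lemma MemHalf.memLp_trace (hs0 : 0 < s) (hs1 : s < 1) (hns : 2 * s < n) {U : X n → ℝ}
    (hU : MemHalf s U) : MemLp (trace s U) (ENNReal.ofReal (critExp n s)) volume :=
  (hU.exists_approxHalf.choose_spec.trace hs0 hs1 hns).1

lemma eLpNorm_traceMeas (hs0 : 0 < s) (hs1 : s < 1) (hns : 2 * s < n) {U : X n → ℝ}
    (hU : MemHalf s U) (c : E n → ℝ) :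
    eLpNorm c (ENNReal.ofReal (critExp n s)) (traceMeas s U) =
      eLpNorm (fun x => c x * trace s U x) (ENNReal.ofReal (critExp n s)) volume := by
  have hp : 0 < critExp n s := by linarith [two_lt_critExp hs0 hns]
  rw [eLpNorm_critExp hs0 hns, eLpNorm_critExp hs0 hns,
    lintegral_traceMeas (hU.memLp_trace hs0 hs1 hns).1]
  congr 1
  refine lintegral_congr fun x => ?_
  rw [enorm_mul, ENNReal.mul_rpow_of_nonneg _ _ hp.le, mul_comm,
    ← ENNReal.ofReal_rpow_of_nonneg (abs_nonneg _) hp.le, ← Real.norm_eq_abs, ofReal_norm]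

lemma isFiniteMeasure_traceMeas (hs0 : 0 < s) (hs1 : s < 1) (hns : 2 * s < n) {U : X n → ℝ}
    (hU : MemHalf s U) : IsFiniteMeasure (traceMeas s U) := by
  have hp : 0 < critExp n s := by linarith [two_lt_critExp hs0 hns]
  refine ⟨?_⟩
  have h1 := eLpNorm_traceMeas hs0 hs1 hns hU (fun _ => 1)
  simp_rw [one_mul] at h1
  have h2 := (hU.memLp_trace hs0 hs1 hns).2
  rw [← h1, eLpNorm_critExp hs0 hns] at h2
  simp only [enorm_one, ENNReal.one_rpow, lintegral_one] at h2
  by_contra h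
  rw [not_lt_top_iff.1 h, ENNReal.top_rpow_of_pos (by positivity)] at h2
  exact lt_irrefl _ h2

lemma memLp_smul_of_bounded {F : Type*} [NormedAddCommGroup F] [NormedSpace ℝ F] {m : Measure (X n)}
    {q : ℝ≥0∞} {c : X n → ℝ} (hc : Continuous c) (hcs : HasCompactSupport c) {f : X n → F}
    (hf : MemLp f q m) : MemLp (fun P => c P • f P) q m := by
  obtain ⟨C, hC⟩ := hcs.exists_bound_of_continuous hc
  exact hf.smul (memLp_top_of_bound hc.aestronglyMeasurable C (ae_of_all _ hC))

lemma integrable_sq_inner {c : X n → ℝ} (hc : Continuous c) (hcs : HasCompactSupport c)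
    {f g : X n → X n} (hf : MemLp f 2 (halfMeas n s)) (hg : MemLp g 2 (halfMeas n s)) :
    Integrable (fun P => c P ^ 2 * inner ℝ (f P) (g P)) (halfMeas n s) := by
  have hcf := memLp_smul_of_bounded hc hcs hf
  have hcg := memLp_smul_of_bounded hc hcs hg
  refine (L2.integrable_inner (𝕜 := ℝ) (hcf.toLp _) (hcg.toLp _)).congr ?_
  filter_upwards [hcf.coeFn_toLp, hcg.coeFn_toLp] with P h1 h2
  rw [h1, h2, real_inner_smul_left, real_inner_smul_right]
  ring

/-- The localized energy of `U_k - V` converges to the defect of energy. -/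
lemma tendsto_lintegral_defect (hs1 : s < 1) {U : ℕ → X n → ℝ} {V : X n → ℝ}
    (hU : ∀ k, MemHalf s (U k)) (hV : MemHalf s V) (hbdd : IsBoundedSeq s U)
    (hweak : WeaklyTendsto s U V) {μ : Measure (X n)}
    (hμ : MeasTendsto (fun k => energyMeas s (U k)) μ) {c : X n → ℝ} (hc : Continuous c)
    (hcs : HasCompactSupport c) :
    Tendsto (fun k => ∫ P, c P ^ 2 * ‖grad (U k) P - grad V P‖ ^ 2 ∂halfMeas n s) atTop
      (𝓝 ((∫ P, c P ^ 2 ∂μ) - ∫ P, c P ^ 2 * ‖grad V P‖ ^ 2 ∂halfMeas n s)) := by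
  have hV2 := hV.memLp hs1
  have hc2 : HasCompactSupport fun P => c P ^ 2 := hcs.comp_left (g := fun t => t ^ 2) (by simp)
  have hcV : MemLp (fun P => c P ^ 2 • grad V P) 2 (halfMeas n s) :=
    memLp_smul_of_bounded (hc.pow 2) hc2 hV2
  have h1 : Tendsto (fun k => ∫ P, c P ^ 2 * ‖grad (U k) P‖ ^ 2 ∂halfMeas n s) atTop
      (𝓝 (∫ P, c P ^ 2 ∂μ)) := by
    refine (hμ _ (hc.pow 2) hc2).congr fun k => ?_
    have hUk := (hU k).memLp hs1
    change ∫ P, c P ^ 2 ∂energyMeas s (U k) = _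
    rw [integral_eq_lintegral_of_nonneg_ae (f := fun P => c P ^ 2)
      (ae_of_all _ fun _ => sq_nonneg _)
      (hc.pow 2).aestronglyMeasurable, lintegral_energyMeas hs1 (hU k),
      integral_eq_lintegral_of_nonneg_ae (f := fun P => c P ^ 2 * ‖grad (U k) P‖ ^ 2)
      (ae_of_all _ fun _ => mul_nonneg (sq_nonneg _) (sq_nonneg _))
      ((hc.pow 2).aestronglyMeasurable.mul (hUk.1.norm.pow 2))]
    congr 1
    refine lintegral_congr fun P => ?_
    rw [ENNReal.ofReal_mul (by positivity), ENNReal.ofReal_pow (norm_nonneg _), ofReal_norm,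
      mul_comm]
  -- The expansion is |a - b|² = |a|² - 2⟨a - b, b⟩ - |b|², with a = ∇U_k and b = ∇V. The middle
  -- term is tested against c²∇V, which need not be a gradient; hence the need for weak convergence
  -- in all of L².
  have h2 := tendsto_inner_grad hs1 hU hV hbdd hweak (hcV.toLp _)
  have h3 := h1.sub (h2.const_mul 2)
  have h4 := h3.sub_const (∫ P, c P ^ 2 * ‖grad V P‖ ^ 2 ∂halfMeas n s)
  rw [mul_zero, sub_zero] at h4
  refine h4.congr fun k => ?_
  have hUk := (hU k).memLp hs1
  have e1 := integrable_sq_inner hc hcs hUk hUk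
  have e2 := integrable_sq_inner hc hcs hUk hV2
  have e3 := integrable_sq_inner hc hcs hV2 hV2
  have h5 : ∀ f : X n → X n, ∀ hf : MemLp f 2 (halfMeas n s),
      inner ℝ (hf.toLp f) (hcV.toLp _) =
        ∫ P, c P ^ 2 * inner ℝ (f P) (grad V P) ∂halfMeas n s := fun f hf => by
    rw [inner_toLp]
    simp_rw [inner_smul_right]
  rw [inner_sub_left, h5, h5]
  simp_rw [← real_inner_self_eq_norm_sq]
  have e4 : Integrable (fun P => 2 * (c P ^ 2 * inner ℝ (grad (U k) P) (grad V P) -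
      c P ^ 2 * inner ℝ (grad V P) (grad V P))) (halfMeas n s) := (e2.sub e3).const_mul 2
  have e5 : Integrable (fun P => c P ^ 2 * inner ℝ (grad (U k) P) (grad (U k) P) -
      2 * (c P ^ 2 * inner ℝ (grad (U k) P) (grad V P) -
      c P ^ 2 * inner ℝ (grad V P) (grad V P))) (halfMeas n s) := e1.sub e4
  rw [← integral_sub e2 e3, ← integral_const_mul, ← integral_sub e1 e4, ← integral_sub e5 e3]
  refine integral_congr_ae (ae_of_all _ fun P => ?_)
  simp only [inner_sub_left, inner_sub_right, real_inner_comm (grad (U k) P) (grad V P)]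
  ring

lemma rpow_half_sq (a : ℝ≥0∞) : (a ^ 2) ^ (1 / 2 : ℝ) = a := by
  rw [← ENNReal.rpow_natCast, ← ENNReal.rpow_mul]; norm_num

lemma lintegral_sq_eq_ofReal {m : Measure (X n)} [IsFiniteMeasureOnCompacts m] {c : X n → ℝ}
    (hc : Continuous c) (hcs : HasCompactSupport c) :
    ∫⁻ P, ‖c P‖ₑ ^ 2 ∂m = ENNReal.ofReal (∫ P, c P ^ 2 ∂m) := by
  have h := lintegral_enorm_rpow_eq (m := m) hc hcs two_pos
  simpa using h

/-- Only an upper bound for the limit is retained: the energy of `V` is dropped, since the norm of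
`c` in L²(μ) suffices for every later use. -/
lemma tendsto_eLpNorm_defect (hs1 : s < 1) {U : ℕ → X n → ℝ} {V : X n → ℝ}
    (hU : ∀ k, MemHalf s (U k)) (hV : MemHalf s V) (hbdd : IsBoundedSeq s U)
    (hweak : WeaklyTendsto s U V) {μ : Measure (X n)} [IsFiniteMeasureOnCompacts μ]
    (hμ : MeasTendsto (fun k => energyMeas s (U k)) μ) {c : X n → ℝ} (hc : Continuous c)
    (hcs : HasCompactSupport c) :
    ∃ D, D ≤ eLpNorm c 2 μ ∧ Tendsto (fun k =>
      eLpNorm (fun P => c P • (grad (U k) P - grad V P)) 2 (halfMeas n s)) atTop (𝓝 D) := by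
  have h := tendsto_lintegral_defect hs1 hU hV hbdd hweak hμ hc hcs
  have h1 := (ENNReal.continuous_rpow_const (y := (1 / 2 : ℝ))).tendsto _ |>.comp
    (ENNReal.tendsto_ofReal h)
  refine ⟨_, ?_, h1.congr fun k => ?_⟩
  · rw [← rpow_half_sq (eLpNorm c 2 μ), eLpNorm_two_sq, lintegral_sq_eq_ofReal hc hcs]
    gcongr
    exact sub_le_self _ (integral_nonneg fun P => by positivity)
  · have hd := ((hU k).memLp hs1).sub (hV.memLp hs1)
    simp only [Function.comp_apply]
    rw [← rpow_half_sq (eLpNorm _ 2 _), eLpNorm_two_sq, ofReal_integral_eq_lintegral_ofReal]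
    · congr 1
      refine lintegral_congr fun P => ?_
      rw [← ofReal_norm, ← ENNReal.ofReal_pow (norm_nonneg _), norm_smul, mul_pow,
        Real.norm_eq_abs, sq_abs]
    · refine (integrable_sq_inner hc hcs hd hd).congr (ae_of_all _ fun P => ?_)
      simp only [Pi.sub_apply, real_inner_self_eq_norm_sq]
    · exact ae_of_all _ fun P => by positivity

/-- Weak lower semicontinuity of the energy, localized. -/
lemma lintegral_sq_energyMeas_le (hs1 : s < 1) {U : ℕ → X n → ℝ} {V : X n → ℝ}
    (hU : ∀ k, MemHalf s (U k)) (hV : MemHalf s V) (hbdd : IsBoundedSeq s U)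
    (hweak : WeaklyTendsto s U V) {μ : Measure (X n)} [IsFiniteMeasureOnCompacts μ]
    (hμ : MeasTendsto (fun k => energyMeas s (U k)) μ) {c : X n → ℝ} (hc : Continuous c)
    (hcs : HasCompactSupport c) :
    ∫⁻ P, ‖c P‖ₑ ^ 2 ∂energyMeas s V ≤ ∫⁻ P, ‖c P‖ₑ ^ 2 ∂μ := by
  have h := tendsto_lintegral_defect hs1 hU hV hbdd hweak hμ hc hcs
  have h0 := ge_of_tendsto' h fun k => integral_nonneg fun P => by positivity
  have h1 : ∫⁻ P, ‖c P‖ₑ ^ 2 ∂energyMeas s V =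
      ENNReal.ofReal (∫ P, c P ^ 2 * ‖grad V P‖ ^ 2 ∂halfMeas n s) := by
    rw [lintegral_energyMeas hs1 hV, ofReal_integral_eq_lintegral_ofReal]
    · refine lintegral_congr fun P => ?_
      rw [ENNReal.ofReal_mul (by positivity), ENNReal.ofReal_pow (norm_nonneg _), ofReal_norm,
        mul_comm, ← sq_abs, ENNReal.ofReal_pow (abs_nonneg _), ← Real.norm_eq_abs, ofReal_norm]
    · refine (integrable_sq_inner hc hcs (hV.memLp hs1) (hV.memLp hs1)).congr
        (ae_of_all _ fun P => ?_)
      simp only [real_inner_self_eq_norm_sq]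
    · exact ae_of_all _ fun P => by positivity
  rw [h1, lintegral_sq_eq_ofReal hc hcs]
  exact ENNReal.ofReal_le_ofReal (by linarith)

/-! ### Inequalities for cutoffs. -/

/-- The energy of the localized defect, up to a vanishing error. -/
lemma exists_error_grad_mul (hs0 : 0 < s) (hs1 : s < 1) (hns : 2 * s < n) {U : ℕ → X n → ℝ}
    {V : X n → ℝ} (hU : ∀ k, MemHalf s (U k)) (hV : MemHalf s V) (hbdd : IsBoundedSeq s U)
    (hweak : WeaklyTendsto s U V) {η : X n → ℝ} (hη : IsTest η)
    (heven : ∀ P, η (reflect n P) = η P) :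
    ∃ e : ℕ → ℝ≥0∞, Tendsto e atTop (𝓝 0) ∧ ∀ k,
      eLpNorm (grad fun P => η P * (U k P - V P)) 2 (halfMeas n s) ≤
        e k + eLpNorm (fun P => η P • (grad (U k) P - grad V P)) 2 (halfMeas n s) := by
  obtain ⟨R, hR, hsub⟩ := exists_tsupport_subset_box hη
  obtain ⟨A, hA, hA1, hA2⟩ := hη.exists_enorm_le
  obtain ⟨φV, hφV⟩ := hV.exists_approxHalf
  choose φ hφ using fun k => (hU k).exists_approxHalf
  have hχ := fun k => (hφ k).sub hφV
  have hηχ := fun k => (hχ k).mul hs0 hs1 hns hη heven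
  set δ : ℕ → ℝ≥0∞ := fun k => ((k + 1 : ℕ) : ℝ≥0∞)⁻¹ with hδ
  have hδ0 : ∀ k, 0 < δ k := fun k => ENNReal.inv_pos.2 (ENNReal.natCast_ne_top _)
  have hδ1 : ∀ k, δ k ≤ 1 := fun k => by
    rw [hδ, ENNReal.inv_le_one]
    exact_mod_cast Nat.le_add_left 1 k
  have hδt : Tendsto δ atTop (𝓝 0) :=
    ENNReal.tendsto_inv_nat_nhds_zero.comp (tendsto_add_atTop_nat 1)
  -- A diagonal choice: one test function within δ_k of U_k - V in energy whose product with η is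
  -- within δ_k of η(U_k - V). The compactness theorem, stated for test functions, then applies to
  -- the resulting sequence.
  have hex : ∀ k, ∃ j, eLpNorm (gradient (fun P => φ k j P - φV j P) -
        grad (fun P => U k P - V P)) 2 (halfMeas n s) ≤ δ k ∧
      eLpNorm (gradient (fun P => η P * (φ k j P - φV j P)) -
        grad (fun P => η P * (U k P - V P))) 2 (halfMeas n s) ≤ δ k := fun k =>
    ((ENNReal.tendsto_nhds_zero.1 ((hχ k).grad hs1).2 _ (hδ0 k)).and
      (ENNReal.tendsto_nhds_zero.1 ((hηχ k).grad hs1).2 _ (hδ0 k))).exists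
  choose j hj1 hj2 using hex
  set ψ : ℕ → X n → ℝ := fun k P => φ k (j k) P - φV (j k) P with hψdef
  have hψ : ∀ k, IsTest (ψ k) := fun k => (hχ k).test (j k)
  have hψg := fun k => memLp_gradient hs1 (hψ k)
  have hUg := fun k => (hU k).memLp hs1
  have hVg := hV.memLp hs1
  have hj1' : ∀ k, eLpNorm (gradient (ψ k) - (grad (U k) - grad V)) 2 (halfMeas n s) ≤ δ k :=
    fun k => (eLpNorm_congr_ae ((EventuallyEq.refl _ _).sub
      (grad_sub_ae hs1 (hU k) hV))).symm.trans_le (hj1 k)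
  obtain ⟨C, hC⟩ := hbdd
  have hbound : ∀ k, halfEnergy s (ψ k) ≤
      (1 + (ENNReal.ofReal C + eLpNorm (grad V) 2 (halfMeas n s))) ^ 2 := by
    intro k
    rw [halfEnergy_eq_eLpNorm]
    refine pow_le_pow_left₀ zero_le ?_ 2
    have h1 : gradient (ψ k) =
        (gradient (ψ k) - (grad (U k) - grad V)) + (grad (U k) - grad V) := by abel
    rw [h1]
    refine (eLpNorm_add_le ((hψg k).1.sub ((hUg k).1.sub hVg.1)) ((hUg k).1.sub hVg.1)
      one_le_two).trans (add_le_add ((hj1' k).trans (hδ1 k)) ?_)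
    refine (eLpNorm_sub_le (hUg k).1 hVg.1 one_le_two).trans (add_le_add_left ?_ _)
    have h2 := hC k
    rw [normHalf_eq (hUg k).1] at h2
    exact (ENNReal.le_ofReal_iff_toReal_le (hUg k).2.ne
      (ENNReal.toReal_nonneg.trans h2)).2 h2
  have hw : ∀ K : Lp (X n) 2 (halfMeas n s), Tendsto
      (fun k => inner ℝ K ((hψg k).toLp _)) atTop (𝓝 0) := by
    intro K
    have h1 := tendsto_inner_grad hs1 hU hV ⟨C, hC⟩ hweak K
    have h2 : Tendsto (fun k => inner ℝ ((hψg k).toLp _ -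
        ((hUg k).toLp _ - hVg.toLp _)) K) atTop (𝓝 0) := by
      have h3 : Tendsto (fun k => (δ k).toReal * ‖K‖) atTop (𝓝 0) := by
        have := ((ENNReal.tendsto_toReal ENNReal.zero_ne_top).comp hδt).mul_const ‖K‖
        simpa using this
      refine squeeze_zero_norm (fun k => ?_) h3
      refine (norm_inner_le_norm _ _).trans ?_
      gcongr
      rw [← MemLp.toLp_sub, ← MemLp.toLp_sub, Lp.norm_toLp]
      exact ENNReal.toReal_mono ((hδ1 k).trans_lt ENNReal.one_lt_top).ne (hj1' k)
    have h4 := h2.add h1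
    simp_rw [← inner_add_left, sub_add_cancel, add_zero] at h4
    simp_rw [real_inner_comm K] at h4 ⊢
    exact h4
  have hbox := tendsto_lintegral_box hs0 hs1 hns hψ
    (by have := hVg.2.ne; finiteness) hbound hw hR
  have hbox' := ((ENNReal.continuous_rpow_const (y := (1 / 2 : ℝ))).tendsto 0).comp hbox
  rw [ENNReal.zero_rpow_of_pos (by norm_num)] at hbox'
  refine ⟨fun k => δ k + A * δ k +
    A * (∫⁻ P in box n R, ‖ψ k P‖ₑ ^ 2 ∂halfMeas n s) ^ (1 / 2 : ℝ), ?_, fun k => ?_⟩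
  · have h1 := (hδt.add (ENNReal.Tendsto.const_mul hδt (Or.inr hA))).add
      (ENNReal.Tendsto.const_mul (a := A) hbox' (Or.inr hA))
    simpa using h1
  · have hηψ := memLp_gradient hs1 (hη.mul (hψ k))
    have hgm := ((hηχ k).grad hs1).1
    have hcη : AEStronglyMeasurable η (halfMeas n s) := hη.continuous.aestronglyMeasurable
    have m1 : AEStronglyMeasurable (fun P => η P • (gradient (ψ k) - (grad (U k) - grad V)) P)
        (halfMeas n s) := hcη.smul ((hψg k).1.sub ((hUg k).1.sub hVg.1))
    have m2 : AEStronglyMeasurable (fun P => ψ k P • gradient η P) (halfMeas n s) :=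
      ((hψ k).continuous.smul (continuous_gradient hη)).aestronglyMeasurable
    have m3 : AEStronglyMeasurable (fun P => η P • (grad (U k) P - grad V P)) (halfMeas n s) :=
      hcη.smul ((hUg k).1.sub hVg.1)
    -- Apart from the main term, two pieces are approximation errors, at most δ_k and A δ_k. The
    -- third is ψ_k ∇η, the only one that needs compactness.
    have hdecomp : grad (fun P => η P * (U k P - V P)) =
        (grad (fun P => η P * (U k P - V P)) - gradient (fun P => η P * ψ k P)) +
        ((fun P => η P • (gradient (ψ k) - (grad (U k) - grad V)) P) +
          (fun P => ψ k P • gradient η P) + fun P => η P • (grad (U k) P - grad V P)) := by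
      ext1 P
      simp only [Pi.add_apply, Pi.sub_apply, gradient_mul hη (hψ k), smul_sub]
      abel
    have hlast : eLpNorm (fun P => ψ k P • gradient η P) 2 (halfMeas n s) ≤
        A * (∫⁻ P in box n R, ‖ψ k P‖ₑ ^ 2 ∂halfMeas n s) ^ (1 / 2 : ℝ) := by
      rw [← rpow_half_sq (eLpNorm _ 2 _), eLpNorm_two_sq]
      conv_rhs => rw [← rpow_half_sq A, ← ENNReal.mul_rpow_of_nonneg _ _ (by norm_num)]
      gcongr
      rw [← lintegral_const_mul' _ _ (by finiteness), ← lintegral_indicator (measurableSet_box R)]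
      refine lintegral_mono fun P => ?_
      by_cases hP : P ∈ tsupport η
      · rw [Set.indicator_of_mem (hsub hP), enorm_smul, mul_pow, mul_comm]
        gcongr
        exact hA2 P
      · rw [gradient_eq_zero_of_notMem hP]; simp
    rw [hdecomp]
    refine (eLpNorm_add_le (hgm.1.sub hηψ.1) ((m1.add m2).add m3) one_le_two).trans ?_
    refine (add_le_add_right (eLpNorm_add_le (m1.add m2) m3 one_le_two) _).trans ?_
    refine (add_le_add_right (add_le_add_left (eLpNorm_add_le m1 m2 one_le_two) _) _).trans ?_
    rw [← add_assoc, ← add_assoc]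
    refine add_le_add (add_le_add (add_le_add ?_ ?_) ?_) le_rfl
    · rw [eLpNorm_sub_comm]; exact hj2 k
    · exact (eLpNorm_mul_le hA hA1 _).trans (mul_le_mul_right (hj1' k) _)
    · exact hlast

/-- The reverse Hölder inequality for cutoffs. -/
theorem eLpNorm_cutoff_le (hs0 : 0 < s) (hs1 : s < 1) (hns : 2 * s < n) {U : ℕ → X n → ℝ}
    {V : X n → ℝ} (hU : ∀ k, MemHalf s (U k)) (hV : MemHalf s V) (hbdd : IsBoundedSeq s U)
    (hweak : WeaklyTendsto s U V) {μ : Measure (X n)} {ν : Measure (E n)}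
    [IsFiniteMeasureOnCompacts μ] [IsFiniteMeasureOnCompacts ν]
    (hμ : MeasTendsto (fun k => energyMeas s (U k)) μ)
    (hν : MeasTendsto (fun k => traceMeas s (U k)) ν) {σ : ℝ≥0∞} (hσt : σ ≠ ⊤)
    (hσ : ∀ Z : X n → ℝ, MemHalf s Z →
      σ * eLpNorm (trace s Z) (ENNReal.ofReal (critExp n s)) volume ≤
        eLpNorm (grad Z) 2 (halfMeas n s))
    {η : X n → ℝ} (hη : IsTest η) (heven : ∀ P, η (reflect n P) = η P) :
    σ * eLpNorm (fun x => η (pt x 0)) (ENNReal.ofReal (critExp n s)) ν ≤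
        σ * eLpNorm (fun x => η (pt x 0)) (ENNReal.ofReal (critExp n s)) (traceMeas s V) +
          eLpNorm η 2 μ ∧
      σ * eLpNorm (fun x => η (pt x 0)) (ENNReal.ofReal (critExp n s)) (traceMeas s V) ≤
        σ * eLpNorm (fun x => η (pt x 0)) (ENNReal.ofReal (critExp n s)) ν + eLpNorm η 2 μ := by
  set q := ENNReal.ofReal (critExp n s) with hq
  have hp : 0 < critExp n s := by linarith [two_lt_critExp hs0 hns]
  have hq1 : 1 ≤ q := one_le_critExp hs0 hns
  obtain ⟨e, he, hle⟩ := exists_error_grad_mul hs0 hs1 hns hU hV hbdd hweak hη heven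
  obtain ⟨D, hD, hDt⟩ := tendsto_eLpNorm_defect hs1 hU hV hbdd hweak hμ hη.continuous hη.2
  have htU := fun k => (hU k).memLp_trace hs0 hs1 hns
  have htV := hV.memLp_trace hs0 hs1 hns
  have hcη : AEStronglyMeasurable (fun x : E n => η (pt x 0)) volume :=
    hη.continuous_trace.aestronglyMeasurable
  have hdiff : ∀ k, σ * eLpNorm (fun x => η (pt x 0) * (trace s (U k) x - trace s V x)) q volume ≤
      e k + eLpNorm (fun P => η P • (grad (U k) P - grad V P)) 2 (halfMeas n s) := by
    intro k
    have hsub : MemHalf s fun P => U k P - V P :=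
      ((hU k).exists_approxHalf.choose_spec.sub hV.exists_approxHalf.choose_spec).memHalf
    have hmul : MemHalf s fun P => η P * (U k P - V P) :=
      (hsub.exists_approxHalf.choose_spec.mul hs0 hs1 hns hη heven).memHalf
    refine le_trans (le_of_eq ?_) ((hσ _ hmul).trans (hle k))
    congr 1
    refine eLpNorm_congr_ae ?_
    filter_upwards [trace_mul_ae hs0 hs1 hns hη heven hsub,
      trace_sub_ae hs0 hs1 hns (hU k) hV] with x h1 h2
    rw [h1, h2, Pi.sub_apply]
  have hνt : Tendsto (fun k => eLpNorm (fun x => η (pt x 0)) q (traceMeas s (U k))) atTop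
      (𝓝 (eLpNorm (fun x => η (pt x 0)) q ν)) := by
    have hfin := fun k => isFiniteMeasure_traceMeas hs0 hs1 hns (hU k)
    simp_rw [hq, eLpNorm_critExp hs0 hns]
    exact ((ENNReal.continuous_rpow_const (y := 1 / critExp n s)).tendsto _).comp
      (hν.lintegral_rpow hη.continuous_trace hη.hasCompactSupport_trace hp)
  have hνt' := ENNReal.Tendsto.const_mul (a := σ) hνt (Or.inr hσt)
  have hlim := he.add hDt
  rw [zero_add] at hlim
  simp_rw [hq, eLpNorm_traceMeas hs0 hs1 hns hV, ← hq]
  simp_rw [hq, eLpNorm_traceMeas hs0 hs1 hns (hU _), ← hq] at hνt'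
  have mU := fun k => hcη.mul (htU k).1
  have mV := hcη.mul htV.1
  have md := fun k => hcη.mul ((htU k).1.sub htV.1)
  -- Both parts are the triangle inequality, for ηu_k = ηv + η(u_k - v) and for ηv = ηu_k - η(u_k -
  -- v), where u_k and v are the traces of U_k and V.
  constructor
  · refine (le_of_tendsto_of_tendsto' hνt' (hlim.const_add _) fun k => ?_).trans
      (add_le_add_right hD _)
    refine le_trans ?_ (add_le_add_right (hdiff k) _)
    rw [← mul_add]
    refine mul_le_mul_right ?_ _
    refine le_trans (le_of_eq ?_) (eLpNorm_add_le mV (md k) hq1)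
    congr 1; ext x; simp only [Pi.add_apply]; ring
  · refine (ge_of_tendsto' (hνt'.add hlim) fun k => ?_).trans (add_le_add_right hD _)
    refine le_trans ?_ (add_le_add_right (hdiff k) _)
    rw [← mul_add]
    refine mul_le_mul_right ?_ _
    refine le_trans (le_of_eq ?_) (eLpNorm_sub_le (mU k) (md k) hq1)
    congr 1; ext x; simp only [Pi.sub_apply]; ring

/-- The trace inequality on the whole space, written with a positive constant on the left. -/
lemma exists_mul_eLpNorm_trace_le (hs0 : 0 < s) (hs1 : s < 1) (hns : 2 * s < n) :
    ∃ c : ℝ≥0∞, c ≠ 0 ∧ c ≠ ⊤ ∧ ∀ Z : X n → ℝ, MemHalf s Z →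
      c * eLpNorm (trace s Z) (ENNReal.ofReal (critExp n s)) volume ≤
        eLpNorm (grad Z) 2 (halfMeas n s) := by
  obtain ⟨C, hC, h⟩ := exists_eLpNorm_trace_le (n := n) hs0 hs1.le hns
  have hC1 : C + 1 ≠ ⊤ := by finiteness
  -- The 1 is added because `C` might be 0 and its inverse must be finite.
  refine ⟨(C + 1)⁻¹, ENNReal.inv_ne_zero.2 hC1, ENNReal.inv_ne_top.2 (by simp), fun Z hZ => ?_⟩
  obtain ⟨φ, hφ⟩ := hZ.exists_approxHalf
  obtain ⟨hg, hgt⟩ := hφ.grad hs1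
  obtain ⟨ht, htt⟩ := hφ.trace hs0 hs1 hns
  have key : eLpNorm (trace s Z) (ENNReal.ofReal (critExp n s)) volume ≤
      C * eLpNorm (grad Z) 2 (halfMeas n s) := by
    have hlim := htt.add ((ENNReal.Tendsto.const_mul (a := C) hgt (Or.inr hC)).add_const
      (C * eLpNorm (grad Z) 2 (halfMeas n s)))
    rw [mul_zero, zero_add, zero_add] at hlim
    refine ge_of_tendsto' hlim fun j => ?_
    have m0 : AEStronglyMeasurable (fun x : E n => φ j (pt x 0)) volume :=
      (hφ.test j).continuous_trace.aestronglyMeasurable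
    have hgj := memLp_gradient hs1 (hφ.test j)
    have h1 : trace s Z = (fun x => φ j (pt x 0)) - ((fun x => φ j (pt x 0)) - trace s Z) := by
      abel
    have h2 : gradient (φ j) = (gradient (φ j) - grad Z) + grad Z := by abel
    calc eLpNorm (trace s Z) (ENNReal.ofReal (critExp n s)) volume
        ≤ eLpNorm (fun x => φ j (pt x 0)) (ENNReal.ofReal (critExp n s)) volume +
          eLpNorm ((fun x => φ j (pt x 0)) - trace s Z) (ENNReal.ofReal (critExp n s)) volume := by
          conv_lhs => rw [h1]
          exact eLpNorm_sub_le m0 (m0.sub ht.1) (one_le_critExp hs0 hns)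
      _ ≤ C * eLpNorm (gradient (φ j)) 2 (halfMeas n s) +
          eLpNorm ((fun x => φ j (pt x 0)) - trace s Z) (ENNReal.ofReal (critExp n s)) volume :=
          add_le_add_left (h _ (hφ.test j)) _
      _ ≤ C * (eLpNorm (gradient (φ j) - grad Z) 2 (halfMeas n s) +
            eLpNorm (grad Z) 2 (halfMeas n s)) +
          eLpNorm ((fun x => φ j (pt x 0)) - trace s Z) (ENNReal.ofReal (critExp n s)) volume := by
          refine add_le_add_left (mul_le_mul_right ?_ _) _
          conv_lhs => rw [h2]
          exact eLpNorm_add_le (hgj.1.sub hg.1) hg.1 one_le_two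
      _ = _ := by rw [mul_add, add_comm]
  rw [ENNReal.inv_mul_le_iff (by simp) hC1]
  exact key.trans (mul_le_mul_left le_self_add _)

/-! ### The best constant, and smooth cutoffs. -/

lemma sobolevConst_nonneg : 0 ≤ sobolevConst n s := by
  refine Real.sInf_nonneg ?_
  rintro _ ⟨U, -, -, rfl⟩
  positivity

lemma sobolevConst_mul_le {Z : X n → ℝ} (hZ : MemHalf s Z) :
    sobolevConst n s * normTrace s Z ^ 2 ≤ normHalf s Z ^ 2 := by
  by_cases h : normTrace s Z = 0
  · rw [h]; simp; positivity
  · rw [← le_div_iff₀ (by positivity)]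
    refine csInf_le ⟨0, ?_⟩ ⟨Z, hZ, h, rfl⟩
    rintro _ ⟨U, -, -, rfl⟩
    positivity

/-- Used only for the inequality between atoms, where the constant may be 0. The comparison of
measures divides by its constant and therefore uses the one from `exists_mul_eLpNorm_trace_le`. -/
lemma sqrt_sobolevConst_mul_le (hs0 : 0 < s) (hs1 : s < 1) (hns : 2 * s < n) {Z : X n → ℝ}
    (hZ : MemHalf s Z) :
    ENNReal.ofReal (√(sobolevConst n s)) *
        eLpNorm (trace s Z) (ENNReal.ofReal (critExp n s)) volume ≤
      eLpNorm (grad Z) 2 (halfMeas n s) := by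
  have ht := (hZ.memLp_trace hs0 hs1 hns).2.ne
  have hg := hZ.memLp hs1
  have h := sobolevConst_mul_le hZ
  have h1 : √(sobolevConst n s) * normTrace s Z ≤ normHalf s Z := by
    refine le_of_sq_le_sq ?_ (Real.sqrt_nonneg _)
    rwa [mul_pow, Real.sq_sqrt sobolevConst_nonneg]
  rw [normHalf_eq hg.1, normTrace] at h1
  rw [← ENNReal.toReal_le_toReal (by finiteness) hg.2.ne, ENNReal.toReal_mul,
    ENNReal.toReal_ofReal (Real.sqrt_nonneg _)]
  exact h1

lemma exists_contDiff_cutoff {F : Type*} [NormedAddCommGroup F] [NormedSpace ℝ F]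
    [FiniteDimensional ℝ F] {K O : Set F} (hK : IsCompact K) (hO : IsOpen O) (hKO : K ⊆ O) :
    ∃ f : F → ℝ, ContDiff ℝ ∞ f ∧ HasCompactSupport f ∧ (∀ x ∈ K, f x = 1) ∧ (∀ x ∉ O, f x = 0) ∧
      ∀ x, f x ∈ Set.Icc (0 : ℝ) 1 := by
  have : ProperSpace F := FiniteDimensional.proper ℝ F
  obtain ⟨L, hL, hKL, hLO⟩ := exists_compact_between hK hO hKO
  obtain ⟨f, hf1, hf0, hf⟩ := exists_contMDiffMap_one_nhds_of_subset_interior (n := (⊤ : ℕ∞))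
    (modelWithCornersSelf ℝ F) hK.isClosed hKL
  exact ⟨f, f.contMDiff.contDiff, HasCompactSupport.intro hL hf0, fun x hx =>
    hf1.self_of_nhdsSet _ hx, fun x hx => hf0 x fun h => hx (hLO h), hf⟩

lemma reflect_pt_zero (x : E n) : reflect n (pt x 0) = pt x 0 := by
  rw [reflect_apply]; simp [pt]

/-- Even cutoffs that are `1` on a compact subset of the boundary. -/
lemma exists_even_cutoff {K : Set (E n)} (hK : IsCompact K) {O : Set (E n)} (hO : IsOpen O)
    (hKO : K ⊆ O) {O' : Set (X n)} (hO' : IsOpen O') (hKO' : (fun x => pt x 0) '' K ⊆ O') :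
    ∃ η : X n → ℝ, IsTest η ∧ (∀ P, η (reflect n P) = η P) ∧ (∀ P, η P ∈ Set.Icc (0 : ℝ) 1) ∧
      (∀ x ∈ K, η (pt x 0) = 1) ∧ (∀ x ∉ O, η (pt x 0) = 0) ∧ ∀ P ∉ O', η P = 0 := by
  obtain ⟨f, hf, hfc, hf1, hf0, hf01⟩ := exists_contDiff_cutoff
    (hK.image (continuous_pt_left 0)) (hO'.inter (hO.preimage continuous_fst))
    (Set.subset_inter hKO' (by rintro _ ⟨x, hx, rfl⟩; exact hKO hx))
  have hft : IsTest f := ⟨hf, hfc⟩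
  -- The product with the reflected cutoff is even; boundary points are fixed by the reflection, so
  -- the value 1 on K is kept.
  refine ⟨fun P => f P * f (reflect n P), hft.mul (isTest_reflect hft), fun P => ?_, fun P => ?_,
    fun x hx => ?_, fun x hx => ?_, fun P hP => ?_⟩
  · have : reflect n (reflect n P) = P := by
      simp only [reflect_apply, pt, WithLp.toLp_fst, WithLp.toLp_snd, neg_neg]; rfl
    simp only [this, mul_comm]
  · exact ⟨mul_nonneg (hf01 _).1 (hf01 _).1, mul_le_one₀ (hf01 _).2 (hf01 _).1 (hf01 _).2⟩
  · simp only [reflect_pt_zero, hf1 _ (Set.mem_image_of_mem _ hx), mul_one]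
  · simp only [hf0 (pt x 0) fun h => hx h.2, zero_mul]
  · simp only [hf0 P fun h => hP h.1, zero_mul]

/-! ### From cutoffs to sets. -/

lemma rpow_measure_le_eLpNorm {Y : Type*} [MeasurableSpace Y] {m : Measure Y} {p : ℝ} (hp : 0 < p)
    {A : Set Y} (hA : MeasurableSet A) {f : Y → ℝ} (hf : ∀ x ∈ A, f x = 1) :
    m A ^ (1 / p) ≤ eLpNorm f (ENNReal.ofReal p) m := by
  rw [eLpNorm_eq_lintegral_rpow_enorm_toReal (by simpa using hp) (by simp),
    ENNReal.toReal_ofReal hp.le]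
  gcongr
  rw [← lintegral_indicator_one hA]
  refine lintegral_mono fun x => ?_
  by_cases hx : x ∈ A
  · simp [hx, hf x hx]
  · simp [hx]

lemma eLpNorm_le_rpow_measure {Y : Type*} [MeasurableSpace Y] {m : Measure Y} {p : ℝ} (hp : 0 < p)
    {A : Set Y} (hA : MeasurableSet A) {f : Y → ℝ} (hf : ∀ x ∉ A, f x = 0)
    (hf1 : ∀ x, f x ∈ Set.Icc (0 : ℝ) 1) :
    eLpNorm f (ENNReal.ofReal p) m ≤ m A ^ (1 / p) := by
  rw [eLpNorm_eq_lintegral_rpow_enorm_toReal (by simpa using hp) (by simp),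
    ENNReal.toReal_ofReal hp.le]
  gcongr
  rw [← lintegral_indicator_one hA]
  refine lintegral_mono fun x => ?_
  by_cases hx : x ∈ A
  · simp only [hx, Set.indicator_of_mem, Pi.one_apply]
    refine ENNReal.rpow_le_one ?_ hp.le
    rw [Real.enorm_eq_ofReal (hf1 x).1]
    exact ENNReal.ofReal_le_one.2 (hf1 x).2
  · simp [hx, hf x hx, hp]

/-- From even cutoffs to compact sets. -/
lemma rpow_measure_compact_le {p : ℝ} (hp : 0 < p) {a : ℝ≥0∞} (ha : a ≠ ⊤)
    {μ : Measure (X n)} {ν τ : Measure (E n)} [IsFiniteMeasureOnCompacts μ]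
    [IsFiniteMeasureOnCompacts τ]
    (h : ∀ η : X n → ℝ, IsTest η → (∀ P, η (reflect n P) = η P) →
      a * eLpNorm (fun x => η (pt x 0)) (ENNReal.ofReal p) ν ≤
        a * eLpNorm (fun x => η (pt x 0)) (ENNReal.ofReal p) τ + eLpNorm η 2 μ)
    {K : Set (E n)} (hK : IsCompact K) :
    a * ν K ^ (1 / p) ≤ a * τ K ^ (1 / p) + μ ((fun x => pt x 0) '' K) ^ (1 / 2 : ℝ) := by
  have hK' := hK.image (continuous_pt_left (n := n) 0)
  have key : ∀ ε : ℝ≥0∞, 0 < ε → a * ν K ^ (1 / p) ≤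
      a * (τ K + ε) ^ (1 / p) + (μ ((fun x => pt x 0) '' K) + ε) ^ (1 / 2 : ℝ) := by
    intro ε hε
    -- Two independent neighbourhoods are taken: one of K in ℝⁿ, almost optimal for τ, and one of
    -- its copy in the boundary, almost optimal for μ.
    obtain ⟨O, hKO, hO, hτ⟩ := K.exists_isOpen_le_add τ hε.ne'
    obtain ⟨O', hKO', hO', hμ⟩ := ((fun x : E n => pt x 0) '' K).exists_isOpen_le_add μ hε.ne'
    obtain ⟨η, hη, heven, h01, h1, h0, h0'⟩ := exists_even_cutoff hK hO hKO hO' hKO'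
    have h2 := eLpNorm_le_rpow_measure (m := μ) two_pos hO'.measurableSet h0' h01
    rw [ENNReal.ofReal_ofNat] at h2
    calc a * ν K ^ (1 / p) ≤ a * eLpNorm (fun x => η (pt x 0)) (ENNReal.ofReal p) ν := by
          gcongr
          exact rpow_measure_le_eLpNorm hp hK.measurableSet h1
      _ ≤ _ := h η hη heven
      _ ≤ a * τ O ^ (1 / p) + μ O' ^ (1 / 2 : ℝ) := by
          gcongr
          exact eLpNorm_le_rpow_measure hp hO.measurableSet h0 fun x => h01 _
      _ ≤ _ := by gcongr
  have hlim : Tendsto (fun ε : ℝ≥0∞ => a * (τ K + ε) ^ (1 / p) +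
      (μ ((fun x => pt x 0) '' K) + ε) ^ (1 / 2 : ℝ)) (𝓝[>] 0)
      (𝓝 (a * (τ K + 0) ^ (1 / p) + (μ ((fun x => pt x 0) '' K) + 0) ^ (1 / 2 : ℝ))) := by
    refine tendsto_nhdsWithin_of_tendsto_nhds (Continuous.tendsto ?_ 0)
    refine ((ENNReal.continuous_const_mul ha).comp
      (ENNReal.continuous_rpow_const.comp ?_)).add (ENNReal.continuous_rpow_const.comp ?_)
    · fun_prop
    · fun_prop
  rw [add_zero, add_zero] at hlim
  have : (𝓝[>] (0 : ℝ≥0∞)).NeBot := inferInstance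
  exact ge_of_tendsto hlim (eventually_nhdsWithin_of_forall key)

/-- From compact sets to Borel sets. -/
lemma rpow_measure_le {p : ℝ} (hp : 0 < p) {a : ℝ≥0∞} (ha0 : a ≠ 0) (ha : a ≠ ⊤)
    {μ : Measure (X n)} {ν τ : Measure (E n)} [IsFiniteMeasureOnCompacts ν]
    (h : ∀ K : Set (E n), IsCompact K →
      a * ν K ^ (1 / p) ≤ a * τ K ^ (1 / p) + μ ((fun x => pt x 0) '' K) ^ (1 / 2 : ℝ))
    {B : Set (E n)} (hB : MeasurableSet B) :
    a * ν B ^ (1 / p) ≤ a * τ B ^ (1 / p) + μ ((fun x => pt x 0) '' B) ^ (1 / 2 : ℝ) := by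
  rw [one_div] at h ⊢
  -- Solving for ν B makes it a supremum over compact subsets by inner regularity; the right side
  -- only grows from K to B.
  rw [mul_comm a, ← ENNReal.le_div_iff_mul_le (Or.inl ha0) (Or.inl ha),
    ENNReal.rpow_inv_le_iff hp, hB.measure_eq_iSup_isCompact]
  refine iSup₂_le fun K hKB => iSup_le fun hK => ?_
  rw [← ENNReal.rpow_inv_le_iff hp, ENNReal.le_div_iff_mul_le (Or.inl ha0) (Or.inl ha),
    mul_comm _ a]
  exact (h K hK).trans (by gcongr)

/-- Inner regularity of the finite measure on the left and outer regularity of μ reduce the claim to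
K ⊆ O, where a cutoff between them and lower semicontinuity apply. -/
lemma energyMeas_le (hs1 : s < 1) {U : ℕ → X n → ℝ} {V : X n → ℝ}
    (hU : ∀ k, MemHalf s (U k)) (hV : MemHalf s V) (hbdd : IsBoundedSeq s U)
    (hweak : WeaklyTendsto s U V) {μ : Measure (X n)} [IsFiniteMeasureOnCompacts μ]
    (hμ : MeasTendsto (fun k => energyMeas s (U k)) μ) : energyMeas s V ≤ μ := by
  have hfin := isFiniteMeasure_energyMeas hs1 hV
  refine Measure.le_iff.2 fun A hA => ?_
  rw [hA.measure_eq_iSup_isCompact]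
  refine iSup₂_le fun K hKA => iSup_le fun hK => le_trans ?_ (measure_mono hKA)
  rw [K.measure_eq_iInf_isOpen μ]
  refine le_iInf₂ fun O hKO => le_iInf fun hO => ?_
  obtain ⟨f, hf, hfc, hf1, hf0, hf01⟩ := exists_contDiff_cutoff hK hO hKO
  calc energyMeas s V K ≤ ∫⁻ P, ‖f P‖ₑ ^ 2 ∂energyMeas s V := by
        rw [← lintegral_indicator_one hK.measurableSet]
        refine lintegral_mono fun P => ?_
        by_cases hP : P ∈ K
        · simp [hP, hf1 P hP]
        · simp [hP]
    _ ≤ ∫⁻ P, ‖f P‖ₑ ^ 2 ∂μ :=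
        lintegral_sq_energyMeas_le hs1 hU hV hbdd hweak hμ hf.continuous hfc
    _ ≤ μ O := by
        rw [← lintegral_indicator_one hO.measurableSet]
        refine lintegral_mono fun P => ?_
        by_cases hP : P ∈ O
        · simp only [hP, Set.indicator_of_mem, Pi.one_apply]
          refine pow_le_one₀ zero_le ?_
          rw [Real.enorm_eq_ofReal (hf01 P).1]
          exact ENNReal.ofReal_le_one.2 (hf01 P).2
        · simp [hP, hf0 P hP]

/-! ### Comparison of measures away from atoms. -/

/-- Without atoms, outer regularity gives every point an open neighbourhood of mass at most ε;
countably many cover the space by second countability, and they are then made disjoint. -/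
lemma exists_partition_measure_le {α : Type*} [TopologicalSpace α] [SecondCountableTopology α]
    [MeasurableSpace α] [OpensMeasurableSpace α] [Nonempty α] {κ : Measure α} [κ.OuterRegular]
    (h0 : ∀ x, κ {x} = 0) {ε : ℝ≥0∞} (hε : ε ≠ 0) :
    ∃ t : ℕ → Set α, (∀ i, MeasurableSet (t i)) ∧ Pairwise (Function.onFun Disjoint t) ∧
      ⋃ i, t i = Set.univ ∧ ∀ i, κ (t i) ≤ ε := by
  choose O hxO hO hκ using fun x : α => Set.exists_isOpen_le_add {x} κ hε
  simp_rw [h0, zero_add] at hκ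
  obtain ⟨S, hS, hcov⟩ := TopologicalSpace.countable_cover_nhds
    fun x => (hO x).mem_nhds (hxO x rfl)
  have hne : S.Nonempty := by
    by_contra h
    rw [Set.not_nonempty_iff_eq_empty] at h
    simp [h] at hcov
    exact Set.empty_ne_univ hcov
  obtain ⟨g, rfl⟩ := hS.exists_eq_range hne
  refine ⟨disjointed fun i => O (g i), MeasurableSet.disjointed fun i => (hO _).measurableSet,
    disjoint_disjointed _, ?_, fun i => (measure_mono (disjointed_subset _ _)).trans (hκ _)⟩
  rw [iUnion_disjointed, ← hcov, Set.biUnion_range]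

/-- A reverse Hölder inequality between measures, with an error that has no atoms, is an
inequality between the measures. -/
lemma measure_univ_le_of_rpow_le {α : Type*} [TopologicalSpace α] [SecondCountableTopology α]
    [MeasurableSpace α] [OpensMeasurableSpace α] [Nonempty α] {κ ν τ : Measure α} [κ.OuterRegular]
    [IsFiniteMeasure κ] (h0 : ∀ x, κ {x} = 0) {p : ℝ} (hp : 2 < p) {a : ℝ≥0∞} (ha0 : a ≠ 0)
    (ha : a ≠ ⊤) (h : ∀ B, MeasurableSet B →
      a * ν B ^ (1 / p) ≤ a * τ B ^ (1 / p) + κ B ^ (1 / 2 : ℝ)) :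
    ν Set.univ ≤ τ Set.univ := by
  have hp0 : 0 < p := by linarith
  have key : ∀ ε : ℝ≥0∞, 0 < ε → a * ν Set.univ ^ (1 / p) ≤
      a * τ Set.univ ^ (1 / p) + (ε ^ (p / 2 - 1) * κ Set.univ) ^ (1 / p) := by
    intro ε hε
    obtain ⟨t, htm, htd, htu, htκ⟩ := exists_partition_measure_le h0 hε.ne'
    have hsum : ∀ m : Measure α, (∫⁻ i : ℕ, (a * m (t i) ^ (1 / p)) ^ p ∂Measure.count) ^ (1 / p) =
        a * m Set.univ ^ (1 / p) := by
      intro m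
      have h1 : ∀ i, (a * m (t i) ^ (1 / p)) ^ p = a ^ p * m (t i) := fun i => by
        rw [ENNReal.mul_rpow_of_nonneg _ _ hp0.le, ← ENNReal.rpow_mul, one_div,
          inv_mul_cancel₀ hp0.ne', ENNReal.rpow_one]
      simp_rw [h1]
      rw [lintegral_count, ENNReal.tsum_mul_left, ← measure_iUnion htd htm, htu,
        ENNReal.mul_rpow_of_nonneg _ _ (by positivity), ← ENNReal.rpow_mul, mul_one_div,
        div_self hp0.ne', ENNReal.rpow_one]
    -- As p/2 > 1, each κ(t_i)^(p/2) is at most ε^(p/2-1) κ(t_i); this gain is where p > 2 and the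
    -- small pieces are used.
    have hκ : ∫⁻ i : ℕ, (κ (t i) ^ (1 / 2 : ℝ)) ^ p ∂Measure.count ≤
        ε ^ (p / 2 - 1) * κ Set.univ := by
      rw [lintegral_count, ← htu, measure_iUnion htd htm, ← ENNReal.tsum_mul_left]
      refine ENNReal.tsum_le_tsum fun i => ?_
      rw [← ENNReal.rpow_mul, show (1 / 2 : ℝ) * p = (p / 2 - 1) + 1 by ring,
        ENNReal.rpow_add_of_nonneg _ _ (by linarith) zero_le_one, ENNReal.rpow_one]
      gcongr
      · linarith
      · exact htκ i
    rw [← hsum ν, ← hsum τ]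
    calc _ ≤ (∫⁻ i : ℕ, ((fun i => a * τ (t i) ^ (1 / p)) +
          fun i => κ (t i) ^ (1 / 2 : ℝ)) i ^ p ∂Measure.count) ^ (1 / p) := by
          gcongr with i
          exact h _ (htm i)
      -- Minkowski's inequality in ℓ^p over the pieces.
      _ ≤ _ := ENNReal.lintegral_Lp_add_le (Measurable.of_discrete.aemeasurable)
          (Measurable.of_discrete.aemeasurable) (by linarith)
      _ ≤ _ := by gcongr
  have hlim : Tendsto (fun ε : ℝ≥0∞ => a * τ Set.univ ^ (1 / p) +
      (ε ^ (p / 2 - 1) * κ Set.univ) ^ (1 / p)) (𝓝[>] 0) (𝓝 (a * τ Set.univ ^ (1 / p) +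
        ((0 : ℝ≥0∞) ^ (p / 2 - 1) * κ Set.univ) ^ (1 / p))) := by
    refine tendsto_nhdsWithin_of_tendsto_nhds (Continuous.tendsto ?_ 0)
    exact continuous_const.add (ENNReal.continuous_rpow_const.comp
      ((ENNReal.continuous_mul_const (measure_ne_top κ _)).comp ENNReal.continuous_rpow_const))
  rw [ENNReal.zero_rpow_of_pos (by linarith), zero_mul, ENNReal.zero_rpow_of_pos (by positivity),
    add_zero] at hlim
  have : (𝓝[>] (0 : ℝ≥0∞)).NeBot := inferInstance
  have h1 := ge_of_tendsto hlim (eventually_nhdsWithin_of_forall key)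
  rwa [ENNReal.mul_le_mul_iff_right ha0 ha, ENNReal.rpow_le_rpow_iff (by positivity)] at h1

lemma measure_le_of_rpow_le {κ ν τ : Measure (E n)} {p : ℝ} (hp : 2 < p) {a : ℝ≥0∞}
    (ha0 : a ≠ 0) (ha : a ≠ ⊤) (h : ∀ B, MeasurableSet B →
      a * ν B ^ (1 / p) ≤ a * τ B ^ (1 / p) + κ B ^ (1 / 2 : ℝ))
    {B : Set (E n)} (hB : MeasurableSet B) (hκB : κ B ≠ ⊤) (h0 : ∀ x ∈ B, κ {x} = 0) :
    ν B ≤ τ B := by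
  have : IsFiniteMeasure (κ.restrict B) := ⟨by simpa [lt_top_iff_ne_top] using hκB⟩
  have h1 := measure_univ_le_of_rpow_le (κ := κ.restrict B) (ν := ν.restrict B)
    (τ := τ.restrict B) (fun x => ?_) hp ha0 ha (fun A hA => ?_)
  · simpa using h1
  · rw [Measure.restrict_apply (measurableSet_singleton x)]
    by_cases hx : x ∈ B
    · exact measure_mono_null Set.inter_subset_left (h0 x hx)
    · rw [Set.singleton_inter_eq_empty.2 hx, measure_empty]
  · simp only [Measure.restrict_apply hA]
    exact h _ (hA.inter hB)

/-- Away from the atoms of `κ` the two measures agree. -/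
lemma restrict_compl_eq_of_rpow_le {κ ν τ : Measure (E n)} [SigmaFinite κ] {p : ℝ} (hp : 2 < p)
    {a : ℝ≥0∞} (ha0 : a ≠ 0) (ha : a ≠ ⊤)
    (h : ∀ B, MeasurableSet B → a * ν B ^ (1 / p) ≤ a * τ B ^ (1 / p) + κ B ^ (1 / 2 : ℝ))
    (h' : ∀ B, MeasurableSet B → a * τ B ^ (1 / p) ≤ a * ν B ^ (1 / p) + κ B ^ (1 / 2 : ℝ))
    {D : Set (E n)} (hD : MeasurableSet D) (h0 : ∀ x ∉ D, κ {x} = 0) :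
    ν.restrict Dᶜ = τ.restrict Dᶜ := by
  -- κ is only σ-finite, so the comparison, which needs finite κ-mass, is made on each set of an
  -- exhaustion.
  rw [Measure.ext_iff_of_iUnion_eq_univ (iUnion_spanningSets κ)]
  intro i
  ext B hB
  have hm := hB.inter (measurableSet_spanningSets κ i)
  have hκ : κ (B ∩ spanningSets κ i ∩ Dᶜ) ≠ ⊤ :=
    ((measure_mono (Set.inter_subset_left.trans Set.inter_subset_right)).trans_lt
      (measure_spanningSets_lt_top κ i)).ne
  rw [Measure.restrict_apply hB, Measure.restrict_apply hB, Measure.restrict_apply hm,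
    Measure.restrict_apply hm]
  exact le_antisymm
    (measure_le_of_rpow_le hp ha0 ha h (hm.inter hD.compl) hκ fun x hx => h0 x hx.2)
    (measure_le_of_rpow_le hp ha0 ha h' (hm.inter hD.compl) hκ fun x hx => h0 x hx.2)

lemma countable_atoms {κ : Measure (E n)} [SigmaFinite κ] : {x | κ {x} ≠ 0}.Countable := by
  have := Measure.countable_meas_pos_of_disjoint_iUnion (μ := κ) (As := fun x : E n => {x})
    (fun x => measurableSet_singleton x) fun x y hxy => by simpa using hxy
  simpa only [pos_iff_ne_zero] using this

lemma restrict_image_eq_sum {Y Z : Type*} [MeasurableSpace Z] [MeasurableSingletonClass Z]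
    (m : Measure Z) {D : Set Y} (hD : D.Countable) {f : Y → Z} (hf : Function.Injective f) :
    m.restrict (f '' D) = Measure.sum fun x : D => m {f x} • Measure.dirac (f x) := by
  have h1 : f '' D = ⋃ x ∈ D, {f x} := by ext; simp [eq_comm]
  rw [h1, Measure.restrict_biUnion hD (fun x _ y _ hxy => by simpa using hf.ne hxy)
    fun x => measurableSet_singleton _]
  simp_rw [Measure.restrict_singleton]

end CCP

end

/-! ### The decomposition of the limit measures. -/

theorem mainTheorem6 (n : ℕ) (s : ℝ) (hs0 : 0 < s) (hs1 : s < 1) (hns : 2 * s < n)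
    (U : ℕ → CCP.X n → ℝ) (V : CCP.X n → ℝ)
    (hU : ∀ k, CCP.MemHalf s (U k)) (hV : CCP.MemHalf s V)
    (hbdd : CCP.IsBoundedSeq s U) (htight : CCP.IsTightSeq s U)
    (hweak : CCP.WeaklyTendsto s U V)
    (μ : Measure (CCP.X n)) (ν : Measure (CCP.E n))
    [IsLocallyFiniteMeasure μ] [IsLocallyFiniteMeasure ν]
    (hμsupp : μ (CCP.closedHalf n)ᶜ = 0)
    (hμ : CCP.MeasTendsto (fun k => CCP.energyMeas s (U k)) μ)
    (hν : CCP.MeasTendsto (fun k => CCP.traceMeas s (U k)) ν) :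
    ∃ (J : Type) (_ : Countable J) (x : J → CCP.E n) (νj μj : J → ℝ),
      Function.Injective x ∧ (∀ j, 0 ≤ νj j) ∧ (∀ j, 0 ≤ μj j) ∧
      ν = CCP.traceMeas s V +
        Measure.sum (fun j => ENNReal.ofReal (νj j) • Measure.dirac (x j)) ∧
      CCP.energyMeas s V +
        Measure.sum (fun j => ENNReal.ofReal (μj j) • Measure.dirac (CCP.pt (x j) 0)) ≤ μ ∧
      ∀ j, CCP.sobolevConst n s * (νj j) ^ (2 / CCP.critExp n s) ≤ μj j := by
  have hp2 := CCP.two_lt_critExp hs0 hns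
  have hp : 0 < CCP.critExp n s := by linarith
  -- In dimension 0 Lebesgue measure is a point mass; n > 0 is what makes τ free of atoms.
  have hn : 0 < n := by
    rcases Nat.eq_zero_or_pos n with rfl | h
    · simp at hns; linarith
    · exact h
  have : Nonempty (Fin n) := ⟨⟨0, hn⟩⟩
  have hfτ := CCP.isFiniteMeasure_traceMeas hs0 hs1 hns hV
  have hcut := fun (a : ℝ≥0∞) (ha : a ≠ ⊤) (hσ : ∀ Z : CCP.X n → ℝ, CCP.MemHalf s Z → a *
      eLpNorm (CCP.trace s Z) (ENNReal.ofReal (CCP.critExp n s)) volume ≤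
        eLpNorm (CCP.grad Z) 2 (CCP.halfMeas n s)) (η : CCP.X n → ℝ) (hη : CCP.IsTest η)
      (heven : ∀ P, η (CCP.reflect n P) = η P) =>
    CCP.eLpNorm_cutoff_le hs0 hs1 hns hU hV hbdd hweak hμ hν ha hσ hη heven
  set τ := CCP.traceMeas s V with hτ
  have hι := CCP.isClosedEmbedding_pt (n := n)
  set ι : CCP.E n → CCP.X n := fun x => CCP.pt x 0 with hιdef
  have hκ : ∀ B, μ.comap ι B = μ (ι '' B) := hι.measurableEmbedding.comap_apply μ
  have hτ0 : ∀ x, τ {x} = 0 := fun x =>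
    withDensity_absolutelyContinuous _ _ (measure_singleton x)
  have : IsFiniteMeasureOnCompacts (μ.comap ι) := ⟨fun K hK => by
    rw [hκ]; exact (hK.image hι.continuous).measure_lt_top⟩
  obtain ⟨a, ha0, ha, hσ⟩ := CCP.exists_mul_eLpNorm_trace_le (n := n) hs0 hs1 hns
  have hB := fun B (hBm : MeasurableSet B) => CCP.rpow_measure_le hp ha0 ha (fun K hK =>
    CCP.rpow_measure_compact_le hp ha (fun η h1 h2 => (hcut a ha hσ η h1 h2).1) hK) hBm
  have hB' := fun B (hBm : MeasurableSet B) => CCP.rpow_measure_le hp ha0 ha (fun K hK =>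
    CCP.rpow_measure_compact_le hp ha (fun η h1 h2 => (hcut a ha hσ η h1 h2).2) hK) hBm
  simp_rw [← hιdef, ← hκ] at hB hB'
  -- The index set consists of the atoms of μ on the boundary. Atoms of ν are among them, since ν
  -- equals the atomless τ off D; some weights ν_j may be 0.
  set D : Set (CCP.E n) := {x | μ.comap ι {x} ≠ 0} with hDdef
  have hD : D.Countable := CCP.countable_atoms
  have hνfin : ∀ x, ν {x} ≠ ⊤ := fun x => isCompact_singleton.measure_lt_top.ne
  have hμfin : ∀ P, μ {P} ≠ ⊤ := fun P => isCompact_singleton.measure_lt_top.ne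
  refine ⟨D, hD.to_subtype, Subtype.val, fun x => (ν {x.1}).toReal, fun x => (μ {ι x.1}).toReal,
    Subtype.val_injective, fun _ => ENNReal.toReal_nonneg, fun _ => ENNReal.toReal_nonneg,
    ?_, ?_, fun x => ?_⟩
  · have h1 := CCP.restrict_compl_eq_of_rpow_le hp2 ha0 ha hB hB' hD.measurableSet
      fun x hx => not_not.1 hx
    have h2 : τ.restrict Dᶜ = τ := by
      refine Measure.restrict_eq_self_of_ae_mem ?_
      have : NullSingletonClass τ := ⟨hτ0⟩
      exact measure_eq_zero_iff_ae_notMem.1 (hD.measure_zero τ)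
    have h3 := CCP.restrict_image_eq_sum ν hD Function.injective_id
    rw [Set.image_id] at h3
    simp only [id] at h3
    simp_rw [ENNReal.ofReal_toReal (hνfin _), ← h3]
    rw [← h2, ← h1, add_comm, Measure.restrict_add_restrict_compl hD.measurableSet]
  · have hDm : MeasurableSet (ι '' D) := (hD.image ι).measurableSet
    simp_rw [ENNReal.ofReal_toReal (hμfin _)]
    have h3 := CCP.restrict_image_eq_sum μ hD hι.injective
    rw [← h3]
    -- The energy measure of V is carried by the open half-space, so it lives off the boundary
    -- atoms; the bound by μ is used only there, and the atoms of μ are added at no cost.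
    have h4 : (CCP.energyMeas s V).restrict (ι '' D)ᶜ = CCP.energyMeas s V := by
      refine Measure.restrict_eq_self_of_ae_mem ?_
      refine (withDensity_absolutelyContinuous _ _).ae_le ?_
      filter_upwards [ae_restrict_mem CCP.measurableSet_half] with P hP
      rintro ⟨x, -, rfl⟩
      exact lt_irrefl (0 : ℝ) hP
    rw [← h4, add_comm]
    refine le_trans ?_ (Measure.restrict_add_restrict_compl (μ := μ) hDm).le
    exact add_le_add_right (Measure.restrict_mono le_rfl
      (CCP.energyMeas_le hs1 hU hV hbdd hweak hμ)) _
  -- The compact set is a single point, where τ vanishes; what remains is √S ν_j^(1/p) ≤ μ_j^(1/2),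
  -- to be squared.
  · have h1 := CCP.rpow_measure_compact_le hp ENNReal.ofReal_ne_top (fun η h1 h2 =>
      (hcut _ ENNReal.ofReal_ne_top (fun Z hZ => CCP.sqrt_sobolevConst_mul_le hs0 hs1 hns hZ)
        η h1 h2).1) (isCompact_singleton (x := x.1))
    rw [hτ0, ENNReal.zero_rpow_of_pos (by positivity), mul_zero, zero_add,
      Set.image_singleton] at h1
    have h2 := ENNReal.toReal_mono (by finiteness [hμfin (ι x)]) h1
    rw [ENNReal.toReal_mul, ENNReal.toReal_ofReal (Real.sqrt_nonneg _), ← ENNReal.toReal_rpow,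
      ← ENNReal.toReal_rpow, ← Real.sqrt_eq_rpow] at h2
    have h3 := pow_le_pow_left₀ (by positivity) h2 2
    rw [mul_pow, Real.sq_sqrt CCP.sobolevConst_nonneg, Real.sq_sqrt ENNReal.toReal_nonneg,
      ← Real.rpow_natCast, ← Real.rpow_mul ENNReal.toReal_nonneg] at h3
    rw [show 2 / CCP.critExp n s = 1 / CCP.critExp n s * (2 : ℕ) by push_cast; ring]
    exact h3
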